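/- Let $p$ be a prime and $d > 1$ an integer. Let $\mathrm{Rat}_d \subset \mathbb{P}^{2d+1}_{\mathbb{F}_p}$ be the open subscheme of those $(a_d : \cdots : a_0 : b_d : \cdots : b_0)$ for which the degree-$(d,d)$ resultant of $f = \sum_{i=0}^d a_i z^i$ and $g = \sum_{i=0}^d b_i z^i$ does not vanish (the space of rational functions $f/g$ of degree $d$), and let $\mathrm{Insep}_d \subset \mathrm{Rat}_d$ be the closed locus where $a_i = b_i = 0$ for all $i$ with $p \nmid i$. Write $f'g - fg' = \sum_{i=0}^{2d-2} c_i z^i$ and let $\omega : \mathrm{Rat}_d \smallsetminus \mathrm{Insep}_d \to \mathbb{P}^{2d-2}_{\mathbb{F}_p}$ be the morphism $f/g \mapsto (c_{2d-2} : \cdots : c_0)$. Let $C \subset \mathbb{P}^{2d-2}_{\mathbb{F}_p}$ be the (scheme-theoretic) image of the morphism $\theta : \mathbb{P}^1_{\mathbb{F}_p} \to \mathbb{P}^{2d-2}_{\mathbb{F}_p}$, $(s:t) \mapsto (\theta_{2d-2}(s,t) : \cdots : \theta_0(s,t))$, where $(tz-s)^{2d-2} = \sum_{i=0}^{2d-2}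 \theta_i(s,t) z^i$. The unicritical locus $U_d$ is the fibre product of $\omega$ and the inclusion $C \hookrightarrow \mathbb{P}^{2d-2}_{\mathbb{F}_p}$; it is a closed subscheme of $\mathrm{Rat}_d \smallsetminus \mathrm{Insep}_d$ whose geometric points are the rational functions of degree $d$ with exactly one critical point. **Theorem.** If $d \not\equiv 0, 1 \pmod p$, then $U_d$ is empty. Otherwise $U_d$ is an irreducible quasi-projective variety over $\mathbb{F}_p$ (an integral, separated scheme of finite type over $\mathbb{F}_p$ that admits an immersion into some projective space over $\mathbb{F}_p$), it is rational over $\mathbb{F}_p$ (birational over $\mathbb{F}_p$ to an affine space), and $$\dim(U_d) = \begin{cases} 3 + 2d/p & \text{if } p \mid d, \\ 4 + 2(d-1)/p & \text{if } p \mid d-1. \end{cases}$$ -/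

import Mathlib

open CategoryTheory CategoryTheory.Limits AlgebraicGeometry

noncomputable section

namespace Unicritical

/-! ### Projective space and morphisms given by homogeneous forms -/

/-- The standard grading of `R[x_i : i ∈ σ]` by total degree. -/
abbrev grading (R σ : Type) [CommRing R] : ℕ → Submodule R (MvPolynomial σ R) :=
  MvPolynomial.homogeneousSubmodule σ R

instance gradingAlgebra (R σ : Type) [CommRing R] : GradedAlgebra (grading R σ) :=
  MvPolynomial.gradedAlgebra

/-- Projective space over `Spec R` with homogeneous coordinates indexed by `σ`
(so `ℙ^n` when `σ` has `n + 1` elements). -/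
abbrev ProjSpace (R σ : Type) [CommRing R] : Scheme.{0} :=
  Proj (grading R σ)

/-- The structure morphism of projective space. -/
def ProjSpace.toSpec (R σ : Type) [CommRing R] : ProjSpace R σ ⟶ Spec (.of R) :=
  Proj.toSpecZero (grading R σ) ≫
    Spec.map (CommRingCat.ofHom (algebraMap R (grading R σ 0)))

section Forms

variable {R σ τ : Type} [CommRing R]

/-- The substitution `y_i ↦ c_i`. -/
abbrev subst (c : τ → MvPolynomial σ R) : MvPolynomial τ R →ₐ[R] MvPolynomial σ R :=
  MvPolynomial.aeval c

lemma subst_mem {c : τ → MvPolynomial σ R} {r : ℕ} (hc : ∀ i, (c i).IsHomogeneous r)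
    {k : ℕ} {a : MvPolynomial τ R} (ha : a ∈ grading R τ k) :
    subst c a ∈ grading R σ (r * k) :=
  MvPolynomial.IsHomogeneous.aeval ha c hc

lemma X_mem (i : τ) : (MvPolynomial.X i : MvPolynomial τ R) ∈ grading R τ 1 :=
  MvPolynomial.isHomogeneous_X R i

lemma powers_le_comap_subst (c : τ → MvPolynomial σ R) (s : MvPolynomial τ R) :
    Submonoid.powers s ≤ (Submonoid.powers (subst c s)).comap (subst c).toRingHom := by
  rintro _ ⟨n, rfl⟩
  exact ⟨n, by simp⟩

/-- The substitution `y_i ↦ c_i` on all fractions, `a / s ^ n ↦ a(c) / s(c) ^ n`. -/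
def substLoc (c : τ → MvPolynomial σ R) (s : MvPolynomial τ R) :
    Localization.Away s →+* Localization.Away (subst c s) :=
  IsLocalization.map (Localization (Submonoid.powers (subst c s)))
    (subst c).toRingHom (powers_le_comap_subst c s)

/-- Underlying function of `substAway`. -/
def substAwayFun (c : τ → MvPolynomial σ R) {r : ℕ} (hc : ∀ i, (c i).IsHomogeneous r)
    (s : MvPolynomial τ R) :
    HomogeneousLocalization.Away (grading R τ) s →
      HomogeneousLocalization.Away (grading R σ) (subst c s) :=
  Quotient.map'
    (fun x ↦ ⟨r * x.1, ⟨_, subst_mem hc x.2.2⟩, ⟨_, subst_mem hc x.3.2⟩,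
      powers_le_comap_subst c s x.4⟩)
    fun x y (e : x.embedding = y.embedding) ↦ by
      apply_fun substLoc c s at e
      simp_rw [substLoc, HomogeneousLocalization.NumDenSameDeg.embedding, Localization.mk_eq_mk',
        IsLocalization.map_mk', ← Localization.mk_eq_mk'] at e
      exact e

lemma val_substAwayFun (c : τ → MvPolynomial σ R) {r : ℕ} (hc : ∀ i, (c i).IsHomogeneous r)
    (s : MvPolynomial τ R) (z : HomogeneousLocalization.Away (grading R τ) s) :
    (substAwayFun c hc s z).val = substLoc c s z.val := by
  obtain ⟨x, rfl⟩ := HomogeneousLocalization.mk_surjective z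
  rw [HomogeneousLocalization.val_mk, substLoc, Localization.mk_eq_mk', IsLocalization.map_mk',
    ← Localization.mk_eq_mk']
  rfl

/-- For forms `c_i` of the same degree `r`, the substitution `y_i ↦ c_i` induces a ring map on
degree-zero fractions, `a / s ^ n ↦ a(c) / s(c) ^ n`. -/
def substAway (c : τ → MvPolynomial σ R) {r : ℕ} (hc : ∀ i, (c i).IsHomogeneous r)
    (s : MvPolynomial τ R) :
    HomogeneousLocalization.Away (grading R τ) s →+*
      HomogeneousLocalization.Away (grading R σ) (subst c s) where
  toFun := substAwayFun c hc s
  map_add' x y := by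
    apply HomogeneousLocalization.val_injective
    simp only [val_substAwayFun, HomogeneousLocalization.val_add, map_add]
  map_mul' x y := by
    apply HomogeneousLocalization.val_injective
    simp only [val_substAwayFun, HomogeneousLocalization.val_mul, map_mul]
  map_zero' := by
    apply HomogeneousLocalization.val_injective
    simp only [val_substAwayFun, HomogeneousLocalization.val_zero, map_zero]
  map_one' := by
    apply HomogeneousLocalization.val_injective
    simp only [val_substAwayFun, HomogeneousLocalization.val_one, map_one]

lemma val_substAway (c : τ → MvPolynomial σ R) {r : ℕ} (hc : ∀ i, (c i).IsHomogeneous r)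
    (s : MvPolynomial τ R) (z : HomogeneousLocalization.Away (grading R τ) s) :
    (substAway c hc s z).val = substLoc c s z.val :=
  val_substAwayFun c hc s z

lemma subst_X (c : τ → MvPolynomial σ R) (i : τ) : subst c (MvPolynomial.X i) = c i := by
  simp

lemma substAway_comp_awayMap (c : τ → MvPolynomial σ R) {r : ℕ}
    (hc : ∀ i, (c i).IsHomogeneous r) {f g x : MvPolynomial τ R} {k : ℕ}
    (hg : g ∈ grading R τ k) (hx : x = f * g) (hg' : subst c g ∈ grading R σ (r * k))
    (hx' : subst c x = subst c f * subst c g) :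
    (HomogeneousLocalization.awayMap (grading R σ) hg' hx').comp (substAway c hc f) =
      (substAway c hc x).comp (HomogeneousLocalization.awayMap (grading R τ) hg hx) := by
  ext z
  simp only [RingHom.comp_apply, val_substAway, HomogeneousLocalization.val_awayMap]
  generalize z.val = w
  rw [← RingHom.comp_apply, ← RingHom.comp_apply (substLoc c x)]
  congr 1
  apply IsLocalization.ringHom_ext (Submonoid.powers f)
  refine RingHom.ext fun a ↦ ?_
  simp only [RingHom.comp_apply, substLoc, Localization.awayLift, IsLocalization.map_eq,
    IsLocalization.Away.lift_eq]

/-- The chart `D₊(c_i) ⟶ ℙ^τ` of the morphism `(c_j)_j`, with `y_j / y_i ↦ c_j / c_i`. -/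
def formsChart (c : τ → MvPolynomial σ R) {r : ℕ} (hc : ∀ i, (c i).IsHomogeneous r) (i : τ) :
    Spec (.of (HomogeneousLocalization.Away (grading R σ) (subst c (MvPolynomial.X i)))) ⟶ ProjSpace R τ :=
  Spec.map (CommRingCat.ofHom (substAway c hc (MvPolynomial.X i))) ≫
    Proj.awayι (grading R τ) (MvPolynomial.X i) (X_mem i) one_pos

/-- The complement of the base locus of a family of forms: the open set where at least one of
them does not vanish. -/
def formsLocus (c : τ → MvPolynomial σ R) : (ProjSpace R σ).Opens :=
  ⨆ i, Proj.basicOpen (grading R σ) (c i)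

/-- The affine open `Spec (R[x]_{(c_i)}) ⟶ ℙ^σ`, with image `D₊(c_i)`. -/
abbrev sourceChart (c : τ → MvPolynomial σ R) {r : ℕ} (hc : ∀ i, (c i).IsHomogeneous r)
    (hr : 0 < r) (i : τ) :
    Spec (.of (HomogeneousLocalization.Away (grading R σ) (subst c (MvPolynomial.X i)))) ⟶ ProjSpace R σ :=
  Proj.awayι (grading R σ) (subst c (MvPolynomial.X i)) (m := r * 1)
    (subst_mem hc (X_mem i)) (by omega)

lemma opensRange_sourceChart (c : τ → MvPolynomial σ R) {r : ℕ}
    (hc : ∀ i, (c i).IsHomogeneous r) (hr : 0 < r) (i : τ) :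
    (sourceChart c hc hr i).opensRange = Proj.basicOpen (grading R σ) (c i) := by
  exact (Proj.opensRange_awayι _ _ _ _).trans (by rw [subst_X])

lemma formsChart_compat (c : τ → MvPolynomial σ R) {r : ℕ}
    (hc : ∀ i, (c i).IsHomogeneous r) (hr : 0 < r) (i j : τ) :
    pullback.fst (sourceChart c hc hr i) (sourceChart c hc hr j) ≫ formsChart c hc i =
      pullback.snd (sourceChart c hc hr i) (sourceChart c hc hr j) ≫ formsChart c hc j := by
  have hi := X_mem (R := R) i
  have hj := X_mem (R := R) j
  have hx : subst c (MvPolynomial.X i * MvPolynomial.X j) = subst c (MvPolynomial.X i) * subst c (MvPolynomial.X j) := map_mul _ _ _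
  have h1 : pullback.fst (sourceChart c hc hr i) (sourceChart c hc hr j) = _ :=
    (Proj.pullbackAwayιIso_hom_SpecMap_awayMap_left (grading R σ)
      (subst_mem hc hi) (by omega) (subst_mem hc hj) (by omega) hx).symm
  have h2 : pullback.snd (sourceChart c hc hr i) (sourceChart c hc hr j) = _ :=
    (Proj.pullbackAwayιIso_hom_SpecMap_awayMap_right (grading R σ)
      (subst_mem hc hi) (by omega) (subst_mem hc hj) (by omega) hx).symm
  rw [h1, h2, Category.assoc, Category.assoc]
  congr 1
  rw [formsChart, formsChart, ← Spec.map_comp_assoc, ← Spec.map_comp_assoc,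
    ← CommRingCat.ofHom_comp, ← CommRingCat.ofHom_comp,
    substAway_comp_awayMap c hc hj rfl, substAway_comp_awayMap c hc hi (mul_comm _ _),
    CommRingCat.ofHom_comp, CommRingCat.ofHom_comp, Spec.map_comp_assoc, Spec.map_comp_assoc,
    Proj.SpecMap_awayMap_awayι, Proj.SpecMap_awayMap_awayι]

/-- The chart `sourceChart` of `ℙ^σ`, viewed as a chart of the complement of the base locus. -/
def locusChart (c : τ → MvPolynomial σ R) {r : ℕ} (hc : ∀ i, (c i).IsHomogeneous r)
    (hr : 0 < r) (i : τ) :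
    Spec (.of (HomogeneousLocalization.Away (grading R σ) (subst c (MvPolynomial.X i)))) ⟶
      (formsLocus c).toScheme :=
  IsOpenImmersion.lift (formsLocus c).ι (sourceChart c hc hr i) (by
    rw [Scheme.Opens.range_ι, ← Scheme.Hom.coe_opensRange, opensRange_sourceChart]
    exact le_iSup (fun i ↦ Proj.basicOpen (grading R σ) (c i)) i)

lemma locusChart_ι (c : τ → MvPolynomial σ R) {r : ℕ} (hc : ∀ i, (c i).IsHomogeneous r)
    (hr : 0 < r) (i : τ) : locusChart c hc hr i ≫ (formsLocus c).ι = sourceChart c hc hr i :=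
  IsOpenImmersion.lift_fac _ _ _

instance isOpenImmersion_locusChart (c : τ → MvPolynomial σ R) {r : ℕ}
    (hc : ∀ i, (c i).IsHomogeneous r) (hr : 0 < r) (i : τ) :
    IsOpenImmersion (locusChart c hc hr i) := by
  have : IsOpenImmersion (locusChart c hc hr i ≫ (formsLocus c).ι) := by
    rw [locusChart_ι]; infer_instance
  exact IsOpenImmersion.of_comp _ (formsLocus c).ι

/-- The charts `D₊(c_i)` as an open cover of the complement of the base locus. -/
def formsCover (c : τ → MvPolynomial σ R) {r : ℕ} (hc : ∀ i, (c i).IsHomogeneous r)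
    (hr : 0 < r) : (formsLocus c).toScheme.OpenCover :=
  Scheme.Cover.mkOfCovers τ
    (fun i ↦ Spec (.of (HomogeneousLocalization.Away (grading R σ)
      (subst c (MvPolynomial.X i)))))
    (fun i ↦ locusChart c hc hr i)
    (fun x ↦ by
      obtain ⟨i, hi⟩ := TopologicalSpace.Opens.mem_iSup.mp x.2
      rw [← opensRange_sourceChart c hc hr i] at hi
      obtain ⟨y, hy⟩ := hi
      refine ⟨i, y, (formsLocus c).ι.isOpenEmbedding.injective ?_⟩
      rw [← Scheme.Hom.comp_apply, locusChart_ι]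
      exact hy)
    (fun i ↦ isOpenImmersion_locusChart c hc hr i)

lemma locusChart_compat (c : τ → MvPolynomial σ R) {r : ℕ}
    (hc : ∀ i, (c i).IsHomogeneous r) (hr : 0 < r) (i j : τ) :
    pullback.fst (locusChart c hc hr i) (locusChart c hc hr j) ≫ formsChart c hc i =
      pullback.snd (locusChart c hc hr i) (locusChart c hc hr j) ≫ formsChart c hc j := by
  have h : pullback.fst (locusChart c hc hr i) (locusChart c hc hr j) ≫ sourceChart c hc hr i =
      pullback.snd (locusChart c hc hr i) (locusChart c hc hr j) ≫ sourceChart c hc hr j := by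
    rw [← locusChart_ι, ← locusChart_ι, pullback.condition_assoc]
  have key := congrArg (pullback.lift _ _ h ≫ ·) (formsChart_compat c hc hr i j)
  simp only [pullback.lift_fst_assoc, pullback.lift_snd_assoc] at key
  exact key

/-- The morphism `x ↦ (c_i(x))_i` to projective space defined by forms `c_i` of the same positive
degree, on the complement of their base locus. -/
def formsMorphism (c : τ → MvPolynomial σ R) {r : ℕ} (hc : ∀ i, (c i).IsHomogeneous r)
    (hr : 0 < r) : (formsLocus c).toScheme ⟶ ProjSpace R τ :=
  (formsCover c hc hr).glueMorphisms (fun i ↦ formsChart c hc i)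
    (fun i j ↦ locusChart_compat c hc hr i j)

lemma locusChart_formsMorphism (c : τ → MvPolynomial σ R) {r : ℕ}
    (hc : ∀ i, (c i).IsHomogeneous r) (hr : 0 < r) (i : τ) :
    locusChart c hc hr i ≫ formsMorphism c hc hr = formsChart c hc i :=
  (formsCover c hc hr).ι_glueMorphisms _ _ i

lemma coeff_mul_isHomogeneous {P Q : Polynomial (MvPolynomial σ R)} {k l : ℕ}
    (hP : ∀ n, (P.coeff n).IsHomogeneous k) (hQ : ∀ n, (Q.coeff n).IsHomogeneous l) (n : ℕ) :
    ((P * Q).coeff n).IsHomogeneous (k + l) := by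
  rw [Polynomial.coeff_mul]
  exact MvPolynomial.IsHomogeneous.sum _ _ _ fun x _ ↦ (hP x.1).mul (hQ x.2)

lemma coeff_pow_isHomogeneous {P : Polynomial (MvPolynomial σ R)}
    (hP : ∀ n, (P.coeff n).IsHomogeneous 1) (m n : ℕ) :
    ((P ^ m).coeff n).IsHomogeneous m := by
  induction m generalizing n with
  | zero =>
    rw [pow_zero, Polynomial.coeff_one]
    split_ifs
    · exact MvPolynomial.isHomogeneous_one σ R
    · exact MvPolynomial.isHomogeneous_zero σ R 0
  | succ m ih =>
    rw [pow_succ]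
    exact coeff_mul_isHomogeneous ih hP n

lemma coeff_derivative_isHomogeneous {P : Polynomial (MvPolynomial σ R)} {k : ℕ}
    (hP : ∀ n, (P.coeff n).IsHomogeneous k) (n : ℕ) :
    ((Polynomial.derivative P).coeff n).IsHomogeneous k := by
  rw [Polynomial.coeff_derivative]
  have h := (hP (n + 1)).mul (MvPolynomial.isHomogeneous_C σ ((n : R) + 1))
  simpa using h

end Forms

/-! ### The space of rational functions -/

/-- Index set for the homogeneous coordinates `(a_d : ⋯ : a_0 : b_d : ⋯ : b_0)` on `ℙ^{2d+1}`:
`Sum.inl i` stands for `a_i` and `Sum.inr i` for `b_i`. -/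
abbrev CoeffIdx (d : ℕ) : Type := Fin (d + 1) ⊕ Fin (d + 1)

section Rat

variable (R : Type) [CommRing R] (d : ℕ)

/-- The generic numerator `f(z) = a_d z^d + ⋯ + a_0`. -/
def genNum : Polynomial (MvPolynomial (CoeffIdx d) R) :=
  ∑ i : Fin (d + 1), Polynomial.C (MvPolynomial.X (Sum.inl i)) * Polynomial.X ^ (i : ℕ)

/-- The generic denominator `g(z) = b_d z^d + ⋯ + b_0`. -/
def genDen : Polynomial (MvPolynomial (CoeffIdx d) R) :=
  ∑ i : Fin (d + 1), Polynomial.C (MvPolynomial.X (Sum.inr i)) * Polynomial.X ^ (i : ℕ)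

/-- The degree-`(d, d)` resultant of `f` and `g`. -/
def genRes : MvPolynomial (CoeffIdx d) R :=
  Polynomial.resultant (genNum R d) (genDen R d) d d

/-- `Rat_d = ℙ^{2d+1} ∖ {Res(f, g) = 0}`. -/
def Rat : (ProjSpace R (CoeffIdx d)).Opens :=
  Proj.basicOpen (grading R (CoeffIdx d)) (genRes R d)

/-- The coefficients `c_i`, `0 ≤ i ≤ 2d - 2`, of
`f'(z) g(z) - f(z) g'(z) = c_{2d-2} z^{2d-2} + ⋯ + c_0`. -/
def critForm (i : Fin (2 * d - 1)) : MvPolynomial (CoeffIdx d) R :=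
  (Polynomial.derivative (genNum R d) * genDen R d -
    genNum R d * Polynomial.derivative (genDen R d)).coeff i

lemma coeff_genNum (n : ℕ) : (genNum R d).coeff n =
    if h : n < d + 1 then MvPolynomial.X (Sum.inl ⟨n, h⟩) else 0 := by
  simp only [genNum, Polynomial.finsetSum_coeff, Polynomial.coeff_C_mul_X_pow]
  split_ifs with h
  · rw [Finset.sum_eq_single ⟨n, h⟩]
    · simp
    · intro b _ hb
      exact if_neg fun h' ↦ hb (Fin.ext h'.symm)
    · simp
  · exact Finset.sum_eq_zero fun b _ ↦ if_neg fun h' ↦ h (by rw [h']; exact b.2)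

lemma coeff_genDen (n : ℕ) : (genDen R d).coeff n =
    if h : n < d + 1 then MvPolynomial.X (Sum.inr ⟨n, h⟩) else 0 := by
  simp only [genDen, Polynomial.finsetSum_coeff, Polynomial.coeff_C_mul_X_pow]
  split_ifs with h
  · rw [Finset.sum_eq_single ⟨n, h⟩]
    · simp
    · intro b _ hb
      exact if_neg fun h' ↦ hb (Fin.ext h'.symm)
    · simp
  · exact Finset.sum_eq_zero fun b _ ↦ if_neg fun h' ↦ h (by rw [h']; exact b.2)

lemma natDegree_genNum_le : (genNum R d).natDegree ≤ d := by
  rw [Polynomial.natDegree_le_iff_coeff_eq_zero]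
  intro n hn
  rw [coeff_genNum, dif_neg (by omega)]

lemma natDegree_genDen_le : (genDen R d).natDegree ≤ d := by
  rw [Polynomial.natDegree_le_iff_coeff_eq_zero]
  intro n hn
  rw [coeff_genDen, dif_neg (by omega)]

lemma critForm_isHomogeneous (i : Fin (2 * d - 1)) : (critForm R d i).IsHomogeneous 2 := by
  have hf : ∀ n, ((genNum R d).coeff n).IsHomogeneous 1 := fun n ↦ by
    rw [coeff_genNum]
    split_ifs
    · exact MvPolynomial.isHomogeneous_X R _
    · exact MvPolynomial.isHomogeneous_zero _ R 1
  have hg : ∀ n, ((genDen R d).coeff n).IsHomogeneous 1 := fun n ↦ by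
    rw [coeff_genDen]
    split_ifs
    · exact MvPolynomial.isHomogeneous_X R _
    · exact MvPolynomial.isHomogeneous_zero _ R 1
  rw [critForm, Polynomial.coeff_sub]
  exact (coeff_mul_isHomogeneous (coeff_derivative_isHomogeneous hf) hg i).sub
    (coeff_mul_isHomogeneous hf (coeff_derivative_isHomogeneous hg) i)

/-- The coefficients `θ_i(s, t)`, `0 ≤ i ≤ 2d - 2`, of `(t z - s)^{2d-2}`, where `s, t` are the
homogeneous coordinates `X 0, X 1` on `ℙ^1`. -/
def thetaForm (i : Fin (2 * d - 1)) : MvPolynomial (Fin 2) R :=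
  Polynomial.coeff ((Polynomial.C (MvPolynomial.X 1) * Polynomial.X -
    Polynomial.C (MvPolynomial.X 0)) ^ (2 * d - 2)) i

lemma thetaForm_isHomogeneous (i : Fin (2 * d - 1)) :
    (thetaForm R d i).IsHomogeneous (2 * d - 2) := by
  refine coeff_pow_isHomogeneous (fun n ↦ ?_) _ _
  rw [Polynomial.coeff_sub]
  refine MvPolynomial.IsHomogeneous.sub ?_ ?_
  · rw [Polynomial.coeff_C_mul, Polynomial.coeff_X]
    split_ifs
    · rw [mul_one]; exact MvPolynomial.isHomogeneous_X R _
    · rw [mul_zero]; exact MvPolynomial.isHomogeneous_zero _ R 1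
  · rw [Polynomial.coeff_C]
    split_ifs
    · exact MvPolynomial.isHomogeneous_X R _
    · exact MvPolynomial.isHomogeneous_zero _ R 1

lemma iSup_basicOpen_X (σ : Type) :
    ⨆ i, Proj.basicOpen (grading R σ) (MvPolynomial.X i) = ⊤ := by
  refine Proj.iSup_basicOpen_eq_top' _ _ (fun i ↦ ⟨1, X_mem i⟩) (top_unique fun a _ ↦ ?_)
  induction a using MvPolynomial.induction_on with
  | C a =>
    exact Subalgebra.algebraMap_mem (Algebra.adjoin (grading R σ 0) _)
      (⟨MvPolynomial.C a, MvPolynomial.isHomogeneous_C σ a⟩ : grading R σ 0)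
  | add a b ha hb => exact add_mem (ha trivial) (hb trivial)
  | mul_X a i ha => exact mul_mem (ha trivial) (Algebra.subset_adjoin ⟨i, rfl⟩)

/-- `θ` has no base point: the forms `θ_i` have no common zero on `ℙ^1`. -/
lemma formsLocus_thetaForm (hd : 1 < d) : formsLocus (thetaForm R d) = ⊤ := by
  rw [← top_le_iff, ← iSup_basicOpen_X R (Fin 2)]
  have h0 : thetaForm R d ⟨0, by omega⟩ = (-MvPolynomial.X 0) ^ (2 * d - 2) := by
    rw [thetaForm, Polynomial.coeff_zero_eq_eval_zero]
    simp
  have h1 : thetaForm R d ⟨2 * d - 2, by omega⟩ = MvPolynomial.X 1 ^ (2 * d - 2) := by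
    have hP : (Polynomial.C (MvPolynomial.X 1 : MvPolynomial (Fin 2) R) * Polynomial.X -
        Polynomial.C (MvPolynomial.X 0)).natDegree ≤ 1 := by
      rw [sub_eq_add_neg, ← Polynomial.C_neg]
      exact Polynomial.natDegree_linear_le
    have := Polynomial.coeff_pow_of_natDegree_le (m := 2 * d - 2) hP
    rw [mul_one] at this
    rw [thetaForm]
    simpa using this
  refine iSup_le fun i ↦ ?_
  fin_cases i
  · refine le_trans ?_ (le_iSup (fun i ↦ Proj.basicOpen (grading R (Fin 2)) (thetaForm R d i))
      ⟨0, by omega⟩)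
    intro x hx
    simp only [Proj.mem_basicOpen] at hx ⊢
    rw [h0]
    intro h
    exact hx ((neg_mem_iff (H := x.asHomogeneousIdeal.toIdeal)).mp
      (x.isPrime.mem_of_pow_mem _ h))
  · refine le_trans ?_ (le_iSup (fun i ↦ Proj.basicOpen (grading R (Fin 2)) (thetaForm R d i))
      ⟨2 * d - 2, by omega⟩)
    intro x hx
    simp only [Proj.mem_basicOpen] at hx ⊢
    rw [h1]
    intro h
    exact hx (x.isPrime.mem_of_pow_mem _ h)

/-- The morphism `θ : ℙ^1 ⟶ ℙ^{2d-2}`, `(s : t) ↦ (θ_{2d-2}(s, t) : ⋯ : θ_0(s, t))`. -/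
def theta (hd : 1 < d) : ProjSpace R (Fin 2) ⟶ ProjSpace R (Fin (2 * d - 1)) :=
  (Scheme.topIso _).inv ≫
    Scheme.homOfLE _ (formsLocus_thetaForm R d hd).ge ≫
      formsMorphism (thetaForm R d) (thetaForm_isHomogeneous R d) (by omega)

end Rat

/-! ### The unicritical locus in characteristic `p` -/

section Unicrit

variable (p : ℕ) [Fact p.Prime] (d : ℕ)

/-- The locus of inseparable rational functions:
`Insep_d = {φ ∈ Rat_d : a_i = b_i = 0 whenever p ∤ i}`. -/
def insep : Set (ProjSpace (ZMod p) (CoeffIdx d)) :=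
  {x | x ∈ Rat (ZMod p) d ∧ ∀ i : Fin (d + 1), ¬ p ∣ (i : ℕ) →
    MvPolynomial.X (Sum.inl i) ∈ x.asHomogeneousIdeal ∧
      MvPolynomial.X (Sum.inr i) ∈ x.asHomogeneousIdeal}

/-- The open subscheme `Rat_d ∖ Insep_d` of separable rational functions. -/
def sepLocus : (ProjSpace (ZMod p) (CoeffIdx d)).Opens where
  carrier := (Rat (ZMod p) d : Set (ProjSpace (ZMod p) (CoeffIdx d))) \ insep p d
  is_open' := by
    have : (Rat (ZMod p) d : Set (ProjSpace (ZMod p) (CoeffIdx d))) \ insep p d =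
        ((Rat (ZMod p) d ⊓ ⨆ i : {i : Fin (d + 1) // ¬ p ∣ (i : ℕ)},
          Proj.basicOpen (grading (ZMod p) (CoeffIdx d)) (MvPolynomial.X (Sum.inl i.1)) ⊔
          Proj.basicOpen (grading (ZMod p) (CoeffIdx d)) (MvPolynomial.X (Sum.inr i.1)) :
            (ProjSpace (ZMod p) (CoeffIdx d)).Opens) :
          Set (ProjSpace (ZMod p) (CoeffIdx d))) := by
      ext x
      simp only [insep, Set.mem_sdiff, SetLike.mem_coe, TopologicalSpace.Opens.mem_inf,
        TopologicalSpace.Opens.mem_iSup, TopologicalSpace.Opens.mem_sup, Proj.mem_basicOpen,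
        Set.mem_ofPred_eq, Subtype.exists, exists_prop]
      constructor
      · rintro ⟨h1, h2⟩
        refine ⟨h1, ?_⟩
        by_contra! h
        exact h2 ⟨h1, h⟩
      · rintro ⟨h1, i, hi, h⟩
        refine ⟨h1, fun h2 ↦ ?_⟩
        have := h2.2 i hi
        tauto
    rw [this]
    exact TopologicalSpace.Opens.isOpen _

/-- Over a field, polynomials of degree at most `d` with nonzero
degree-`(d, d)` resultant and vanishing `f' g - f g'` have zero derivative. -/
lemma derivative_eq_zero_of_resultant {K : Type} [Field K] {d : ℕ} (hd : d ≠ 0)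
    {f g : Polynomial K} (hf : f.natDegree ≤ d) (hg : g.natDegree ≤ d)
    (hres : f.resultant g d d ≠ 0)
    (hw : ∀ i < 2 * d - 1,
      (Polynomial.derivative f * g - f * Polynomial.derivative g).coeff i = 0) :
    Polynomial.derivative f = 0 ∧ Polynomial.derivative g = 0 := by
  have hco : IsCoprime f g := by
    obtain ⟨u, v, -, -, h⟩ := Polynomial.exists_mul_add_mul_eq_C_resultant f g hf hg (.inl hd)
    refine ⟨Polynomial.C (f.resultant g d d)⁻¹ * u, Polynomial.C (f.resultant g d d)⁻¹ * v, ?_⟩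
    rw [mul_assoc, mul_assoc, ← mul_add, mul_comm u, mul_comm v, h, ← Polynomial.C_mul,
      inv_mul_cancel₀ hres, Polynomial.C_1]
  have hf' : (Polynomial.derivative f).natDegree ≤ d - 1 :=
    (Polynomial.natDegree_derivative_le f).trans (by omega)
  have hg' : (Polynomial.derivative g).natDegree ≤ d - 1 :=
    (Polynomial.natDegree_derivative_le g).trans (by omega)
  have hzero : Polynomial.derivative f * g - f * Polynomial.derivative g = 0 := by
    ext n
    rw [Polynomial.coeff_zero]
    rcases lt_trichotomy n (2 * d - 1) with h | h | h
    · exact hw n h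
    · have e1 := Polynomial.coeff_mul_add_eq_of_natDegree_le hf' hg
      have e2 := Polynomial.coeff_mul_add_eq_of_natDegree_le hf hg'
      have : n = d - 1 + d := by omega
      rw [Polynomial.coeff_sub, this, e1, add_comm (d - 1) d, e2, Polynomial.coeff_derivative,
        Polynomial.coeff_derivative, show d - 1 + 1 = d by omega]
      ring
    · apply Polynomial.coeff_eq_zero_of_natDegree_lt
      refine lt_of_le_of_lt (Polynomial.natDegree_sub_le_of_le (m := 2 * d - 1)
        (n := 2 * d - 1) ?_ ?_) (by omega)
      · exact Polynomial.natDegree_mul_le.trans (by omega)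
      · exact Polynomial.natDegree_mul_le.trans (by omega)
  rw [← hco.wronskian_eq_zero_iff, Polynomial.wronskian, ← neg_sub, hzero, neg_zero]

/-- The form `f' g - f g'` does not vanish identically at a separable rational function. -/
lemma sepLocus_le (hd : 1 < d) : sepLocus p d ≤ formsLocus (critForm (ZMod p) d) := by
  rintro x ⟨hx, hsep⟩
  by_contra hcon
  apply hsep
  refine ⟨hx, ?_⟩
  let P : Ideal (MvPolynomial (CoeffIdx d) (ZMod p)) := x.asHomogeneousIdeal.toIdeal
  have hP : P.IsPrime := x.isPrime
  let K := FractionRing (MvPolynomial (CoeffIdx d) (ZMod p) ⧸ P)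
  let q : MvPolynomial (CoeffIdx d) (ZMod p) →+* K :=
    (algebraMap (MvPolynomial (CoeffIdx d) (ZMod p) ⧸ P) K).comp (Ideal.Quotient.mk P)
  have hq : ∀ a, q a = 0 ↔ a ∈ P := fun a ↦ by
    rw [RingHom.comp_apply, FaithfulSMul.algebraMap_eq_zero_iff, Ideal.Quotient.eq_zero_iff_mem]
  have hchar : CharP K p := charP_of_injective_ringHom
    (q.comp (MvPolynomial.C (σ := CoeffIdx d) (R := ZMod p))).injective p
  have hres : ((genNum (ZMod p) d).map q).resultant ((genDen (ZMod p) d).map q) d d ≠ 0 := by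
    rw [Polynomial.resultant_map_map]
    exact fun h ↦ hx ((hq _).mp h)
  obtain ⟨h1, h2⟩ := derivative_eq_zero_of_resultant (d := d) (by omega)
    (Polynomial.natDegree_map_le.trans (natDegree_genNum_le (ZMod p) d))
    (Polynomial.natDegree_map_le.trans (natDegree_genDen_le (ZMod p) d)) hres (fun i hi ↦ by
      rw [Polynomial.derivative_map, Polynomial.derivative_map, ← Polynomial.map_mul,
        ← Polynomial.map_mul, ← Polynomial.map_sub, Polynomial.coeff_map, hq]
      by_contra h
      exact hcon (TopologicalSpace.Opens.mem_iSup.mpr ⟨⟨i, hi⟩, h⟩))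
  have key : ∀ (F : Polynomial (MvPolynomial (CoeffIdx d) (ZMod p))),
      Polynomial.derivative (F.map q) = 0 → ∀ i : ℕ, ¬ p ∣ i → F.coeff i ∈ P := by
    intro F hF i hi
    obtain ⟨j, rfl⟩ : ∃ j, i = j + 1 := ⟨i - 1, by
      rcases i with _ | i
      · exact absurd (dvd_zero p) hi
      · rfl⟩
    have := congrArg (fun G ↦ Polynomial.coeff G j) hF
    simp only [Polynomial.coeff_derivative, Polynomial.coeff_map, Polynomial.coeff_zero,
      mul_eq_zero] at this
    rcases this with h | h
    · exact (hq _).mp h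
    · exact absurd ((CharP.cast_eq_zero_iff K p (j + 1)).mp (by exact_mod_cast h)) hi
  intro i hi
  have a1 := key _ h1 i hi
  have a2 := key _ h2 i hi
  rw [coeff_genNum, dif_pos i.2] at a1
  rw [coeff_genDen, dif_pos i.2] at a2
  exact ⟨a1, a2⟩

/-- The morphism `ω : Rat_d ∖ Insep_d ⟶ ℙ^{2d-2}`, `φ ↦ (c_{2d-2} : ⋯ : c_0)`. -/
def omega (hd : 1 < d) : (sepLocus p d).toScheme ⟶ ProjSpace (ZMod p) (Fin (2 * d - 1)) :=
  Scheme.homOfLE _ (sepLocus_le p d hd) ≫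
    formsMorphism (critForm (ZMod p) d) (critForm_isHomogeneous (ZMod p) d) two_pos

/-- The closed immersion `C ⟶ ℙ^{2d-2}` of the (scheme-theoretic) image `C` of `θ`. -/
abbrev curveι (hd : 1 < d) :
    (theta (ZMod p) d hd).image ⟶ ProjSpace (ZMod p) (Fin (2 * d - 1)) :=
  (theta (ZMod p) d hd).imageι

/-- The unicritical locus `U_d`, the fibre product of `ω` and `C ⟶ ℙ^{2d-2}`. -/
def unicriticalLocus (hd : 1 < d) : Scheme.{0} :=
  pullback (omega p d hd) (curveι p d hd)

/-- The inclusion of `U_d` in `ℙ^{2d+1}`. -/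
def unicriticalLocus.toProjSpace (hd : 1 < d) :
    unicriticalLocus p d hd ⟶ ProjSpace (ZMod p) (CoeffIdx d) :=
  pullback.fst (omega p d hd) (curveι p d hd) ≫ (sepLocus p d).ι

/-- The structure morphism `U_d ⟶ Spec 𝔽_p`. -/
def unicriticalLocus.toSpec (hd : 1 < d) :
    unicriticalLocus p d hd ⟶ Spec (.of (ZMod p)) :=
  unicriticalLocus.toProjSpace p d hd ≫ ProjSpace.toSpec (ZMod p) (CoeffIdx d)

end Unicrit

/-! ### Varieties -/

/-- `f : X ⟶ Spec k` is a quasi-projective variety over `k`: `X` is integral, separated and of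
finite type over `k`, and is a locally closed subscheme of a projective space over `k`. -/
structure IsQuasiProjectiveVariety {k : Type} [CommRing k] {X : Scheme.{0}}
    (f : X ⟶ Spec (.of k)) : Prop where
  isIntegral : IsIntegral X
  isSeparated : IsSeparated f
  locallyOfFiniteType : LocallyOfFiniteType f
  quasiCompact : QuasiCompact f
  exists_immersion : ∃ (σ : Type) (_ : Finite σ) (i : X ⟶ ProjSpace k σ),
    IsImmersion i ∧ i ≫ ProjSpace.toSpec k σ = f

/-- `f : X ⟶ Spec k` is rational over `k`: it is birational over `k` to some affine space
`𝔸^n` over `k`. -/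
def IsRational {k : Type} [CommRing k] {X : Scheme.{0}} (f : X ⟶ Spec (.of k)) : Prop :=
  ∃ n : ℕ, Scheme.BirationalOver f (𝔸(Fin n; Spec (.of k)) ↘ Spec (.of k))

end Unicritical

end

/-! Write W = f'g - fg' and 2d - 2 = q m with q = p^k and p ∤ m. Since (tz - s)^{2d-2} = (t^q z^q -
s^q)^m, a point of U_d over a local ring B is a pair (f, g) with unit resultant such that W = c (z^q
- S)^m with c a unit, either for (f, g) itself or for the pair reversed by z ↦ 1/z. In one
direction, homogeneous relations between the θ_i hold on C, and p ∤ m allows S to be read off the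
second coefficient of W (`exists_isRat_of_point`). In the other, z^q - S acquires a root in an
injective extension of B, and factoring through a scheme-theoretic image may be tested after such an
extension (`IsUnicrit.exists_lift`).

The identity (z - s)W' = kW says Lf · g = f · Lg for L = (z - s)D² - kD. As f and g are coprime and
L lowers degrees, Lf = Lg = 0 (`IsRat.annihilated`). If d ≢ 0, 1, the top coefficients of f and g
then vanish, which contradicts the unit resultant. Otherwise f and g lie in a rank-two module over
the polynomials in z^p. Up to a shift α, its basis (u, v) is (z, 1) if p ∣ d - 1, (1, z) if p = 2 ∣
d, and (1, (z - S)^{p-1}) if p is odd and p ∣ d. Polynomials in z^p are constants for d/dz, so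
writing f = A(z^p)u + B₁(z^p)v and g = A₂(z^p)u + B₂(z^p)v turns the condition on W into A B₂ - B₁
A₂ = cτ with τ explicit (`critPoly_expand`, `NormalForm`).

A shift of the basis by α ∈ {0, 1}, the replacement of f by f + βg with β ∈ {0, 1}, and a rescaling
make A monic and coprime to A₂. Bézout then determines (B₁, B₂) up to adding λ(A, A₂), and the
degree bounds allow a nonzero constant λ only if p ∣ d - 1; this is recorded by ε = 1 in that case
and ε = 0 if p ∣ d. The free parameters are the e coefficients of A, the e + 1 of A₂, then c, S and
possibly λ: altogether 2e + 3 + ε, where e is d/p or (d - 1)/p (`exists_specialization`,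
`specialization_unique`).

With α and β kept as variables, this gives one morphism to U_d per chart from the spectrum of a
localized polynomial ring, and every local-ring point of U_d factors through one of the two. Hence
U_d is reduced; it is irreducible because each generic point also lies in the image of the other
chart. Fixing α and β at their values at the generic point of U_d gives an open part of affine space
which maps birationally to U_d (`birationalOver_of_lift`), and dimension is a birational invariant.
-/

noncomputable section

namespace Unicritical

/-! ### Ring-valued points of projective space -/

section Points

variable {R σ τ : Type} [CommRing R] {B B' : Type} [CommRing B] [Algebra R B] [CommRing B']
  [Algebra R B']

/-- Evaluation of degree-zero fractions with denominator a power of `h` at a vector `v` with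
`h(v)` invertible. -/
def evalAway (h : MvPolynomial σ R) (v : σ → B) (hu : IsUnit (MvPolynomial.aeval v h)) :
    HomogeneousLocalization.Away (grading R σ) h →+* B :=
  (IsLocalization.Away.lift (S := Localization.Away h) h
    (g := (MvPolynomial.aeval v : MvPolynomial σ R →ₐ[R] B).toRingHom) hu).comp
    (algebraMap (HomogeneousLocalization.Away (grading R σ) h) (Localization.Away h))

lemma evalAway_apply (h : MvPolynomial σ R) (v : σ → B) (hu : IsUnit (MvPolynomial.aeval v h))
    (z : HomogeneousLocalization.Away (grading R σ) h) :
    evalAway h v hu z = IsLocalization.Away.lift (S := Localization.Away h) h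
      (g := (MvPolynomial.aeval v : MvPolynomial σ R →ₐ[R] B).toRingHom) hu z.val := rfl

/-- Clearing the denominator avoids any mention of the inverse of h(v); all later computations with
`evalAway` cancel a power of this unit. -/
lemma evalAway_mk (h : MvPolynomial σ R) (v : σ → B) (hu : IsUnit (MvPolynomial.aeval v h))
    {d : ℕ} (hd : h ∈ grading R σ d) (n : ℕ) (a : MvPolynomial σ R)
    (ha : a ∈ grading R σ (n • d)) :
    evalAway h v hu (HomogeneousLocalization.Away.mk (grading R σ) hd n a ha) *
      MvPolynomial.aeval v h ^ n = MvPolynomial.aeval v a := by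
  rw [evalAway_apply, HomogeneousLocalization.Away.val_mk, Localization.mk_eq_mk']
  have := IsLocalization.mk'_spec (Localization.Away h) a (⟨h ^ n, n, rfl⟩ : Submonoid.powers h)
  apply_fun IsLocalization.Away.lift (S := Localization.Away h) h
      (g := (MvPolynomial.aeval v : MvPolynomial σ R →ₐ[R] B).toRingHom) hu at this
  simpa [IsLocalization.Away.lift_eq] using this

/-- Characterization of `evalAway` by its values. -/
lemma eq_evalAway (h : MvPolynomial σ R) (v : σ → B) (hu : IsUnit (MvPolynomial.aeval v h))
    {d : ℕ} (hd : h ∈ grading R σ d)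
    (φ : HomogeneousLocalization.Away (grading R σ) h →+* B)
    (hφ : ∀ (n : ℕ) (a : MvPolynomial σ R) (ha : a ∈ grading R σ (n • d)),
      φ (HomogeneousLocalization.Away.mk (grading R σ) hd n a ha) *
        MvPolynomial.aeval v h ^ n = MvPolynomial.aeval v a) :
    φ = evalAway h v hu := by
  ext z
  obtain ⟨n, a, ha, rfl⟩ := HomogeneousLocalization.Away.mk_surjective (grading R σ) hd z
  exact (hu.pow n).mul_right_cancel ((hφ n a ha).trans (evalAway_mk h v hu hd n a ha).symm)

/-- The point of projective space with homogeneous coordinates `v`, where `h(v)` is invertible for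
some form `h` of positive degree. -/
def pt (h : MvPolynomial σ R) {d : ℕ} (hd : h ∈ grading R σ d) (hd0 : 0 < d) (v : σ → B)
    (hu : IsUnit (MvPolynomial.aeval v h)) : Spec (.of B) ⟶ ProjSpace R σ :=
  Spec.map (CommRingCat.ofHom (evalAway h v hu)) ≫ Proj.awayι (grading R σ) h hd hd0

lemma isUnit_aeval_comp (φ : B →ₐ[R] B') {v : σ → B} {h : MvPolynomial σ R}
    (hu : IsUnit (MvPolynomial.aeval v h)) : IsUnit (MvPolynomial.aeval (φ ∘ v) h) := by
  have : MvPolynomial.aeval (φ ∘ v) h = φ (MvPolynomial.aeval v h) := by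
    rw [← AlgHom.comp_apply, MvPolynomial.comp_aeval]; rfl
  rw [this]; exact hu.map φ

lemma map_comp_pt (φ : B →ₐ[R] B') (h : MvPolynomial σ R) {d : ℕ} (hd : h ∈ grading R σ d)
    (hd0 : 0 < d) (v : σ → B) (hu : IsUnit (MvPolynomial.aeval v h)) :
    Spec.map (CommRingCat.ofHom φ.toRingHom) ≫ pt h hd hd0 v hu =
      pt h hd hd0 (φ ∘ v) (isUnit_aeval_comp φ hu) := by
  rw [pt, pt, ← Spec.map_comp_assoc, ← CommRingCat.ofHom_comp]
  congr 3
  refine eq_evalAway _ _ _ hd _ fun n a ha ↦ ?_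
  have e : ∀ b : MvPolynomial σ R, MvPolynomial.aeval (φ ∘ v) b = φ (MvPolynomial.aeval v b) :=
    fun b ↦ by rw [← AlgHom.comp_apply, MvPolynomial.comp_aeval]; rfl
  rw [e, e, ← map_pow, ← evalAway_mk h v hu hd n a ha, map_mul]
  rfl

/-- Compatibility on the overlap D₊(fg), from which `pt_eq_pt` deduces that the choice of the
nonvanishing form is immaterial. -/
lemma evalAway_comp_awayMap {f g x : MvPolynomial σ R} {k l : ℕ} (hf : f ∈ grading R σ k)
    (hg : g ∈ grading R σ l) (hx : x = f * g) (v : σ → B)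
    (hfu : IsUnit (MvPolynomial.aeval v f)) (hxu : IsUnit (MvPolynomial.aeval v x)) :
    (evalAway x v hxu).comp (HomogeneousLocalization.awayMap (grading R σ) hg hx) =
      evalAway f v hfu := by
  refine eq_evalAway _ _ _ hf _ fun n a ha ↦ ?_
  have hx' : x ∈ grading R σ (k + l) := hx ▸ SetLike.mul_mem_graded hf hg
  have h1 := evalAway_mk f v hfu hf n a ha
  rw [← h1]
  congr 1
  rw [RingHom.comp_apply, evalAway_apply, evalAway_apply, HomogeneousLocalization.val_awayMap]
  generalize (HomogeneousLocalization.Away.mk (grading R σ) hf n a ha).val = w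
  rw [← RingHom.comp_apply]
  congr 1
  apply IsLocalization.ringHom_ext (Submonoid.powers f)
  refine RingHom.ext fun a ↦ ?_
  simp only [RingHom.comp_apply, Localization.awayLift, IsLocalization.Away.lift_eq]

/-- The point attached to `v` does not depend on the form used to witness nonvanishing. -/
lemma pt_eq_pt {f g : MvPolynomial σ R} {k l : ℕ} (hf : f ∈ grading R σ k) (hk : 0 < k)
    (hg : g ∈ grading R σ l) (hl : 0 < l) (v : σ → B) (hfu : IsUnit (MvPolynomial.aeval v f))
    (hgu : IsUnit (MvPolynomial.aeval v g)) : pt f hf hk v hfu = pt g hg hl v hgu := by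
  have hxu : IsUnit (MvPolynomial.aeval v (f * g)) := by rw [map_mul]; exact hfu.mul hgu
  rw [pt, pt, ← evalAway_comp_awayMap hf hg rfl v hfu hxu,
    ← evalAway_comp_awayMap hg hf (mul_comm f g) v hgu hxu, CommRingCat.ofHom_comp,
    CommRingCat.ofHom_comp, Spec.map_comp_assoc, Spec.map_comp_assoc,
    Proj.SpecMap_awayMap_awayι, Proj.SpecMap_awayMap_awayι]
  rfl

lemma aeval_smul_of_mem {h : MvPolynomial σ R} {d : ℕ} (hd : h ∈ grading R σ d) (c : B)
    (v : σ → B) : MvPolynomial.aeval (c • v) h = c ^ d * MvPolynomial.aeval v h := by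
  rw [MvPolynomial.aeval_def, MvPolynomial.aeval_def, MvPolynomial.eval₂_eq,
    MvPolynomial.eval₂_eq, Finset.mul_sum]
  refine Finset.sum_congr rfl fun s hs ↦ ?_
  have h1 : s.degree = d := by
    have := hd (MvPolynomial.mem_support_iff.mp hs)
    rw [← this, Finsupp.degree_eq_weight_one]
    rfl
  simp only [Pi.smul_apply, smul_eq_mul, mul_pow, Finset.prod_mul_distrib,
    Finset.prod_pow_eq_pow_sum]
  rw [← h1, Finsupp.degree_apply]
  ring

lemma pt_smul {h : MvPolynomial σ R} {d : ℕ} (hd : h ∈ grading R σ d) (hd0 : 0 < d) (c : B)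
    (hc : IsUnit c) (v : σ → B) (hu : IsUnit (MvPolynomial.aeval v h))
    (hu' : IsUnit (MvPolynomial.aeval (c • v) h)) :
    pt h hd hd0 (c • v) hu' = pt h hd hd0 v hu := by
  rw [pt, pt]
  congr 3
  refine eq_evalAway _ _ _ hd _ fun n a ha ↦ ?_
  have := evalAway_mk h (c • v) hu' hd n a ha
  rw [aeval_smul_of_mem hd, aeval_smul_of_mem ha, mul_pow, ← pow_mul, smul_eq_mul,
    mul_comm d n] at this
  refine (hc.pow (n * d)).mul_left_cancel ?_
  rw [← this]
  ring

lemma pt_mem_basicOpen {h : MvPolynomial σ R} {d : ℕ} (hd : h ∈ grading R σ d) (hd0 : 0 < d)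
    (v : σ → B) (hu : IsUnit (MvPolynomial.aeval v h)) {f : MvPolynomial σ R} {k : ℕ}
    (hf : f ∈ grading R σ k) (hk : 0 < k) (x : Spec (.of B)) :
    pt h hd hd0 v hu x ∈ Proj.basicOpen (grading R σ) f ↔
      MvPolynomial.aeval v f ∉ x.asIdeal := by
  have h1 : pt h hd hd0 v hu x ∈ Proj.basicOpen (grading R σ) f ↔
      Spec.map (CommRingCat.ofHom (evalAway h v hu)) x ∈
        Proj.awayι (grading R σ) h hd hd0 ⁻¹ᵁ Proj.basicOpen (grading R σ) f := Iff.rfl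
  rw [h1, Proj.awayι_preimage_basicOpen (grading R σ) hd hd0 hf hk]
  have h2 : ∀ z, Spec.map (CommRingCat.ofHom (evalAway h v hu)) x ∈
      (PrimeSpectrum.basicOpen z : (Spec (.of (HomogeneousLocalization.Away (grading R σ) h))).Opens)
      ↔ evalAway h v hu z ∉ x.asIdeal := fun z ↦ Iff.rfl
  refine (h2 _).trans ?_
  rw [HomogeneousLocalization.Away.isLocalizationElem]
  -- Inside the chart of h, the open set D₊(f) is cut out by the degree-zero fraction f^d / h^k,
  -- where d = deg h and k = deg f.
  have h3 := evalAway_mk h v hu hd k (f ^ d)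
    (by simpa [mul_comm] using SetLike.pow_mem_graded d hf)
  have h4 : MvPolynomial.aeval v f ∈ x.asIdeal ↔
      MvPolynomial.aeval v (f ^ d) ∈ x.asIdeal := by
    rw [map_pow]
    exact (x.isPrime.pow_mem_iff_mem d hd0).symm
  rw [h4, ← h3, not_iff_not]
  constructor
  · intro h; exact Ideal.mul_mem_right _ _ h
  · intro h
    exact (Ideal.mul_unit_mem_iff_mem _ (hu.pow k)).mp h

/-- The base ring of a homogeneous localization. -/
def awayBase (h : MvPolynomial σ R) : R →+* HomogeneousLocalization.Away (grading R σ) h :=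
  (HomogeneousLocalization.fromZeroRingHom (grading R σ) (Submonoid.powers h)).comp
    (algebraMap R (grading R σ 0))

lemma pt_toSpec (h : MvPolynomial σ R) {d : ℕ} (hd : h ∈ grading R σ d)
    (hd0 : 0 < d) (v : σ → B) (hu : IsUnit (MvPolynomial.aeval v h)) :
    pt h hd hd0 v hu ≫ ProjSpace.toSpec R σ = Spec.map (CommRingCat.ofHom (algebraMap R B)) := by
  rw [pt, ProjSpace.toSpec, Category.assoc, Proj.awayι_toSpecZero_assoc, ← Spec.map_comp,
    ← Spec.map_comp, ← CommRingCat.ofHom_comp, ← CommRingCat.ofHom_comp]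
  congr 2
  ext r
  have h0 : (HomogeneousLocalization.fromZeroRingHom (grading R σ) (Submonoid.powers h))
      (algebraMap R (grading R σ 0) r) = HomogeneousLocalization.Away.mk (grading R σ) hd 0
        (MvPolynomial.C r)
      (by rw [zero_smul]; exact MvPolynomial.isHomogeneous_C σ r) := by
    apply HomogeneousLocalization.val_injective
    rw [HomogeneousLocalization.Away.val_mk]
    simp only [pow_zero]
    rfl
  have := evalAway_mk h v hu hd 0 (MvPolynomial.C r)
    (by rw [zero_smul]; exact MvPolynomial.isHomogeneous_C σ r)
  rw [pow_zero, mul_one, MvPolynomial.aeval_C] at this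
  rw [RingHom.comp_apply, RingHom.comp_apply, h0, this]

/-- Homogeneity gives a / x_i^n = a(x_j / x_i). A ring map out of the chart is therefore determined
by the scalars and the images of the x_j / x_i, which become homogeneous coordinates in
`exists_eq_pt`. -/
lemma away_mk_eq_eval₂ (i : σ) (n : ℕ) (a : MvPolynomial σ R)
    (ha : a ∈ grading R σ (n • 1)) :
    HomogeneousLocalization.Away.mk (grading R σ) (X_mem i) n a ha =
      MvPolynomial.eval₂ (awayBase (MvPolynomial.X i)) (fun j ↦
        HomogeneousLocalization.Away.mk (grading R σ) (X_mem (R := R) i) 1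
          (MvPolynomial.X j) (X_mem j)) a := by
  apply HomogeneousLocalization.val_injective
  let L := Localization.Away (MvPolynomial.X i : MvPolynomial σ R)
  let ι : HomogeneousLocalization.Away (grading R σ) (MvPolynomial.X i) →+* L := algebraMap _ _
  let c : L := IsLocalization.Away.invSelf (MvPolynomial.X i : MvPolynomial σ R)
  have hc : algebraMap (MvPolynomial σ R) L (MvPolynomial.X i) * c = 1 :=
    IsLocalization.Away.mul_invSelf _
  have hmk : ∀ (n : ℕ) (a : MvPolynomial σ R) (ha : a ∈ grading R σ (n • 1)),
      (HomogeneousLocalization.Away.mk (grading R σ) (X_mem i) n a ha).val =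
        c ^ n * algebraMap _ L a := by
    intro n a ha
    rw [HomogeneousLocalization.Away.val_mk, Localization.mk_eq_mk', IsLocalization.mk'_eq_iff_eq_mul]
    have : (algebraMap (MvPolynomial σ R) L (MvPolynomial.X i)) ^ n * c ^ n = 1 := by
      rw [← mul_pow, hc, one_pow]
    rw [map_pow]
    linear_combination (-(algebraMap (MvPolynomial σ R) L a)) * this
  rw [hmk]
  change _ = ι _
  rw [MvPolynomial.hom_eval₂]
  have hb : ι.comp (awayBase (MvPolynomial.X i)) = algebraMap R L := by
    ext r
    change (HomogeneousLocalization.fromZeroRingHom (grading R σ) (Submonoid.powers _)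
      (algebraMap R (grading R σ 0) r)).val = _
    rfl
  have ht : (fun j ↦ ι (HomogeneousLocalization.Away.mk (grading R σ) (X_mem (R := R) i) 1
          (MvPolynomial.X j) (X_mem j))) = c • fun j ↦ algebraMap (MvPolynomial σ R) L (MvPolynomial.X j) := by
    funext j
    refine (hmk 1 _ _).trans ?_
    rw [pow_one]
    rfl
  rw [hb, ht, ← MvPolynomial.aeval_def, aeval_smul_of_mem ha]
  congr 1
  · simp
  · exact DFunLike.congr_fun (MvPolynomial.aeval_unique
      (IsScalarTower.toAlgHom R (MvPolynomial σ R) L)) a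

/-- Over a local ring every point of projective space has homogeneous coordinates. -/
lemma exists_eq_pt [IsLocalRing B] [Subsingleton (R →+* B)] (x : Spec (.of B) ⟶ ProjSpace R σ) :
    ∃ (i : σ) (v : σ → B) (hv : v i = 1),
      x = pt (MvPolynomial.X i) (X_mem i) one_pos v (by simp [hv]) := by
  -- An open subset of a local scheme containing the closed point is everything, so the chart of the
  -- closed point contains the whole image.
  obtain ⟨i, hi⟩ : ∃ i, x (IsLocalRing.closedPoint B) ∈
      Proj.basicOpen (grading R σ) (MvPolynomial.X i) := by
    have : x (IsLocalRing.closedPoint B) ∈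
        (⨆ i, Proj.basicOpen (grading R σ) (MvPolynomial.X i) : (ProjSpace R σ).Opens) := by
      rw [iSup_basicOpen_X]; trivial
    exact TopologicalSpace.Opens.mem_iSup.mp this
  have hpre : x ⁻¹ᵁ (Proj.awayι (grading R σ) (MvPolynomial.X i) (X_mem i) one_pos).opensRange
      = ⊤ := by
    rw [Proj.opensRange_awayι]
    exact Scheme.preimage_eq_top_of_closedPoint_mem (R := .of B) x hi
  have hrange : Set.range x ⊆
      Set.range (Proj.awayι (grading R σ) (MvPolynomial.X i) (X_mem i) one_pos) := by
    rintro _ ⟨y, rfl⟩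
    have : y ∈ x ⁻¹ᵁ (Proj.awayι (grading R σ) (MvPolynomial.X i) (X_mem i)
      one_pos).opensRange := by rw [hpre]; trivial
    exact this
  let y := IsOpenImmersion.lift
    (Proj.awayι (grading R σ) (MvPolynomial.X i) (X_mem i) one_pos) x hrange
  have hy : y ≫ Proj.awayι (grading R σ) (MvPolynomial.X i) (X_mem i) one_pos = x :=
    IsOpenImmersion.lift_fac _ _ _
  obtain ⟨φ, hφ⟩ := Spec.map_surjective y
  let v : σ → B := fun j ↦ φ.hom (HomogeneousLocalization.Away.mk (grading R σ) (X_mem i) 1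
    (MvPolynomial.X j) (X_mem j))
  have hv : v i = 1 := by
    have : HomogeneousLocalization.Away.mk (grading R σ) (X_mem (R := R) i) 1
      (MvPolynomial.X i) (X_mem i) = 1 := by
      apply HomogeneousLocalization.val_injective
      rw [HomogeneousLocalization.Away.val_mk, HomogeneousLocalization.val_one]
      rw [Localization.mk_eq_mk', IsLocalization.mk'_eq_iff_eq_mul]
      simp
    simp only [v, this, map_one]
  refine ⟨i, v, hv, ?_⟩
  rw [← hy, ← hφ, pt]
  congr 2
  have : φ = CommRingCat.ofHom φ.hom := rfl
  rw [this]
  congr 1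
  refine eq_evalAway _ _ _ (X_mem i) _ fun n a ha ↦ ?_
  rw [MvPolynomial.aeval_X, hv, one_pow, mul_one]
  -- No structure morphism needs to be tracked: uniqueness of ring maps R → B makes φ automatically
  -- R-linear. This applies to R = `ZMod p`.
  have hbase : φ.hom.comp (awayBase (MvPolynomial.X i)) = algebraMap R B :=
    Subsingleton.elim _ _
  rw [away_mk_eq_eval₂ i n a ha, MvPolynomial.aeval_def, ← hbase]
  exact MvPolynomial.hom_eval₂ _ _ _ _

end Points
end Unicritical
end

noncomputable section

namespace Unicritical

/-! ### Morphisms given by forms, on points -/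

section FormsPoints

variable {R σ τ : Type} [CommRing R] {B : Type} [CommRing B] [Algebra R B]

lemma aeval_aeval_forms (c : τ → MvPolynomial σ R) (v : σ → B) (a : MvPolynomial τ R) :
    MvPolynomial.aeval v (subst c a) =
      MvPolynomial.aeval (fun j ↦ MvPolynomial.aeval v (c j)) a := by
  rw [← AlgHom.comp_apply, MvPolynomial.comp_aeval]

lemma evalAway_comp_substAway (c : τ → MvPolynomial σ R) {r : ℕ}
    (hc : ∀ i, (c i).IsHomogeneous r) {s : MvPolynomial τ R} {k : ℕ} (hs : s ∈ grading R τ k)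
    (v : σ → B) (hu : IsUnit (MvPolynomial.aeval v (subst c s)))
    (hu' : IsUnit (MvPolynomial.aeval (fun j ↦ MvPolynomial.aeval v (c j)) s)) :
    (evalAway (subst c s) v hu).comp (substAway c hc s) =
      evalAway s (fun j ↦ MvPolynomial.aeval v (c j)) hu' := by
  refine eq_evalAway _ _ _ hs _ fun n a ha ↦ ?_
  rw [← evalAway_mk s _ hu' hs n a ha]
  congr 1
  rw [RingHom.comp_apply, evalAway_apply, evalAway_apply, val_substAway]
  generalize (HomogeneousLocalization.Away.mk (grading R τ) hs n a ha).val = w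
  rw [← RingHom.comp_apply]
  congr 1
  apply IsLocalization.ringHom_ext (Submonoid.powers s)
  refine RingHom.ext fun a ↦ ?_
  simp only [RingHom.comp_apply, substLoc, IsLocalization.map_eq, IsLocalization.Away.lift_eq]
  exact aeval_aeval_forms c v a

lemma isUnit_aeval_X {v : σ → B} {i : σ} (h : IsUnit (v i)) :
    IsUnit (MvPolynomial.aeval v (MvPolynomial.X i : MvPolynomial σ R)) := by simpa using h

lemma isUnit_aeval_subst_X {c : τ → MvPolynomial σ R} {v : σ → B} {i : τ}
    (h : IsUnit (MvPolynomial.aeval v (c i))) :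
    IsUnit (MvPolynomial.aeval v (subst c (MvPolynomial.X i))) := by rwa [subst_X]

lemma pt_comp_formsChart (c : τ → MvPolynomial σ R) {r : ℕ} (hc : ∀ i, (c i).IsHomogeneous r)
    (v : σ → B) (i : τ) (hi : IsUnit (MvPolynomial.aeval v (c i))) :
    Spec.map (CommRingCat.ofHom (evalAway (subst c (MvPolynomial.X i)) v
      (isUnit_aeval_subst_X hi))) ≫ formsChart c hc i =
      pt (MvPolynomial.X i) (X_mem i) one_pos (fun j ↦ MvPolynomial.aeval v (c j))
        (isUnit_aeval_X hi) := by
  rw [formsChart, pt, ← Spec.map_comp_assoc, ← CommRingCat.ofHom_comp,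
    evalAway_comp_substAway c hc (X_mem i)]

/-- Unit-ness of c_i(v) makes y factor through the chart D₊(c_i), whichever form h witnessed v;
there the morphism is plain substitution. -/
lemma pt_comp_formsMorphism (c : τ → MvPolynomial σ R) {r : ℕ}
    (hc : ∀ i, (c i).IsHomogeneous r) (hr : 0 < r) {h : MvPolynomial σ R} {d : ℕ}
    (hd : h ∈ grading R σ d) (hd0 : 0 < d) (v : σ → B) (hu : IsUnit (MvPolynomial.aeval v h))
    (y : Spec (.of B) ⟶ (formsLocus c).toScheme) (hy : y ≫ (formsLocus c).ι = pt h hd hd0 v hu)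
    (i : τ) (hi : IsUnit (MvPolynomial.aeval v (c i))) :
    y ≫ formsMorphism c hc hr =
      pt (MvPolynomial.X i) (X_mem i) one_pos (fun j ↦ MvPolynomial.aeval v (c j))
        (isUnit_aeval_X hi) := by
  have e : y = Spec.map (CommRingCat.ofHom (evalAway (subst c (MvPolynomial.X i)) v
      (isUnit_aeval_subst_X hi))) ≫ locusChart c hc hr i := by
    rw [← cancel_mono (formsLocus c).ι, hy, Category.assoc, locusChart_ι]
    exact pt_eq_pt hd hd0 (subst_mem hc (X_mem i)) (by omega) v hu (isUnit_aeval_subst_X hi)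
  rw [e, Category.assoc, locusChart_formsMorphism, pt_comp_formsChart c hc v i hi]

end FormsPoints

section CurvePoints

variable {R : Type} [CommRing R] {B : Type} [CommRing B] [Algebra R B]

lemma pt_comp_theta (d : ℕ) (hd : 1 < d) {h : MvPolynomial (Fin 2) R} {k : ℕ}
    (hk : h ∈ grading R (Fin 2) k) (hk0 : 0 < k) (v : Fin 2 → B)
    (hu : IsUnit (MvPolynomial.aeval v h)) (i : Fin (2 * d - 1))
    (hi : IsUnit (MvPolynomial.aeval v (thetaForm R d i))) :
    pt h hk hk0 v hu ≫ theta R d hd =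
      pt (MvPolynomial.X i) (X_mem i) one_pos
        (fun j ↦ MvPolynomial.aeval v (thetaForm R d j)) (isUnit_aeval_X hi) := by
  rw [theta, ← Category.assoc, ← Category.assoc]
  refine pt_comp_formsMorphism (thetaForm R d) (thetaForm_isHomogeneous R d) (by omega) hk hk0 v
    hu _ ?_ i hi
  simp

/-- The chart of `ℙ^1` where the form `θ_i` is invertible, followed by `θ`. -/
lemma sourceChart_comp_theta (d : ℕ) (hd : 1 < d) (i : Fin (2 * d - 1)) :
    sourceChart (thetaForm R d) (thetaForm_isHomogeneous R d) (by omega) i ≫ theta R d hd =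
      formsChart (thetaForm R d) (thetaForm_isHomogeneous R d) i := by
  have key : sourceChart (thetaForm R d) (thetaForm_isHomogeneous R d) (by omega) i ≫
      (Scheme.topIso _).inv ≫ Scheme.homOfLE _ (formsLocus_thetaForm R d hd).ge =
        locusChart (thetaForm R d) (thetaForm_isHomogeneous R d) (by omega) i := by
    have aux : ∀ {Z : Scheme.{0}} (g : Z ⟶ ProjSpace R (Fin 2)),
        (g ≫ (Scheme.topIso _).inv ≫ Scheme.homOfLE _ (formsLocus_thetaForm R d hd).ge) ≫
          (formsLocus (thetaForm R d)).ι = g := fun g ↦ by simp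
    rw [← cancel_mono (formsLocus _).ι, locusChart_ι]
    exact aux _
  rw [← locusChart_formsMorphism _ _ (by omega : 0 < 2 * d - 2), theta, ← key]
  simp only [Category.assoc]

end CurvePoints

section OmegaPoints

variable (p : ℕ) [Fact p.Prime] (d : ℕ) {B : Type} [CommRing B] [Algebra (ZMod p) B]

/-- The Sylvester matrix has size 2d and its entries are linear forms, so each term of the
determinant has degree 2d. -/
lemma genRes_mem (R : Type) [CommRing R] : genRes R d ∈ grading R (CoeffIdx d) (2 * d) := by
  have hf : ∀ n, ((genNum R d).coeff n).IsHomogeneous 1 := fun n ↦ by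
    rw [coeff_genNum]
    split_ifs
    · exact MvPolynomial.isHomogeneous_X R _
    · exact MvPolynomial.isHomogeneous_zero _ R 1
  have hg : ∀ n, ((genDen R d).coeff n).IsHomogeneous 1 := fun n ↦ by
    rw [coeff_genDen]
    split_ifs
    · exact MvPolynomial.isHomogeneous_X R _
    · exact MvPolynomial.isHomogeneous_zero _ R 1
  rw [genRes, Polynomial.resultant, Matrix.det_apply]
  refine sum_mem fun s _ ↦ ?_
  refine zsmul_mem ?_ _ 
  have := MvPolynomial.IsHomogeneous.prod (Finset.univ : Finset (Fin (d + d)))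
    (fun i ↦ Polynomial.sylvester (genNum R d) (genDen R d) d d (s i) i) (fun _ ↦ 1) 
    (fun i _ ↦ by
      refine Fin.addCases (fun j ↦ ?_) (fun j ↦ ?_) i
      · simp only [Polynomial.sylvester, Matrix.of_apply, Fin.addCases_left]
        split_ifs
        · exact hg _
        · exact MvPolynomial.isHomogeneous_zero _ R 1
      · simp only [Polynomial.sylvester, Matrix.of_apply, Fin.addCases_right]
        split_ifs
        · exact hf _
        · exact MvPolynomial.isHomogeneous_zero _ R 1)
  simpa [two_mul] using this

lemma pt_comp_omega (hd : 1 < d) {h : MvPolynomial (CoeffIdx d) (ZMod p)} {k : ℕ}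
    (hk : h ∈ grading (ZMod p) (CoeffIdx d) k) (hk0 : 0 < k) (v : CoeffIdx d → B)
    (hu : IsUnit (MvPolynomial.aeval v h)) (y : Spec (.of B) ⟶ (sepLocus p d).toScheme)
    (hy : y ≫ (sepLocus p d).ι = pt h hk hk0 v hu) (i : Fin (2 * d - 1))
    (hi : IsUnit (MvPolynomial.aeval v (critForm (ZMod p) d i))) :
    y ≫ omega p d hd = pt (MvPolynomial.X i) (X_mem i) one_pos
      (fun j ↦ MvPolynomial.aeval v (critForm (ZMod p) d j)) (isUnit_aeval_X hi) := by
  rw [omega, ← Category.assoc]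
  refine pt_comp_formsMorphism (critForm (ZMod p) d) (critForm_isHomogeneous (ZMod p) d) two_pos
    hk hk0 v hu _ ?_ i hi
  simpa using hy

end OmegaPoints

end Unicritical
end

noncomputable section

namespace Unicritical

/-! ### The scheme-theoretic image of `θ` -/

section Image

/-- A function on an affine chart of P which pulls back to zero on X lies in the kernel ideal of f,
and this ideal cuts out the scheme-theoretic image. The inclusion `h2` says that all of X over the
chart is seen by the single affine open `jX`, so that vanishing can be tested there. -/
lemma eq_zero_of_factors_image {P X : Scheme.{0}} {S S' B : CommRingCat.{0}} (f : X ⟶ P)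
    (j : Spec S ⟶ P) [IsOpenImmersion j] [QuasiCompact f] (jX : Spec S' ⟶ X)
    [IsOpenImmersion jX] (φ : S ⟶ S') (h1 : jX ≫ f = Spec.map φ ≫ j)
    (h2 : f ⁻¹ᵁ j.opensRange ≤ jX.opensRange) (ψ : S ⟶ B) (y : Spec B ⟶ f.image)
    (h : y ≫ f.imageι = Spec.map ψ ≫ j) (z : S) (hz : φ z = 0) : ψ z = 0 := by
  have hU : IsAffineOpen (j ''ᵁ ⊤) := (isAffineOpen_top _).image_of_isOpenImmersion j
  let s : Γ(P, j ''ᵁ ⊤) := (j.appIso ⊤).inv ((Scheme.ΓSpecIso S).inv z)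
  have key : ∀ {T : CommRingCat.{0}} (χ : S ⟶ T) (hle : ⊤ ≤ (Spec.map χ ≫ j) ⁻¹ᵁ (j ''ᵁ ⊤)),
      (Spec.map χ ≫ j).appLE (j ''ᵁ ⊤) ⊤ hle s = (Scheme.ΓSpecIso T).inv (χ z) := by
    intro T χ hle
    have hj : (⊤ : (Spec S).Opens) ≤ j ⁻¹ᵁ (j ''ᵁ ⊤) := by simp
    have hχ : (⊤ : (Spec T).Opens) ≤ Spec.map χ ⁻¹ᵁ ⊤ := fun _ _ ↦ trivial
    have e1 : (Spec.map χ ≫ j).appLE (j ''ᵁ ⊤) ⊤ hle =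
        j.appLE (j ''ᵁ ⊤) ⊤ hj ≫ (Spec.map χ).appLE ⊤ ⊤ hχ := by
      rw [Scheme.Hom.appLE_comp_appLE]
    rw [e1]
    have e2 : (j.appIso ⊤).inv ≫ j.appLE (j ''ᵁ ⊤) ⊤ hj = 𝟙 _ := by
      rw [Scheme.Hom.appIso_inv_appLE]
      simp
    have e3 : j.appLE (j ''ᵁ ⊤) ⊤ hj s = (Scheme.ΓSpecIso S).inv z :=
      ConcreteCategory.congr_hom e2 ((Scheme.ΓSpecIso S).inv z)
    rw [ConcreteCategory.comp_apply, e3]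
    have e4 : (Scheme.ΓSpecIso S).inv ≫ (Spec.map χ).appLE ⊤ ⊤ hχ =
        χ ≫ (Scheme.ΓSpecIso T).inv := by
      rw [Scheme.ΓSpecIso_inv_naturality]
      simp only [Scheme.Hom.appLE]
      congr 1
    exact ConcreteCategory.congr_hom e4 z
  have hle : ∀ {T : CommRingCat.{0}} (χ : S ⟶ T), ⊤ ≤ (Spec.map χ ≫ j) ⁻¹ᵁ (j ''ᵁ ⊤) := by
    intro T χ x _
    exact ⟨Spec.map χ x, trivial, rfl⟩
  -- the section vanishes on `X`
  have hs : f.app (j ''ᵁ ⊤) s = 0 := by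
    have hV : f ⁻¹ᵁ (j ''ᵁ ⊤) ≤ jX.opensRange := by
      rw [Scheme.Hom.image_top_eq_opensRange]; exact h2
    have := jX.isIso_app _ hV
    apply (ConcreteCategory.bijective_of_isIso (jX.app (f ⁻¹ᵁ (j ''ᵁ ⊤)))).1
    rw [map_zero, ← ConcreteCategory.comp_apply, ← Scheme.Hom.comp_app]
    have h3 := key φ (hle φ)
    rw [hz, map_zero] at h3
    have h4 : ∀ (k : Spec S' ⟶ P) (hk : ⊤ ≤ k ⁻¹ᵁ (j ''ᵁ ⊤)),
      k.appLE (j ''ᵁ ⊤) ⊤ hk s = 0 → k.app (j ''ᵁ ⊤) s = 0 := by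
      intro k hk h0
      have e : k ⁻¹ᵁ (j ''ᵁ ⊤) = ⊤ := top_le_iff.mp hk
      have : IsIso ((Spec S').presheaf.map (homOfLE hk).op) := by
        have : IsIso (homOfLE hk) := ⟨homOfLE e.le, Subsingleton.elim _ _, Subsingleton.elim _ _⟩
        infer_instance
      apply (ConcreteCategory.bijective_of_isIso ((Spec S').presheaf.map (homOfLE hk).op)).1
      rw [map_zero, ← h0]
      rfl
    exact h4 (jX ≫ f) (h1 ▸ hle φ) (by simpa only [h1] using h3)
  have hs' : (Spec.map ψ ≫ j).app (j ''ᵁ ⊤) s = 0 := by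
    have h5 : s ∈ f.ker.ideal ⟨j ''ᵁ ⊤, hU⟩ := by
      rw [Scheme.Hom.ker_apply]; exact hs
    have h6 : f.ker ≤ (Spec.map ψ ≫ j).ker := by
      rw [← h]
      refine le_trans ?_ (Scheme.Hom.le_ker_comp y f.imageι)
      exact (Scheme.IdealSheafData.ker_subschemeι f.ker).ge
    exact Scheme.Hom.ideal_ker_le _ _ (h6 _ h5)
  have h7 := key ψ (hle ψ)
  have h8 : (Spec.map ψ ≫ j).appLE (j ''ᵁ ⊤) ⊤ (hle ψ) s = 0 := by
    rw [Scheme.Hom.appLE, ConcreteCategory.comp_apply, hs', map_zero]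
  rw [h8] at h7
  apply (ConcreteCategory.bijective_of_isIso (Scheme.ΓSpecIso B).inv).1
  rw [← h7, map_zero]

/-- `Proj` is proper over the ring of degree-zero elements, and forms of degree zero are constants.
-/
instance isProper_toSpec (R σ : Type) [CommRing R] [Finite σ] :
    IsProper (ProjSpace.toSpec R σ) := by
  have h0 : IsScalarTower R (grading R σ 0) (MvPolynomial σ R) :=
    ⟨fun r a b ↦ smul_mul_assoc r (a : MvPolynomial σ R) b⟩
  have h : Algebra.FiniteType (grading R σ 0) (MvPolynomial σ R) :=
    Algebra.FiniteType.of_restrictScalars_finiteType R _ _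
  have : IsIso (CommRingCat.ofHom (algebraMap R (grading R σ 0))) := by
    rw [ConcreteCategory.isIso_iff_bijective]
    constructor
    · intro a b hab
      exact MvPolynomial.C_injective σ R (congrArg Subtype.val hab)
    · rintro ⟨a, ha⟩
      refine ⟨MvPolynomial.coeff 0 a, Subtype.ext ?_⟩
      have := MvPolynomial.totalDegree_eq_zero_iff_eq_C.mp
        ((MvPolynomial.totalDegree_zero_iff_isHomogeneous _).mpr ha)
      exact this.symm
  rw [ProjSpace.toSpec]
  infer_instance

end Image

section

variable (p : ℕ) [Fact p.Prime] (d : ℕ) (hd : 1 < d) {B : Type} [CommRing B]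
  [Algebra (ZMod p) B]

instance : QuasiCompact (theta (ZMod p) d hd) := by
  have : CompactSpace (ProjSpace (ZMod p) (Fin 2)) :=
    QuasiCompact.compactSpace_of_compactSpace (ProjSpace.toSpec (ZMod p) (Fin 2))
  infer_instance

/-- A field-valued point through every point of a scheme over `𝔽_p`. -/
lemma exists_field_pt {σ : Type} (x : ProjSpace (ZMod p) σ) :
    ∃ (K : Type) (_ : Field K) (_ : Algebra (ZMod p) K) (i : σ) (v : σ → K) (hv : v i = 1),
      ∃ z, pt (MvPolynomial.X i) (X_mem i) one_pos v
        (isUnit_aeval_X (R := ZMod p) (hv ▸ isUnit_one)) z = x := by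
  let K := (ProjSpace (ZMod p) σ).residueField x
  let g : Spec (.of K) ⟶ ProjSpace (ZMod p) σ := (ProjSpace (ZMod p) σ).fromSpecResidueField x
  obtain ⟨χ, hχ⟩ := Spec.map_surjective (g ≫ ProjSpace.toSpec (ZMod p) σ)
  let _ : Algebra (ZMod p) K := RingHom.toAlgebra χ.hom
  obtain ⟨i, v, hv, h⟩ := exists_eq_pt (R := ZMod p) (B := K) g
  refine ⟨K, inferInstance, inferInstance, i, v, hv, IsLocalRing.closedPoint K, ?_⟩
  rw [← h]
  exact (ProjSpace (ZMod p) σ).fromSpecResidueField_apply x _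

/-- Checked on field-valued points, where θ is given by its coordinates. This supplies the inclusion
required by `eq_zero_of_factors_image`. -/
lemma theta_preimage_le (i : Fin (2 * d - 1)) :
    theta (ZMod p) d hd ⁻¹ᵁ Proj.basicOpen (grading (ZMod p) _) (MvPolynomial.X i) ≤
      Proj.basicOpen (grading (ZMod p) (Fin 2)) (thetaForm (ZMod p) d i) := by
  intro x hx
  obtain ⟨K, _, _, k, v, hv, z, rfl⟩ := exists_field_pt p x
  have hr : 0 < 2 * d - 2 := by omega
  obtain ⟨l, hl⟩ : ∃ l, IsUnit (MvPolynomial.aeval v (thetaForm (ZMod p) d l)) := by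
    have hz : pt (MvPolynomial.X k) (X_mem k) one_pos v
        (isUnit_aeval_X (R := ZMod p) (hv ▸ isUnit_one)) z ∈ formsLocus (thetaForm (ZMod p) d) := by
      rw [formsLocus_thetaForm _ _ hd]; trivial
    obtain ⟨l, hl⟩ := TopologicalSpace.Opens.mem_iSup.mp hz
    refine ⟨l, ?_⟩
    rw [pt_mem_basicOpen (X_mem k) one_pos v _ (thetaForm_isHomogeneous _ _ l) hr] at hl
    exact isUnit_iff_ne_zero.mpr fun h ↦ hl (h ▸ zero_mem _)
  have hx' : (pt (MvPolynomial.X k) (X_mem k) one_pos v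
        (isUnit_aeval_X (R := ZMod p) (hv ▸ isUnit_one)) ≫ theta (ZMod p) d hd) z ∈
        Proj.basicOpen (grading (ZMod p) _) (MvPolynomial.X i) := hx
  rw [pt_comp_theta d hd _ _ v _ l hl, pt_mem_basicOpen _ _ _ _ (X_mem i) one_pos] at hx'
  rw [pt_mem_basicOpen (X_mem k) one_pos v _ (thetaForm_isHomogeneous _ _ i) hr]
  simpa using hx'

/-- Homogeneous relations between the forms `θ_i` hold on the image of `θ`. -/
lemma aeval_eq_zero_of_image (y : Spec (.of B) ⟶ (theta (ZMod p) d hd).image)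
    (i : Fin (2 * d - 1)) (w : Fin (2 * d - 1) → B) (hw : IsUnit (w i))
    (hy : y ≫ curveι p d hd =
      pt (MvPolynomial.X i) (X_mem i) one_pos w (isUnit_aeval_X (R := ZMod p) hw))
    (Q : MvPolynomial (Fin (2 * d - 1)) (ZMod p)) (n : ℕ) (hQ : Q.IsHomogeneous n)
    (hQ0 : subst (thetaForm (ZMod p) d) Q = 0) : MvPolynomial.aeval w Q = 0 := by
  have hQ' : Q ∈ grading (ZMod p) (Fin (2 * d - 1)) (n • 1) := by simpa using hQ
  have hr : 0 < 2 * d - 2 := by omega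
  have h := eq_zero_of_factors_image (theta (ZMod p) d hd)
    (Proj.awayι (grading (ZMod p) _) (MvPolynomial.X i) (X_mem i) one_pos)
    (sourceChart (thetaForm (ZMod p) d) (thetaForm_isHomogeneous _ d) hr i)
    (CommRingCat.ofHom (substAway (thetaForm (ZMod p) d) (thetaForm_isHomogeneous _ d)
      (MvPolynomial.X i)))
    (sourceChart_comp_theta d hd i)
    (by
      rw [Proj.opensRange_awayι, opensRange_sourceChart]
      exact theta_preimage_le p d hd i)
    (CommRingCat.ofHom (evalAway (MvPolynomial.X i) w (isUnit_aeval_X hw))) y hy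
    (HomogeneousLocalization.Away.mk (grading (ZMod p) _) (X_mem i) n Q hQ')
    (by
      apply HomogeneousLocalization.val_injective
      refine (val_substAway _ _ _ _).trans ?_
      rw [HomogeneousLocalization.Away.val_mk, substLoc, Localization.mk_eq_mk',
        IsLocalization.map_mk']
      have : (subst (thetaForm (ZMod p) d)).toRingHom Q = 0 := hQ0
      rw [HomogeneousLocalization.val_zero]
      exact (congrArg (fun a ↦ IsLocalization.mk' _ a _) this).trans (IsLocalization.mk'_zero _))
  rw [← evalAway_mk (MvPolynomial.X i) w (isUnit_aeval_X hw) (X_mem i) n Q hQ']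
  have h' : evalAway (MvPolynomial.X i) w (isUnit_aeval_X hw)
    (HomogeneousLocalization.Away.mk (grading (ZMod p) _) (X_mem i) n Q hQ') = 0 := h
  rw [h', zero_mul]

end

/-- A point which, after an injective base extension, lifts to `ℙ^1`, factors through the image of
`θ`. -/
lemma exists_lift_image (p d : ℕ) (hd : 1 < d) {B B' : Type} [CommRing B] [CommRing B'] (φ : B →+* B') (hφ : Function.Injective φ)
    (g : Spec (.of B) ⟶ ProjSpace (ZMod p) (Fin (2 * d - 1)))
    (y : Spec (.of B') ⟶ ProjSpace (ZMod p) (Fin 2))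
    (h : Spec.map (CommRingCat.ofHom φ) ≫ g = y ≫ theta (ZMod p) d hd) :
    ∃ z, z ≫ curveι p d hd = g := by
  have h1 : (Spec.map (CommRingCat.ofHom φ)).ker = ⊥ := by
    rw [Scheme.ker_of_isAffine]
    have : RingHom.ker (Spec.map (CommRingCat.ofHom φ)).appTop.hom = ⊥ := by
      rw [← RingHom.injective_iff_ker_eq_bot]
      have e := Scheme.ΓSpecIso_naturality (CommRingCat.ofHom φ)
      intro a b hab
      apply (ConcreteCategory.bijective_of_isIso (Scheme.ΓSpecIso (.of B)).hom).1
      apply hφ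
      have ea := ConcreteCategory.congr_hom e a
      have eb := ConcreteCategory.congr_hom e b
      rw [ConcreteCategory.comp_apply, ConcreteCategory.comp_apply] at ea eb
      refine ea.symm.trans (Eq.trans ?_ eb)
      exact congrArg _ hab
    rw [this]
    exact Scheme.IdealSheafData.ext_of_isAffine (by simp)
  -- Injectivity of φ means that passing to B' loses no equations. The ideal of C is the kernel of
  -- θ, so it vanishes on the lift to ℙ¹ and hence already on g.
  have h2 : (Spec.map (CommRingCat.ofHom φ) ≫ g).ker = g.ker := by
    rw [Scheme.Hom.ker_comp, h1, Scheme.IdealSheafData.map_bot]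
  have h3 : (curveι p d hd).ker ≤ g.ker := by
    rw [← h2, h]
    refine le_trans ?_ (Scheme.Hom.le_ker_comp y _)
    exact (Scheme.IdealSheafData.ker_subschemeι _).le
  exact ⟨IsClosedImmersion.lift _ _ h3, IsClosedImmersion.lift_fac _ _ _⟩

end Unicritical
end

noncomputable section

namespace Unicritical

/-! ### Pairs of polynomials -/

section Pairs

open Polynomial

variable {B B' : Type} [CommRing B] [CommRing B']

/-- The polynomial `f' g - f g'`. -/
def critPoly (f g : B[X]) : B[X] := derivative f * g - f * derivative g

lemma critPoly_map (φ : B →+* B') (f g : B[X]) :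
    critPoly (f.map φ) (g.map φ) = (critPoly f g).map φ := by
  simp [critPoly, derivative_map]

lemma critPoly_C_mul (c : B) (f g : B[X]) :
    critPoly (C c * f) (C c * g) = C (c ^ 2) * critPoly f g := by
  simp only [critPoly, derivative_mul, derivative_C, map_pow]
  ring

/-- The naive bound is 2d - 1, but the two contributions d a_d b_d in that degree cancel. -/
lemma natDegree_critPoly_le {d : ℕ} (hd : 0 < d) {f g : B[X]} (hf : f.natDegree ≤ d)
    (hg : g.natDegree ≤ d) : (critPoly f g).natDegree ≤ 2 * d - 2 := by
  have hf' : (derivative f).natDegree ≤ d - 1 := (natDegree_derivative_le f).trans (by omega)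
  have hg' : (derivative g).natDegree ≤ d - 1 := (natDegree_derivative_le g).trans (by omega)
  rw [natDegree_le_iff_coeff_eq_zero]
  intro n hn
  rcases (by omega : n = d - 1 + d ∨ 2 * d - 1 < n) with h | h
  · have e1 := coeff_mul_add_eq_of_natDegree_le hf' hg
    have e2 := coeff_mul_add_eq_of_natDegree_le hf hg'
    rw [critPoly, coeff_sub, h, e1, add_comm (d - 1) d, e2, coeff_derivative,
      coeff_derivative, show d - 1 + 1 = d by omega]
    ring
  · apply coeff_eq_zero_of_natDegree_lt
    refine lt_of_le_of_lt (natDegree_sub_le_of_le (m := 2 * d - 1) (n := 2 * d - 1) ?_ ?_) (by simpa using h)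
    · exact natDegree_mul_le.trans (by omega)
    · exact natDegree_mul_le.trans (by omega)

/-- For monomials, W is ab(k - l)z^{k+l-1}. Reversal replaces (i, j) by (d - i, d - j), which
changes the sign of the factor k - l and sends the exponent i + j - 1 to 2d - 2 - (i + j - 1). -/
lemma reflect_critPoly_monomial {d i j : ℕ} (hd : 0 < d) (hi : i ≤ d) (hj : j ≤ d) (a b : B) :
    critPoly (reflect d (C a * X ^ i)) (reflect d (C b * X ^ j)) =
      -reflect (2 * d - 2) (critPoly (C a * X ^ i) (C b * X ^ j)) := by
  have key : ∀ k l : ℕ, critPoly (C a * X ^ k) (C b * X ^ l) =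
      C (a * b * ((k : B) - l)) * X ^ (k + l - 1) := by
    intro k l
    rcases k with _ | k
    · rcases l with _ | l
      · simp [critPoly]
      · simp only [critPoly, derivative_mul, derivative_C, derivative_X_pow, pow_zero,
          derivative_one, Nat.add_sub_cancel, zero_add]
        simp only [map_mul, map_sub, Nat.cast_add, Nat.cast_one]
        simp
        ring
    · rcases l with _ | l
      · simp only [critPoly, derivative_mul, derivative_C, derivative_X_pow, pow_zero,
          derivative_one, Nat.add_sub_cancel, add_zero]
        simp only [map_mul, map_sub, map_natCast, Nat.cast_add, Nat.cast_one]
        simp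
        ring
      · have : k + 1 + (l + 1) - 1 = k + l + 1 := by omega
        rw [this]
        simp only [critPoly, derivative_mul, derivative_C, derivative_X_pow, Nat.add_sub_cancel]
        simp only [map_mul, map_sub, Nat.cast_add, Nat.cast_one]
        simp
        ring
  rw [reflect_C_mul_X_pow, reflect_C_mul_X_pow, revAt_le hi, revAt_le hj, key, key,
    reflect_C_mul_X_pow]
  -- At i + j = 0 and i + j = 2d truncated subtraction spoils the exponents, but then i = j and both
  -- sides vanish.
  by_cases h0 : i + j = 0
  · obtain ⟨rfl, rfl⟩ : i = 0 ∧ j = 0 := by omega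
    simp
  by_cases h1 : i + j = 2 * d
  · obtain ⟨rfl, rfl⟩ : i = d ∧ j = d := by omega
    simp
  rw [revAt_le (by omega), show d - i + (d - j) - 1 = 2 * d - 2 - (i + j - 1) by omega,
    ← neg_mul, ← C_neg]
  congr 2
  push_cast [hi, hj]
  ring

lemma critPoly_sum_sum {ι κ : Type} (s : Finset ι) (t : Finset κ) (f : ι → B[X]) (g : κ → B[X]) :
    critPoly (∑ i ∈ s, f i) (∑ j ∈ t, g j) = ∑ i ∈ s, ∑ j ∈ t, critPoly (f i) (g j) := by
  simp only [critPoly, derivative_sum, Finset.sum_mul_sum, Finset.sum_sub_distrib]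

lemma reflect_sum {ι : Type} (N : ℕ) (s : Finset ι) (f : ι → B[X]) :
    reflect N (∑ i ∈ s, f i) = ∑ i ∈ s, reflect N (f i) := by
  classical
  induction s using Finset.induction_on with
  | empty => simp
  | insert a s ha ih => rw [Finset.sum_insert ha, Finset.sum_insert ha, reflect_add, ih]

/-- This is how W transforms under z ↦ 1/z; W is bilinear in (f, g), so monomials suffice. It makes
the chart of critical points away from 0 a copy of the chart away from ∞. -/
lemma critPoly_reflect {d : ℕ} (hd : 0 < d) {f g : B[X]} (hf : f.natDegree ≤ d)
    (hg : g.natDegree ≤ d) :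
    critPoly (reflect d f) (reflect d g) = -reflect (2 * d - 2) (critPoly f g) := by
  have hf' := f.as_sum_range_C_mul_X_pow' (n := d + 1) (by omega)
  have hg' := g.as_sum_range_C_mul_X_pow' (n := d + 1) (by omega)
  rw [hf', hg', reflect_sum, reflect_sum, critPoly_sum_sum, critPoly_sum_sum, reflect_sum,
    ← Finset.sum_neg_distrib]
  refine Finset.sum_congr rfl fun i hi ↦ ?_
  rw [reflect_sum, ← Finset.sum_neg_distrib]
  refine Finset.sum_congr rfl fun j hj ↦ ?_
  rw [Finset.mem_range] at hi hj
  exact reflect_critPoly_monomial hd (by omega) (by omega) _ _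

lemma natDegree_reflect_le' {d : ℕ} {f : B[X]} (hf : f.natDegree ≤ d) :
    (reflect d f).natDegree ≤ d :=
  natDegree_reflect_le.trans (by simp [hf])

lemma sylvester_reflect (d : ℕ) (f g : B[X]) :
    sylvester (reflect d f) (reflect d g) d d = (sylvester f g d d).submatrix Fin.revPerm
      (finSumFinEquiv.symm.trans ((Equiv.sumCongr Fin.revPerm Fin.revPerm).trans
        finSumFinEquiv)) := by
  have key : ∀ (h : B[X]) (i : Fin (d + d)) (j : Fin d),
      (if (i : ℕ) ∈ Set.Icc (j : ℕ) (j + d) then (reflect d h).coeff (i - j) else 0) =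
      (if ((Fin.rev i : Fin (d + d)) : ℕ) ∈ Set.Icc ((Fin.rev j : Fin d) : ℕ) ((Fin.rev j : Fin d) + d)
        then h.coeff ((Fin.rev i : Fin (d + d)) - (Fin.rev j : Fin d)) else 0) := by
    intro h i j
    simp only [Set.mem_Icc, Fin.val_rev]
    have hi := i.2
    have hj := j.2
    by_cases hc : (j : ℕ) ≤ i ∧ (i : ℕ) ≤ j + d
    · rw [if_pos hc, if_pos (by omega), coeff_reflect, revAt_le (by omega)]
      congr 1
      omega
    · rw [if_neg hc, if_neg (by omega)]
  ext i j
  induction j using Fin.addCases with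
  | left j => simpa [sylvester] using key g i j
  | right j =>
    simp only [Matrix.submatrix_apply, sylvester, Matrix.of_apply, Fin.addCases_right,
      Equiv.trans_apply, finSumFinEquiv_symm_apply_natAdd, Equiv.sumCongr_apply, Sum.map_inr,
      finSumFinEquiv_apply_right, Fin.revPerm_apply]
    exact key f i j

/-- Reversal only permutes the rows and columns of the Sylvester matrix. Only invertibility is
recorded, so the sign of the permutations plays no role. -/
lemma isUnit_resultant_reflect {d : ℕ} {f g : B[X]} (h : IsUnit (resultant f g d d)) :
    IsUnit (resultant (reflect d f) (reflect d g) d d) := by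
  rw [resultant, ← Matrix.isUnit_iff_isUnit_det] at h ⊢
  rw [sylvester_reflect]
  exact (Matrix.isUnit_submatrix_equiv _ _).mpr h

/-! ### Coefficient vectors -/

/-- The coefficient vector `(a_d, …, a_0, b_d, …, b_0)` of a pair `(f, g)`. -/
def coeffVec (d : ℕ) (f g : B[X]) : CoeffIdx d → B :=
  Sum.elim (fun i ↦ f.coeff i) (fun i ↦ g.coeff i)

lemma coeffVec_map (φ : B →+* B') (d : ℕ) (f g : B[X]) :
    coeffVec d (f.map φ) (g.map φ) = φ ∘ coeffVec d f g := by
  ext (i | i) <;> simp [coeffVec]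

lemma coeffVec_C_mul (c : B) (d : ℕ) (f g : B[X]) :
    coeffVec d (C c * f) (C c * g) = c • coeffVec d f g := by
  ext (i | i) <;> simp [coeffVec]

lemma coeffVec_injective {d : ℕ} {f g f₂ g₂ : B[X]} (hf : f.natDegree ≤ d) (hg : g.natDegree ≤ d)
    (hf₂ : f₂.natDegree ≤ d) (hg₂ : g₂.natDegree ≤ d)
    (h : coeffVec d f g = coeffVec d f₂ g₂) : f = f₂ ∧ g = g₂ := by
  constructor
  · ext n
    by_cases hn : n < d + 1
    · exact congrFun h (Sum.inl ⟨n, hn⟩)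
    · rw [coeff_eq_zero_of_natDegree_lt (by omega), coeff_eq_zero_of_natDegree_lt (by omega)]
  · ext n
    by_cases hn : n < d + 1
    · exact congrFun h (Sum.inr ⟨n, hn⟩)
    · rw [coeff_eq_zero_of_natDegree_lt (by omega), coeff_eq_zero_of_natDegree_lt (by omega)]

lemma exists_coeffVec {d : ℕ} (v : CoeffIdx d → B) :
    ∃ f g : B[X], f.natDegree ≤ d ∧ g.natDegree ≤ d ∧ v = coeffVec d f g := by
  classical
  refine ⟨∑ i : Fin (d + 1), C (v (Sum.inl i)) * X ^ (i : ℕ),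
    ∑ i : Fin (d + 1), C (v (Sum.inr i)) * X ^ (i : ℕ), ?_, ?_, ?_⟩
  · exact natDegree_sum_le_of_forall_le _ _ fun i _ ↦
      (natDegree_C_mul_X_pow_le _ _).trans (by omega)
  · exact natDegree_sum_le_of_forall_le _ _ fun i _ ↦
      (natDegree_C_mul_X_pow_le _ _).trans (by omega)
  · ext (i | i) <;> simp [coeffVec, finsetSum_coeff, coeff_X_pow, Fin.val_inj]

variable {R : Type} [CommRing R] [Algebra R B]

lemma map_genNum (d : ℕ) {f g : B[X]} (hf : f.natDegree ≤ d) :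
    (genNum R d).map (MvPolynomial.aeval (coeffVec d f g)).toRingHom = f := by
  ext n
  rw [coeff_map, coeff_genNum]
  split_ifs with h
  · exact MvPolynomial.aeval_X _ _
  · rw [coeff_eq_zero_of_natDegree_lt (by omega), map_zero]

lemma map_genDen (d : ℕ) {f g : B[X]} (hg : g.natDegree ≤ d) :
    (genDen R d).map (MvPolynomial.aeval (coeffVec d f g)).toRingHom = g := by
  ext n
  rw [coeff_map, coeff_genDen]
  split_ifs with h
  · exact MvPolynomial.aeval_X _ _
  · rw [coeff_eq_zero_of_natDegree_lt (by omega), map_zero]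

lemma aeval_genRes (d : ℕ) {f g : B[X]} (hf : f.natDegree ≤ d) (hg : g.natDegree ≤ d) :
    MvPolynomial.aeval (coeffVec d f g) (genRes R d) = resultant f g d d := by
  have := resultant_map_map (genNum R d) (genDen R d) d d
    (MvPolynomial.aeval (coeffVec d f g)).toRingHom
  rw [map_genNum d hf, map_genDen d hg] at this
  exact this.symm

lemma aeval_critForm (d : ℕ) {f g : B[X]} (hf : f.natDegree ≤ d) (hg : g.natDegree ≤ d)
    (i : Fin (2 * d - 1)) :
    MvPolynomial.aeval (coeffVec d f g) (critForm R d i) = (critPoly f g).coeff i := by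
  have := critPoly_map (MvPolynomial.aeval (coeffVec d f g)).toRingHom (genNum R d) (genDen R d)
  rw [map_genNum d hf, map_genDen d hg] at this
  rw [this, coeff_map]
  rfl

lemma aeval_thetaForm (d : ℕ) (v : Fin 2 → B) (i : Fin (2 * d - 1)) :
    MvPolynomial.aeval v (thetaForm R d i) =
      ((C (v 1) * X - C (v 0)) ^ (2 * d - 2)).coeff i := by
  have e : ((C (MvPolynomial.X 1 : MvPolynomial (Fin 2) R) * X -
      C (MvPolynomial.X 0)) ^ (2 * d - 2)).map (MvPolynomial.aeval v).toRingHom =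
      (C (v 1) * X - C (v 0)) ^ (2 * d - 2) := by
    simp [Polynomial.map_sub]
  rw [← e, coeff_map]
  rfl

end Pairs

end Unicritical
end

noncomputable section

namespace Unicritical

/-! ### Unicritical functions over a ring give points of U_d -/

section Points

open Polynomial

variable {B B' : Type} [CommRing B] [CommRing B']

/-- `f / g` is a rational function of degree `d` over `B`. -/
structure IsRat (d : ℕ) (f g : B[X]) : Prop where
  left_le : f.natDegree ≤ d
  right_le : g.natDegree ≤ d
  isUnit_resultant : IsUnit (resultant f g d d)

/-- `f / g` is a rational function of degree `d` over `B` with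
`f' g - f g' = c (z ^ q - S) ^ m`, `c` a unit. -/
structure IsUnicrit (d q m : ℕ) (f g : B[X]) : Prop extends IsRat d f g where
  exists_eq : ∃ c S : B, IsUnit c ∧ critPoly f g = C c * (X ^ q - C S) ^ m

lemma IsRat.map {d : ℕ} {f g : B[X]} (h : IsRat d f g) (φ : B →+* B') :
    IsRat d (f.map φ) (g.map φ) :=
  ⟨natDegree_map_le.trans h.1, natDegree_map_le.trans h.2,
    by rw [resultant_map_map]; exact h.3.map φ⟩

lemma IsRat.reflect {d : ℕ} {f g : B[X]} (h : IsRat d f g) :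
    IsRat d (f.reflect d) (g.reflect d) :=
  ⟨natDegree_reflect_le' h.1, natDegree_reflect_le' h.2, isUnit_resultant_reflect h.3⟩

/-- The coefficients of `(a z ^ q - b) ^ m`. -/
lemma coeff_C_mul_X_pow_sub_C_pow {q : ℕ} (hq : 0 < q) (a b : B) (m n : ℕ) :
    ((C a * X ^ q - C b) ^ m).coeff n =
      if q ∣ n then (m.choose (n / q) : B) * a ^ (n / q) * (-b) ^ (m - n / q) else 0 := by
  have e : (C a * X ^ q - C b) ^ m = expand B q ((C a * X + C (-b)) ^ m) := by
    simp [sub_eq_add_neg]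
  rw [e, coeff_expand hq]
  split_ifs with h
  · rw [add_pow, finsetSum_coeff]
    simp_rw [mul_pow, ← C_pow, ← C_eq_natCast, mul_assoc, coeff_C_mul, mul_comm (X ^ _),
      ← C_mul, coeff_C_mul, coeff_X_pow]
    by_cases hn : n / q < m + 1
    · rw [Finset.sum_eq_single (n / q)]
      · simp only [if_true]; ring
      · intro b _ hb; rw [if_neg (Ne.symm hb)]; ring
      · intro h'; exact absurd (Finset.mem_range.mpr hn) h'
    · rw [Nat.choose_eq_zero_of_lt (by omega), Nat.cast_zero, zero_mul]
      refine Finset.sum_eq_zero fun i hi ↦ ?_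
      rw [if_neg]
      · ring
      · rw [Finset.mem_range] at hi; omega
  · rfl

variable {p : ℕ} [Fact p.Prime] {d : ℕ}

section

/-- The morphism to `ℙ^{2d+1}` given by a rational function. -/
def IsRat.pt (p : ℕ) [Fact p.Prime] [Algebra (ZMod p) B] {d : ℕ} {f g : B[X]} (h : IsRat d f g) (hd : 1 < d) :
    Spec (.of B) ⟶ ProjSpace (ZMod p) (CoeffIdx d) :=
  Unicritical.pt (genRes (ZMod p) d) (genRes_mem d _) (by omega) (coeffVec d f g)
    (by rw [aeval_genRes d h.1 h.2]; exact h.3)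

variable [Algebra (ZMod p) B] [Algebra (ZMod p) B']

lemma IsRat.map_comp_pt (hd : 1 < d) {f g : B[X]} (h : IsRat d f g) (φ : B →ₐ[ZMod p] B')
    {f₂ g₂ : B'[X]} (hf : f₂ = f.map φ.toRingHom) (hg : g₂ = g.map φ.toRingHom)
    (h' : IsRat d f₂ g₂) :
    Spec.map (CommRingCat.ofHom φ.toRingHom) ≫ h.pt p hd = h'.pt p hd := by
  rw [IsRat.pt, Unicritical.map_comp_pt]
  subst hf hg
  have e := coeffVec_map φ.toRingHom d f g
  have : ∀ (v : CoeffIdx d → B') (w) (hv : v = w) (hu : IsUnit _),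
    Unicritical.pt (genRes (ZMod p) d) (genRes_mem d _) (by omega) v hu =
      Unicritical.pt (genRes (ZMod p) d) (genRes_mem d _) (by omega) w (hv ▸ hu) := by
    rintro v w rfl hu; rfl
  exact (this _ _ e.symm _)

lemma IsRat.pt_C_mul (hd : 1 < d) {f g f₂ g₂ : B[X]} (h : IsRat d f g) (h' : IsRat d f₂ g₂)
    (c : B) (hc : IsUnit c) (hf : f₂ = C c * f) (hg : g₂ = C c * g) :
    h'.pt p hd = h.pt p hd := by
  subst hf hg
  have e := coeffVec_C_mul c d f g
  have : ∀ (v : CoeffIdx d → B) (w) (hv : v = w) (hu : IsUnit _),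
    Unicritical.pt (genRes (ZMod p) d) (genRes_mem d _) (by omega) v hu =
      Unicritical.pt (genRes (ZMod p) d) (genRes_mem d _) (by omega) w (hv ▸ hu) := by
    rintro v w rfl hu; rfl
  refine (this _ _ e _).trans ?_
  exact pt_smul _ _ c hc _ _ _

/-- At an inseparable point every surviving exponent of f and g is divisible by p, so f' = g' = 0
modulo the prime and W vanishes there. A unit coefficient of W forbids this. -/
lemma IsRat.pt_mem_sepLocus (hd : 1 < d) {f g : B[X]} (h : IsRat d f g) {n : ℕ}
    (hn : IsUnit ((critPoly f g).coeff n)) (x : Spec (.of B)) :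
    h.pt p hd x ∈ sepLocus p d := by
  refine ⟨?_, fun hx ↦ ?_⟩
  · have := (pt_mem_basicOpen (genRes_mem d (ZMod p)) (by omega) (coeffVec d f g)
      (by rw [aeval_genRes d h.1 h.2]; exact h.3) (genRes_mem d (ZMod p)) (by omega) x).mpr
    refine this fun hmem ↦ ?_
    rw [aeval_genRes d h.1 h.2] at hmem
    exact x.isPrime.ne_top (Ideal.eq_top_of_isUnit_mem _ hmem h.3)
  · have hX : ∀ i : CoeffIdx d, MvPolynomial.X i ∈ (h.pt p hd x).asHomogeneousIdeal →
        coeffVec d f g i ∈ x.asIdeal := by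
      intro i hi
      by_contra hcon
      have := (pt_mem_basicOpen (genRes_mem d (ZMod p)) (by omega) (coeffVec d f g)
        (by rw [aeval_genRes d h.1 h.2]; exact h.3) (X_mem i) one_pos x).mpr
        (by rw [MvPolynomial.aeval_X]; exact hcon)
      exact (Proj.mem_basicOpen _ _ _).mp this hi
    let π := Ideal.Quotient.mk x.asIdeal
    have hp : (p : B ⧸ x.asIdeal) = 0 := by
      have : ((p : ZMod p) : ZMod p) = 0 := ZMod.natCast_self p
      have h2 := congrArg (π.comp (algebraMap (ZMod p) B)) this
      rwa [map_natCast, map_zero] at h2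
    have key : ∀ F : B[X], F.natDegree ≤ d → (∀ i : Fin (d + 1), ¬ p ∣ (i : ℕ) →
        F.coeff i ∈ x.asIdeal) → derivative (F.map π) = 0 := by
      intro F hF hi
      ext n
      rw [coeff_derivative, coeff_map, coeff_zero]
      by_cases h1 : n + 1 < d + 1
      · by_cases h2 : p ∣ n + 1
        · obtain ⟨k, hk⟩ := h2
          have : (n : B ⧸ x.asIdeal) + 1 = 0 := by
            rw [← Nat.cast_one, ← Nat.cast_add, hk, Nat.cast_mul, hp, zero_mul]
          rw [this, mul_zero]
        · rw [Ideal.Quotient.eq_zero_iff_mem.mpr (hi ⟨n + 1, h1⟩ h2), zero_mul]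
      · rw [coeff_eq_zero_of_natDegree_lt (by omega), map_zero, zero_mul]
    have h1 := key f h.1 fun i hi ↦ hX (Sum.inl i) (hx.2 i hi).1
    have h2 := key g h.2 fun i hi ↦ hX (Sum.inr i) (hx.2 i hi).2
    have h3 : (critPoly f g).map π = 0 := by
      rw [← critPoly_map, critPoly, h1, h2]; simp
    have h4 := congrArg (fun F ↦ F.coeff n) h3
    simp only [coeff_map, coeff_zero] at h4
    exact x.isPrime.ne_top (Ideal.eq_top_of_isUnit_mem _ (Ideal.Quotient.eq_zero_iff_mem.mp h4) hn)

lemma pt_X_eq_of_smul {R σ : Type} [CommRing R] [Algebra R B] {i : σ} {v w : σ → B} (μ : B)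
    (hμ : IsUnit μ) (hv : v = μ • w)
    (hu : IsUnit (MvPolynomial.aeval v (MvPolynomial.X i : MvPolynomial σ R)))
    (hw : IsUnit (MvPolynomial.aeval w (MvPolynomial.X i : MvPolynomial σ R))) :
    pt (MvPolynomial.X i) (X_mem i) one_pos v hu =
      pt (MvPolynomial.X i) (X_mem i) one_pos w hw := by
  subst hv
  exact pt_smul _ _ μ hμ w hw hu

/-- A rational function factors through `U_d` if, after an injective base extension, the
polynomial `f' g - f g'` is a unit multiple of `(t z - s) ^ (2 d - 2)`. -/
lemma IsRat.exists_lift (hd : 1 < d) {f g : B[X]} (h : IsRat d f g) {n : ℕ}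
    (hn2 : n < 2 * d - 1) (hn : IsUnit ((critPoly f g).coeff n)) (φ : B →ₐ[ZMod p] B') (hφ : Function.Injective φ)
    (s : Fin 2 → B') (k : Fin 2) (hk : s k = 1) (μ : B') (hμ : IsUnit μ)
    (hs : (critPoly f g).map φ.toRingHom = C μ * (C (s 1) * X - C (s 0)) ^ (2 * d - 2)) :
    ∃ y : Spec (.of B) ⟶ unicriticalLocus p d hd,
      y ≫ unicriticalLocus.toProjSpace p d hd = h.pt p hd := by
  have hr : ∀ x, h.pt p hd x ∈ sepLocus p d := h.pt_mem_sepLocus hd hn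
  let y₀ : Spec (.of B) ⟶ (sepLocus p d).toScheme :=
    IsOpenImmersion.lift (sepLocus p d).ι (h.pt p hd) (by
      rw [Scheme.Opens.range_ι]; rintro _ ⟨x, rfl⟩; exact hr x)
  have hy₀ : y₀ ≫ (sepLocus p d).ι = h.pt p hd := IsOpenImmersion.lift_fac _ _ _
  have hn' : IsUnit (MvPolynomial.aeval (coeffVec d f g) (critForm (ZMod p) d ⟨n, hn2⟩)) := by
    rw [aeval_critForm d h.1 h.2]; exact hn
  have hω := pt_comp_omega p d hd (genRes_mem d (ZMod p)) (by omega) (coeffVec d f g)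
    (by rw [aeval_genRes d h.1 h.2]; exact h.3) y₀ hy₀ ⟨n, hn2⟩ hn'
  have hθ : ∀ i : Fin (2 * d - 1), φ (MvPolynomial.aeval (coeffVec d f g) (critForm (ZMod p) d i)) =
      μ * MvPolynomial.aeval s (thetaForm (ZMod p) d i) := by
    intro i
    rw [aeval_critForm d h.1 h.2, aeval_thetaForm, ← coeff_C_mul, ← hs, coeff_map]
    rfl
  have hvec : φ ∘ (fun j ↦ MvPolynomial.aeval (coeffVec d f g) (critForm (ZMod p) d j)) =
      μ • fun j ↦ MvPolynomial.aeval s (thetaForm (ZMod p) d j) := by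
    ext i; exact hθ i
  have hnθ : IsUnit (MvPolynomial.aeval s (thetaForm (ZMod p) d ⟨n, hn2⟩)) := by
    have := hn'.map φ
    rw [hθ] at this
    exact isUnit_of_mul_isUnit_right this
  have hlift := exists_lift_image p d hd φ.toRingHom hφ (y₀ ≫ omega p d hd)
    (Unicritical.pt (MvPolynomial.X k) (X_mem k) one_pos s (isUnit_aeval_X (R := ZMod p) (hk ▸ isUnit_one)))
    (by
      rw [hω, Unicritical.map_comp_pt, pt_comp_theta d hd _ _ s _ ⟨n, hn2⟩ hnθ]
      exact pt_X_eq_of_smul μ hμ hvec _ _)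
  obtain ⟨z, hz⟩ := hlift
  refine ⟨pullback.lift y₀ z hz.symm, ?_⟩
  exact (pullback.lift_fst_assoc _ _ _ _).trans hy₀

lemma sub_pow_pow_of_algebra {A : Type} [CommRing A] [Algebra (ZMod p) A] (k : ℕ) (x y : A) :
    (x - y) ^ p ^ k = x ^ p ^ k - y ^ p ^ k := by
  nontriviality A
  have : CharP A p := charP_of_injective_algebraMap (algebraMap (ZMod p) A).injective p
  exact sub_pow_char_pow _ _ k

lemma reflect_X_sub_C_pow (r : B) (N : ℕ) :
    reflect N ((X - C r) ^ N) = (1 - C r * X) ^ N := by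
  induction N with
  | zero => simp
  | succ N ih =>
    have hN : ((X - C r) ^ N).natDegree ≤ N :=
      natDegree_pow_le.trans ((Nat.mul_le_mul_left N (natDegree_X_sub_C_le r)).trans (by simp))
    rw [pow_succ, reflect_mul _ _ hN (natDegree_X_sub_C_le r), ih, reflect_sub, reflect_one_X, reflect_C, pow_one, pow_succ]

variable {k m : ℕ}

/-- S need not be a p^k-th power in B. Adjoining a root r of z^q - S makes (z^q - S)^m = (z -
r)^{2d-2}, and B injects because the polynomial is monic of positive degree. -/
lemma IsUnicrit.exists_extension (hqm : p ^ k * m = 2 * d - 2) {f g : B[X]}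
    (h : IsUnicrit d (p ^ k) m f g) :
    ∃ (B' : Type) (_ : CommRing B') (_ : Algebra (ZMod p) B') (φ : B →ₐ[ZMod p] B') (c : B)
      (r : B'), Function.Injective φ ∧ IsUnit c ∧ (critPoly f g).coeff (2 * d - 2) = c ∧
      (critPoly f g).map φ.toRingHom = C (φ c) * (X - C r) ^ (2 * d - 2) := by
  obtain ⟨c, S, hc, hS⟩ := h.exists_eq
  have hq : p ^ k ≠ 0 := pow_ne_zero _ (Fact.out : p.Prime).ne_zero
  let P : B[X] := X ^ p ^ k - C S
  have hP : P.Monic := monic_X_pow_sub_C S hq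
  refine ⟨AdjoinRoot P, inferInstance, inferInstance,
    (Algebra.ofId B (AdjoinRoot P)).restrictScalars (ZMod p), c, AdjoinRoot.root P, ?_, hc, ?_, ?_⟩
  · nontriviality B
    refine (injective_iff_map_eq_zero _).mpr fun a ha ↦ ?_
    by_contra h0
    refine hP.not_dvd_of_degree_lt (C_ne_zero.mpr h0) ?_ (AdjoinRoot.mk_eq_zero.mp ha)
    rw [degree_X_pow_sub_C (Nat.pos_of_ne_zero hq), degree_C h0]
    exact_mod_cast Nat.pos_of_ne_zero hq
  · have := coeff_C_mul_X_pow_sub_C_pow (Nat.pos_of_ne_zero hq) (1 : B) S m (2 * d - 2)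
    rw [C_1, one_mul, ← hqm, if_pos (Dvd.intro _ rfl), Nat.mul_div_cancel_left _
      (Nat.pos_of_ne_zero hq)] at this
    rw [hS, coeff_C_mul, ← hqm, this]
    simp
  · have hr : algebraMap B (AdjoinRoot P) S = AdjoinRoot.root P ^ p ^ k := by
      have := AdjoinRoot.eval₂_root P
      simp only [P, eval₂_sub, eval₂_X_pow, eval₂_C] at this
      exact (sub_eq_zero.mp this).symm
    rw [hS, ← hqm, pow_mul, sub_pow_pow_of_algebra (p := p), ← C_pow, ← hr]
    simp

theorem IsUnicrit.exists_lift (hd : 1 < d) (hqm : p ^ k * m = 2 * d - 2) {f g : B[X]}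
    (h : IsUnicrit d (p ^ k) m f g) :
    ∃ y : Spec (.of B) ⟶ unicriticalLocus p d hd,
      y ≫ unicriticalLocus.toProjSpace p d hd = h.toIsRat.pt p hd := by
  obtain ⟨B', _, _, φ, c, r, hφ, hc, h1, h2⟩ := h.exists_extension hqm
  refine h.toIsRat.exists_lift hd (n := 2 * d - 2) (by omega) (h1 ▸ hc) φ hφ ![r, 1] 1 rfl (φ c)
    (hc.map φ) ?_
  rw [h2]
  simp

theorem IsUnicrit.exists_lift_reflect (hd : 1 < d) (hqm : p ^ k * m = 2 * d - 2) {f g : B[X]}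
    (h : IsUnicrit d (p ^ k) m f g) :
    ∃ y : Spec (.of B) ⟶ unicriticalLocus p d hd,
      y ≫ unicriticalLocus.toProjSpace p d hd = h.toIsRat.reflect.pt p hd := by
  obtain ⟨B', _, _, φ, c, r, hφ, hc, h1, h2⟩ := h.exists_extension hqm
  have e := critPoly_reflect (by omega : 0 < d) h.left_le h.right_le
  refine h.toIsRat.reflect.exists_lift hd (n := 0) (by omega) ?_ φ hφ ![1, r] 0 rfl (-φ c)
    (hc.map φ).neg ?_
  · rw [e, coeff_neg, coeff_reflect, revAt_zero, h1]
    exact hc.neg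
  · rw [e, Polynomial.map_neg, ← reflect_map, h2, reflect_C_mul, reflect_X_sub_C_pow]
    -- Reversal turns (z - r)^{2d-2} into (1 - rz)^{2d-2}, which the even exponent identifies with
    -- (rz - 1)^{2d-2}, the value of θ at (1 : r).
    have : Even (2 * d - 2) := ⟨d - 1, by omega⟩
    rw [← this.neg_pow]
    simp

end

end Points

end Unicritical
end

noncomputable section

namespace Unicritical

/-! ### Local-ring points of U_d are unicritical functions -/

section LocalPoints

open Polynomial

variable {B : Type} [CommRing B] {p : ℕ} [Fact p.Prime] {d k m : ℕ}

/-- By Frobenius (tz - s)^{2d-2} = (t^q z^q - s^q)^m with q = p^k, so θ depends only on the q-th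
powers of s and t. -/
lemma thetaForm_eq (hqm : p ^ k * m = 2 * d - 2) (n : Fin (2 * d - 1)) :
    thetaForm (ZMod p) d n = if p ^ k ∣ (n : ℕ) then
      (m.choose (n / p ^ k) : MvPolynomial (Fin 2) (ZMod p)) *
        (MvPolynomial.X 1 ^ p ^ k) ^ (n / p ^ k : ℕ) *
        (-MvPolynomial.X 0 ^ p ^ k) ^ (m - n / p ^ k) else 0 := by
  rw [← coeff_C_mul_X_pow_sub_C_pow (pow_pos (Fact.out : p.Prime).pos k), thetaForm, ← hqm,
    pow_mul, sub_pow_pow_of_algebra (p := p)]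
  simp [mul_pow]

lemma isUnit_natCast_of_algebra [Algebra (ZMod p) B] (hm : ¬ p ∣ m) : IsUnit (m : B) := by
  have : IsUnit (m : ZMod p) := by
    rw [isUnit_iff_ne_zero, Ne, ZMod.natCast_eq_zero_iff]
    exact hm
  simpa using this.map (algebraMap (ZMod p) B)

/-- The relations between the coefficients of a polynomial in the closure of the family
`(t z - s) ^ (2 d - 2)`. -/
structure ThetaRel (q m : ℕ) (w : ℕ → B) : Prop where
  of_not_dvd : ∀ n ≤ q * m, ¬ q ∣ n → w n = 0
  pow_rel : ∀ j ≤ m, w (q * j) ^ m = (m.choose j : B) ^ m * w (q * m) ^ j * w 0 ^ (m - j)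
  top_rel : ∀ j ≤ m, (m : B) ^ (m - j) * w (q * j) * w (q * m) ^ (m - j) =
    m.choose j * w (q * (m - 1)) ^ (m - j) * w (q * m)
  bot_rel : ∀ j ≤ m, (m : B) ^ j * w (q * j) * w 0 ^ j = m.choose j * w q ^ j * w 0

/-- With T = t^q and s replaced by -s^q, the nonzero θ's are binom(m, j) T^j s^{m-j}. Each relation
is a homogeneous identity between these monomials, of degree 1, m, m - j + 1 and j + 1 respectively,
and is transported to the image by `aeval_eq_zero_of_image`. -/
lemma thetaRel_of_image (hd : 1 < d) [Algebra (ZMod p) B] (hqm : p ^ k * m = 2 * d - 2)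
    (y : Spec (.of B) ⟶ (theta (ZMod p) d hd).image)
    (i : Fin (2 * d - 1)) (w : ℕ → B) (hw : IsUnit (w i))
    (hy : y ≫ curveι p d hd =
      pt (MvPolynomial.X i) (X_mem i) one_pos (fun i ↦ w i) (isUnit_aeval_X (R := ZMod p) hw)) :
    ThetaRel (p ^ k) m w := by
  have key := aeval_eq_zero_of_image p d hd y i (fun i ↦ w i) hw hy
  have hq : 0 < p ^ k := pow_pos (Fact.out : p.Prime).pos k
  have hm : 0 < m := by
    rcases Nat.eq_zero_or_pos m with rfl | h
    · omega
    · exact h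
  have hlt : ∀ j ≤ m, p ^ k * j < 2 * d - 1 := fun j hj ↦ by
    have := Nat.mul_le_mul_left (p ^ k) hj
    omega
  have hX : ∀ j, (MvPolynomial.X j : MvPolynomial (Fin (2 * d - 1)) (ZMod p)).IsHomogeneous 1 :=
    MvPolynomial.isHomogeneous_X _
  have hc : ∀ n : ℕ, (n : MvPolynomial (Fin (2 * d - 1)) (ZMod p)).IsHomogeneous 0 := fun n ↦ by
    have := MvPolynomial.isHomogeneous_C (Fin (2 * d - 1)) (n : ZMod p)
    simpa using this
  have h0 : 0 < 2 * d - 1 := by omega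
  have hθ : ∀ j (hj : j ≤ m), subst (thetaForm (ZMod p) d) (MvPolynomial.X ⟨p ^ k * j, hlt j hj⟩) =
      (m.choose j : MvPolynomial (Fin 2) (ZMod p)) * (MvPolynomial.X 1 ^ p ^ k) ^ j *
        (-MvPolynomial.X 0 ^ p ^ k) ^ (m - j) := fun j hj ↦ by
    rw [subst_X, thetaForm_eq hqm]
    simp [Nat.mul_div_cancel_left _ hq]
  have hθ0 : subst (thetaForm (ZMod p) d) (MvPolynomial.X ⟨0, h0⟩) =
      (-MvPolynomial.X 0 ^ p ^ k) ^ m := by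
    have := hθ 0 (Nat.zero_le _)
    simpa using this
  have hθm : subst (thetaForm (ZMod p) d) (MvPolynomial.X ⟨p ^ k * m, hlt m le_rfl⟩) =
      (MvPolynomial.X 1 ^ p ^ k) ^ m := by
    have := hθ m le_rfl
    simpa using this
  have hθ1 : subst (thetaForm (ZMod p) d) (MvPolynomial.X ⟨p ^ k * (m - 1), hlt _ (by omega)⟩) =
      (m : MvPolynomial (Fin 2) (ZMod p)) * (MvPolynomial.X 1 ^ p ^ k) ^ (m - 1) * (-MvPolynomial.X 0 ^ p ^ k) := by
    have := hθ (m - 1) (by omega)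
    rw [Nat.choose_symm (by omega : 1 ≤ m), Nat.choose_one_right, Nat.sub_sub_self hm,
      pow_one] at this
    exact this
  have hθb : subst (thetaForm (ZMod p) d) (MvPolynomial.X ⟨p ^ k * 1, hlt _ (by omega)⟩) =
      (m : MvPolynomial (Fin 2) (ZMod p)) * (MvPolynomial.X 1 ^ p ^ k) * (-MvPolynomial.X 0 ^ p ^ k) ^ (m - 1) := by
    have := hθ 1 (by omega)
    rw [Nat.choose_one_right, pow_one] at this
    exact this
  generalize hs : (-MvPolynomial.X 0 ^ p ^ k : MvPolynomial (Fin 2) (ZMod p)) = s at *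
  generalize ht : (MvPolynomial.X 1 ^ p ^ k : MvPolynomial (Fin 2) (ZMod p)) = t at *
  refine ⟨fun n hn hdvd ↦ ?_, fun j hj ↦ ?_, fun j hj ↦ ?_, fun j hj ↦ ?_⟩
  · have := key (MvPolynomial.X ⟨n, by omega⟩) 1 (hX _)
      (by rw [subst_X, thetaForm_eq hqm, if_neg hdvd])
    rwa [MvPolynomial.aeval_X] at this
  · have h := key (MvPolynomial.X ⟨p ^ k * j, hlt j hj⟩ ^ m -
      (m.choose j : MvPolynomial (Fin (2 * d - 1)) (ZMod p)) ^ m *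
        MvPolynomial.X ⟨p ^ k * m, hlt m le_rfl⟩ ^ j * MvPolynomial.X ⟨0, h0⟩ ^ (m - j)) m
      (by
        refine MvPolynomial.IsHomogeneous.sub ?_ ?_
        · simpa using (hX ⟨p ^ k * j, hlt j hj⟩).pow m
        · have := (((hc (m.choose j)).pow m).mul ((hX ⟨p ^ k * m, hlt m le_rfl⟩).pow j)).mul
            ((hX ⟨0, h0⟩).pow (m - j))
          rwa [show 0 * m + 1 * j + 1 * (m - j) = m by omega] at this)
      (by
        simp only [map_sub, map_mul, map_pow, map_natCast] at hθ hθ0 hθm ⊢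
        rw [hθ j hj, hθ0, hθm, mul_pow, mul_pow, ← pow_mul, ← pow_mul, ← pow_mul, ← pow_mul,
          mul_comm j m, mul_comm (m - j) m, sub_self])
    simpa [sub_eq_zero] using h
  · have h := key ((m : MvPolynomial (Fin (2 * d - 1)) (ZMod p)) ^ (m - j) *
      MvPolynomial.X ⟨p ^ k * j, hlt j hj⟩ * MvPolynomial.X ⟨p ^ k * m, hlt m le_rfl⟩ ^ (m - j) -
      (m.choose j : MvPolynomial (Fin (2 * d - 1)) (ZMod p)) *
        MvPolynomial.X ⟨p ^ k * (m - 1), hlt _ (by omega)⟩ ^ (m - j) *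
        MvPolynomial.X ⟨p ^ k * m, hlt m le_rfl⟩) (m - j + 1)
      (by
        refine MvPolynomial.IsHomogeneous.sub ?_ ?_
        · have := (((hc m).pow (m - j)).mul (hX ⟨p ^ k * j, hlt j hj⟩)).mul
            ((hX ⟨p ^ k * m, hlt m le_rfl⟩).pow (m - j))
          rwa [show 0 * (m - j) + 1 + 1 * (m - j) = m - j + 1 by omega] at this
        · have := ((hc (m.choose j)).mul ((hX ⟨p ^ k * (m - 1), hlt _ (by omega)⟩).pow
            (m - j))).mul (hX ⟨p ^ k * m, hlt m le_rfl⟩)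
          rwa [show 0 + 1 * (m - j) + 1 = m - j + 1 by omega] at this)
      (by
        simp only [map_sub, map_mul, map_pow, map_natCast] at hθ hθ1 hθm ⊢
        rw [hθ j hj, hθ1, hθm]
        obtain ⟨l, rfl⟩ : ∃ l, m = j + l := ⟨m - j, by omega⟩
        rw [Nat.add_sub_cancel_left]
        obtain ⟨a, ha⟩ : ∃ a, j + l = a + 1 := ⟨j + l - 1, by omega⟩
        have e : (t ^ (j + l)) ^ l * t ^ j = (t ^ (j + l - 1)) ^ l * t ^ (j + l) := by
          rw [← pow_mul, ← pow_mul, ← pow_add, ← pow_add, ha, Nat.add_sub_cancel]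
          congr 1
          nlinarith
        rw [mul_pow, mul_pow]
        linear_combination (((j + l : ℕ) : MvPolynomial (Fin 2) (ZMod p)) ^ l *
          ((j + l).choose j : MvPolynomial (Fin 2) (ZMod p)) * s ^ l) * e)
    simpa [sub_eq_zero] using h
  · have h := key ((m : MvPolynomial (Fin (2 * d - 1)) (ZMod p)) ^ j *
      MvPolynomial.X ⟨p ^ k * j, hlt j hj⟩ * MvPolynomial.X ⟨0, h0⟩ ^ j -
      (m.choose j : MvPolynomial (Fin (2 * d - 1)) (ZMod p)) *
        MvPolynomial.X ⟨p ^ k * 1, hlt _ (by omega)⟩ ^ j *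
        MvPolynomial.X ⟨0, h0⟩) (j + 1)
      (by
        refine MvPolynomial.IsHomogeneous.sub ?_ ?_
        · have := (((hc m).pow j).mul (hX ⟨p ^ k * j, hlt j hj⟩)).mul
            ((hX ⟨0, h0⟩).pow j)
          rwa [show 0 * j + 1 + 1 * j = j + 1 by omega] at this
        · have := ((hc (m.choose j)).mul ((hX ⟨p ^ k * 1, hlt _ (by omega)⟩).pow
            j)).mul (hX ⟨0, h0⟩)
          rwa [show 0 + 1 * j + 1 = j + 1 by omega] at this)
      (by
        simp only [map_sub, map_mul, map_pow, map_natCast] at hθ hθb hθ0 ⊢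
        rw [hθ j hj, hθb, hθ0]
        obtain ⟨l, rfl⟩ : ∃ l, m = j + l := ⟨m - j, by omega⟩
        rw [Nat.add_sub_cancel_left]
        obtain ⟨a, ha⟩ : ∃ a, j + l = a + 1 := ⟨j + l - 1, by omega⟩
        have e : (s ^ (j + l)) ^ j * s ^ l = (s ^ (j + l - 1)) ^ j * s ^ (j + l) := by
          rw [← pow_mul, ← pow_mul, ← pow_add, ← pow_add, ha, Nat.add_sub_cancel]
          congr 1
          nlinarith
        rw [mul_pow, mul_pow]
        linear_combination (((j + l : ℕ) : MvPolynomial (Fin 2) (ZMod p)) ^ j *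
          ((j + l).choose j : MvPolynomial (Fin 2) (ZMod p)) * t ^ j) * e)
    simpa [sub_eq_zero] using h

/-- By `pow_rel`, a unit coefficient with index qj forces the top coefficient to be a unit if j > 0;
if j = 0 it is itself the bottom one. So the charts s ≠ 0 and t ≠ 0 cover C. -/
lemma ThetaRel.isUnit_or {q : ℕ} {w : ℕ → B} (h : ThetaRel q m w) {n : ℕ} (hn : n ≤ q * m)
    (hw : IsUnit (w n)) : IsUnit (w (q * m)) ∨ IsUnit (w 0) := by
  nontriviality B
  by_cases hdvd : q ∣ n
  · obtain ⟨j, rfl⟩ := hdvd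
    by_cases hq : q = 0
    · subst hq; simp at hw; exact Or.inr hw
    have hj : j ≤ m := Nat.le_of_mul_le_mul_left hn (Nat.pos_of_ne_zero hq)
    have h1 := hw.pow m
    rw [h.pow_rel j hj] at h1
    rcases Nat.eq_zero_or_pos j with rfl | hj0
    · exact Or.inr (by simpa using hw)
    · left
      rw [mul_assoc] at h1
      exact (isUnit_pow_iff (by omega)).mp
        (isUnit_of_mul_isUnit_left (isUnit_of_mul_isUnit_right h1))
  · rw [h.of_not_dvd n hn hdvd] at hw
    exact absurd hw not_isUnit_zero

/-- In c(z^q - S)^m the coefficient of z^{q(m-1)} is -mcS. Dividing by mc recovers S, which is why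
the full power of p has to be split off 2d - 2; `top_rel` then determines all other coefficients. -/
lemma ThetaRel.eq_of_top [Algebra (ZMod p) B] {q : ℕ} (hq : 0 < q) (hm : ¬ p ∣ m) {P : B[X]}
    (hP : P.natDegree ≤ q * m) (h : ThetaRel q m P.coeff) (hu : IsUnit (P.coeff (q * m))) :
    ∃ S : B, P = C (P.coeff (q * m)) * (X ^ q - C S) ^ m := by
  obtain ⟨μ, hμ⟩ := (isUnit_natCast_of_algebra (B := B) hm).mul hu
  let S : B := -(P.coeff (q * (m - 1)) * (↑μ⁻¹ : B))
  refine ⟨S, ?_⟩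
  ext n
  have e := coeff_C_mul_X_pow_sub_C_pow hq (1 : B) S m n
  rw [C_1, one_mul] at e
  rw [coeff_C_mul, e]
  by_cases hn : n ≤ q * m
  · split_ifs with hdvd
    · obtain ⟨j, rfl⟩ := hdvd
      have hj : j ≤ m := Nat.le_of_mul_le_mul_left hn hq
      rw [Nat.mul_div_cancel_left _ hq, one_pow, mul_one, neg_neg, mul_pow]
      have h1 := h.top_rel j hj
      apply (μ.isUnit.pow (m - j)).mul_left_cancel
      have h2 : (μ : B) ^ (m - j) * (↑μ⁻¹ : B) ^ (m - j) = 1 := by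
        rw [← mul_pow, Units.mul_inv, one_pow]
      have h3 : (μ : B) ^ (m - j) * P.coeff (q * j) = (m : B) ^ (m - j) * P.coeff (q * j) * P.coeff (q * m) ^ (m - j) := by
        rw [hμ, mul_pow]; ring
      rw [h3, h1]
      linear_combination (-(m.choose j : B) * P.coeff (q * (m - 1)) ^ (m - j) *
        P.coeff (q * m)) * h2
    · rw [h.of_not_dvd n hn hdvd, mul_zero]
  · rw [coeff_eq_zero_of_natDegree_lt (by omega)]
    split_ifs with hdvd
    · obtain ⟨j, rfl⟩ := hdvd
      have hj : m < j := by
        by_contra hcon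
        exact hn (Nat.mul_le_mul_left q (not_lt.mp hcon))
      rw [Nat.mul_div_cancel_left _ hq, Nat.choose_eq_zero_of_lt hj]
      simp
    · rw [mul_zero]

/-- The mirror image of `eq_of_top`: S is recovered from the coefficients of 1 and z^q, and
`bot_rel` gives the rest. -/
lemma ThetaRel.eq_of_bot [Algebra (ZMod p) B] {q : ℕ} (hq : 0 < q) (hm : ¬ p ∣ m) {P : B[X]}
    (hP : P.natDegree ≤ q * m) (h : ThetaRel q m P.coeff) (hu : IsUnit (P.coeff 0)) :
    ∃ S : B, P.reflect (q * m) = C (P.coeff 0) * (X ^ q - C S) ^ m := by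
  obtain ⟨μ, hμ⟩ := (isUnit_natCast_of_algebra (B := B) hm).mul hu
  let S : B := -(P.coeff q * (↑μ⁻¹ : B))
  refine ⟨S, ?_⟩
  ext n
  have e := coeff_C_mul_X_pow_sub_C_pow hq (1 : B) S m n
  rw [C_1, one_mul] at e
  rw [coeff_C_mul, e, coeff_reflect]
  by_cases hn : n ≤ q * m
  · rw [revAt_le hn]
    split_ifs with hdvd
    · obtain ⟨j, rfl⟩ := hdvd
      have hj : j ≤ m := Nat.le_of_mul_le_mul_left hn hq
      rw [Nat.mul_div_cancel_left _ hq, one_pow, mul_one, neg_neg, mul_pow, ← Nat.mul_sub]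
      have h1 := h.bot_rel (m - j) (Nat.sub_le _ _)
      rw [Nat.choose_symm hj] at h1
      apply (μ.isUnit.pow (m - j)).mul_left_cancel
      have h2 : (μ : B) ^ (m - j) * (↑μ⁻¹ : B) ^ (m - j) = 1 := by
        rw [← mul_pow, Units.mul_inv, one_pow]
      have h3 : (μ : B) ^ (m - j) * P.coeff (q * (m - j)) =
          (m : B) ^ (m - j) * P.coeff (q * (m - j)) * P.coeff 0 ^ (m - j) := by
        rw [hμ, mul_pow]; ring
      rw [h3, h1]
      linear_combination (-(m.choose j : B) * P.coeff q ^ (m - j) * P.coeff 0) * h2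
    · have hdvd' : ¬ q ∣ q * m - n := fun h' ↦ hdvd ((Nat.dvd_sub_iff_right hn (Dvd.intro _ rfl)).mp h')
      rw [h.of_not_dvd _ (Nat.sub_le _ _) hdvd', mul_zero]
  · rw [revAt_eq_self_of_lt (by omega), coeff_eq_zero_of_natDegree_lt (by omega)]
    split_ifs with hdvd
    · obtain ⟨j, rfl⟩ := hdvd
      have hj : m < j := by
        by_contra hcon
        exact hn (Nat.mul_le_mul_left q (not_lt.mp hcon))
      rw [Nat.mul_div_cancel_left _ hq, Nat.choose_eq_zero_of_lt hj]
      simp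
    · rw [mul_zero]

/-- This replaces the fibre product by explicit polynomials. Local rings suffice for the sequel,
since reducedness and irreducibility are tested on stalks and birationality at generic points. -/
theorem exists_isRat_of_point [IsLocalRing B] [Algebra (ZMod p) B] (hd : 1 < d)
    (hqm : p ^ k * m = 2 * d - 2) (hm : ¬ p ∣ m)
    (x : Spec (.of B) ⟶ unicriticalLocus p d hd) :
    ∃ (f g : B[X]) (h : IsRat d f g),
      x ≫ unicriticalLocus.toProjSpace p d hd = h.pt p hd ∧
      (IsUnit ((critPoly f g).coeff (2 * d - 2)) ∨ IsUnit ((critPoly f g).coeff 0)) ∧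
      (IsUnit ((critPoly f g).coeff (2 * d - 2)) → IsUnicrit d (p ^ k) m f g) ∧
      (IsUnit ((critPoly f g).coeff 0) → IsUnicrit d (p ^ k) m (f.reflect d) (g.reflect d)) := by
  obtain ⟨i, v, hv, hx⟩ := exists_eq_pt (R := ZMod p) (B := B)
    (x ≫ unicriticalLocus.toProjSpace p d hd)
  obtain ⟨f, g, hf, hg, rfl⟩ := exists_coeffVec (d := d) v
  let x₁ : Spec (.of B) ⟶ (sepLocus p d).toScheme := x ≫ pullback.fst (omega p d hd) (curveι p d hd)
  have hx₁ : x₁ ≫ (sepLocus p d).ι = pt (MvPolynomial.X i) (X_mem i) one_pos (coeffVec d f g)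
      (isUnit_aeval_X (R := ZMod p) (hv ▸ isUnit_one)) := (Category.assoc _ _ _).trans hx
  let c : Spec (.of B) := IsLocalRing.closedPoint B
  have hmem : pt (MvPolynomial.X i) (X_mem i) one_pos (coeffVec d f g)
      (isUnit_aeval_X (R := ZMod p) (hv ▸ isUnit_one)) c ∈
      sepLocus p d := by
    rw [← hx₁]
    exact (x₁ c).2
  -- Over a local ring a form takes a unit value as soon as it does not vanish at the closed point.
  have hunit : ∀ (F : MvPolynomial (CoeffIdx d) (ZMod p)) (n : ℕ) (hn : 0 < n)
      (hF : F ∈ grading (ZMod p) (CoeffIdx d) n),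
      pt (MvPolynomial.X i) (X_mem i) one_pos (coeffVec d f g)
        (isUnit_aeval_X (R := ZMod p) (hv ▸ isUnit_one)) c ∈
        Proj.basicOpen (grading (ZMod p) (CoeffIdx d)) F →
      IsUnit (MvPolynomial.aeval (coeffVec d f g) F) := by
    intro F n hn hF h
    by_contra h'
    exact (pt_mem_basicOpen (X_mem i) one_pos _ _ hF hn c).mp h ((IsLocalRing.mem_maximalIdeal _).mpr h')
  have hR : IsRat d f g := ⟨hf, hg, by
    rw [← aeval_genRes (R := ZMod p) d hf hg]
    exact hunit _ (2 * d) (by omega) (genRes_mem d _) hmem.1⟩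
  obtain ⟨n, hn⟩ := TopologicalSpace.Opens.mem_iSup.mp (sepLocus_le p d hd hmem)
  have hn' := hunit _ 2 two_pos (critForm_isHomogeneous (ZMod p) d n) hn
  have hω := pt_comp_omega p d hd (X_mem i) one_pos (coeffVec d f g) _ x₁ hx₁ n hn'
  let y : Spec (.of B) ⟶ (theta (ZMod p) d hd).image := x ≫ pullback.snd (omega p d hd) (curveι p d hd)
  have hy : y ≫ curveι p d hd = x₁ ≫ omega p d hd :=
    (Category.assoc _ _ _).trans ((congrArg (x ≫ ·) pullback.condition.symm).trans
      (Category.assoc _ _ _).symm)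
  have hcoef : (fun j ↦ MvPolynomial.aeval (coeffVec d f g) (critForm (ZMod p) d j)) =
      fun j : Fin (2 * d - 1) ↦ (critPoly f g).coeff j := by
    ext j; exact aeval_critForm d hf hg j
  have hnu : IsUnit ((critPoly f g).coeff n) := by
    rwa [← aeval_critForm (R := ZMod p) d hf hg]
  have hrel : ThetaRel (p ^ k) m (critPoly f g).coeff := by
    refine thetaRel_of_image hd hqm y n (critPoly f g).coeff hnu ?_
    rw [hy, hω]
    have aux : ∀ (v w : Fin (2 * d - 1) → B) (hv : v = w) (hu : IsUnit (MvPolynomial.aeval v (MvPolynomial.X n :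
            MvPolynomial (Fin (2 * d - 1)) (ZMod p)))),
      pt (MvPolynomial.X n) (X_mem n) one_pos v hu = pt (MvPolynomial.X n) (X_mem n) one_pos w
        (hv ▸ hu) := by
      rintro v w rfl hu; rfl
    exact aux _ _ hcoef _
  have hq : 0 < p ^ k := pow_pos (Fact.out : p.Prime).pos k
  have hdeg := natDegree_critPoly_le (by omega : 0 < d) hf hg
  rw [← hqm] at hdeg ⊢
  refine ⟨f, g, hR, ?_, hrel.isUnit_or (by have := n.2; omega) hnu, fun hu ↦ ?_, fun hu ↦ ?_⟩
  · rw [hx]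
    exact pt_eq_pt _ _ _ _ _ _ _
  · obtain ⟨S, hS⟩ := hrel.eq_of_top hq hm hdeg hu
    exact ⟨hR, _, S, hu, hS⟩
  · obtain ⟨S, hS⟩ := hrel.eq_of_bot hq hm hdeg hu
    refine ⟨hR.reflect, -(critPoly f g).coeff 0, S, hu.neg, ?_⟩
    rw [critPoly_reflect (by omega) hf hg, ← hqm, hS, C_neg, neg_mul]

end LocalPoints

end Unicritical
end

noncomputable section

namespace Unicritical

/-! ### The differential equation satisfied by f and g -/

section PolynomialAlgebra

open Polynomial

variable {B : Type} [CommRing B]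

lemma critPoly_add_C_mul (f g : B[X]) (b : B) :
    critPoly (f + C b * g) g = critPoly f g := by
  simp only [critPoly, derivative_add, derivative_mul, derivative_C]
  ring

lemma IsRat.isCoprime {d : ℕ} (hd : d ≠ 0) {f g : B[X]} (h : IsRat d f g) : IsCoprime f g := by
  obtain ⟨u, v, -, -, e⟩ := exists_mul_add_mul_eq_C_resultant f g h.1 h.2 (.inl hd)
  obtain ⟨r, hr⟩ := h.3
  refine ⟨C (↑r⁻¹ : B) * u, C (↑r⁻¹ : B) * v, ?_⟩
  rw [mul_assoc, mul_assoc, ← mul_add, mul_comm u, mul_comm v, e, ← hr, ← C_mul, Units.inv_mul,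
    C_1]

lemma IsRat.add_C_mul {d : ℕ} {f g : B[X]} (h : IsRat d f g) (b : B) :
    IsRat d (f + C b * g) g := by
  refine ⟨natDegree_add_le_of_degree_le h.1 ((natDegree_C_mul_le _ _).trans h.2), h.2, ?_⟩
  rw [mul_comm, resultant_add_mul_left _ _ _ _ _ (by simp) h.2]
  exact h.3

lemma IsRat.C_mul {d : ℕ} {f g : B[X]} (h : IsRat d f g) {c : B} (hc : IsUnit c) :
    IsRat d (C c * f) (C c * g) := by
  refine ⟨(natDegree_C_mul_le _ _).trans h.1, (natDegree_C_mul_le _ _).trans h.2, ?_⟩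
  rw [resultant_C_mul_left, resultant_C_mul_right]
  exact (hc.pow _).mul ((hc.pow _).mul h.3)

/-- If both top coefficients died in the residue field, f and g would have a common zero at infinity
and the degree-(d, d) resultant would vanish there. -/
lemma IsRat.isUnit_coeff_or [IsLocalRing B] {d : ℕ} (hd : d ≠ 0) {f g : B[X]} (h : IsRat d f g) :
    IsUnit (f.coeff d) ∨ IsUnit (g.coeff d) := by
  by_contra! hcon
  have h1 := (h.map (IsLocalRing.residue B))
  have key : ∀ F : B[X], F.natDegree ≤ d → ¬ IsUnit (F.coeff d) →
      (F.map (IsLocalRing.residue B)).natDegree < d := by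
    intro F hF hu
    refine lt_of_le_of_ne (natDegree_map_le.trans hF) fun he ↦ ?_
    have h2 : (F.map (IsLocalRing.residue B)).coeff d = 0 := by
      rw [coeff_map, IsLocalRing.residue_eq_zero_iff]
      exact hu
    have h3 : (F.map (IsLocalRing.residue B)).leadingCoeff = 0 := by rw [leadingCoeff, he, h2]
    rw [leadingCoeff_eq_zero.mp h3, natDegree_zero] at he
    exact hd he.symm
  have h2 := h1.3
  rw [resultant_eq_zero_of_lt_lt _ _ _ _ (key f h.1 hcon.1) (key g h.2 hcon.2)] at h2
  exact not_isUnit_zero h2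

/-- Over a local ring, some `f + β g` with `β ∈ {0, 1}` has unit leading coefficient. -/
lemma IsRat.exists_isUnit_coeff [IsLocalRing B] {d : ℕ} (hd : d ≠ 0) {f g : B[X]}
    (h : IsRat d f g) : ∃ b : B, (b = 0 ∨ b = 1) ∧ IsUnit ((f + C b * g).coeff d) := by
  by_cases hf : IsUnit (f.coeff d)
  · exact ⟨0, Or.inl rfl, by simpa using hf⟩
  · have hg := (h.isUnit_coeff_or hd).resolve_left hf
    refine ⟨1, Or.inr rfl, ?_⟩
    by_contra hcon
    apply (IsLocalRing.mem_maximalIdeal _).mp ?_ hg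
    have h1 := sub_mem ((IsLocalRing.mem_maximalIdeal _).mpr hcon)
      ((IsLocalRing.mem_maximalIdeal _).mpr hf)
    simpa using h1

lemma eq_zero_of_mul_eq_zero_of_isUnit_coeff {f h : B[X]} {n : ℕ} (hf : f.natDegree ≤ n)
    (hu : IsUnit (f.coeff n)) (h0 : f * h = 0) : h = 0 := by
  obtain ⟨u, hu⟩ := hu
  have hm : (C (↑u⁻¹ : B) * f).Monic := by
    refine monic_of_natDegree_le_of_coeff_eq_one n ((natDegree_C_mul_le _ _).trans hf) ?_
    rw [coeff_C_mul, ← hu, Units.inv_mul]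
  refine hm.isRegular.left ?_
  simp only [mul_assoc, h0, mul_zero]

lemma eq_zero_of_dvd_of_isUnit_coeff {f h : B[X]} {n : ℕ} (hf : f.natDegree ≤ n)
    (hu : IsUnit (f.coeff n)) (hdvd : f ∣ h) (hh : h.degree < n) : h = 0 := by
  nontriviality B
  obtain ⟨u, hu⟩ := hu
  have hm : (C (↑u⁻¹ : B) * f).Monic := by
    refine monic_of_natDegree_le_of_coeff_eq_one n ((natDegree_C_mul_le _ _).trans hf) ?_
    rw [coeff_C_mul, ← hu, Units.inv_mul]
  have hd : C (↑u⁻¹ : B) * f ∣ h := by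
    obtain ⟨k, rfl⟩ := hdvd
    refine ⟨C (u : B) * k, ?_⟩
    have : (C (↑u⁻¹ : B) : B[X]) * C (u : B) = 1 := by rw [← C_mul, Units.inv_mul, C_1]
    linear_combination (-f * k) * this
  by_contra h0
  refine hm.not_dvd_of_degree_lt h0 (lt_of_lt_of_le hh ?_) hd
  refine le_degree_of_ne_zero ?_
  rw [coeff_C_mul, ← hu, Units.inv_mul]
  exact one_ne_zero

/-- If `(z - s) W' = k W` for `W = f' g - f g'`, then `f` and `g` are both annihilated by the
operator `(z - s) D² - k D`. -/
lemma IsRat.annihilated [IsLocalRing B] {d : ℕ} (hd : d ≠ 0) {f g : B[X]} (h : IsRat d f g)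
    (s k : B) (hW : (X - C s) * derivative (critPoly f g) = C k * critPoly f g) :
    (X - C s) * derivative (derivative f) - C k * derivative f = 0 ∧
      (X - C s) * derivative (derivative g) - C k * derivative g = 0 := by
  -- Adding a multiple of g to f changes neither W nor the claim, and it provides a unit leading
  -- coefficient to divide by.
  obtain ⟨b, -, hb⟩ := h.exists_isUnit_coeff hd
  have h' := h.add_C_mul b
  rw [← critPoly_add_C_mul f g b] at hW
  let L : B[X] → B[X] := fun F ↦ (X - C s) * derivative (derivative F) - C k * derivative F
  have hadd : L (f + C b * g) = L f + C b * L g := by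
    simp only [L, derivative_add, derivative_mul, derivative_C, zero_mul, zero_add]
    ring
  generalize hF : f + C b * g = F at *
  -- The first-order terms cancel in W' = F''g - Fg'', so the hypothesis on W is exactly this
  -- symmetry of L.
  have e : L F * g = F * L g := by
    have : (X - C s) * derivative (critPoly F g) =
        (X - C s) * (derivative (derivative F) * g - F * derivative (derivative g)) := by
      simp only [critPoly, derivative_sub, derivative_mul]
      ring
    rw [this, critPoly] at hW
    linear_combination hW
  have hdvd : F ∣ L F := (h'.isCoprime hd).dvd_of_dvd_mul_right (Dvd.intro _ e.symm)
  -- L lowers degrees by at least one, so a multiple LF of F must be zero.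
  have hdeg : (L F).degree < d := by
    rw [degree_lt_iff_coeff_zero]
    intro n hn
    obtain ⟨j, rfl⟩ : ∃ j, n = j + 1 := ⟨n - 1, by omega⟩
    have h0 : ∀ i, j + 2 ≤ i → F.coeff i = 0 := fun i hi ↦
      coeff_eq_zero_of_natDegree_lt (lt_of_le_of_lt h'.1 (by omega))
    simp only [L, coeff_sub, sub_mul, coeff_X_mul, coeff_C_mul, coeff_derivative]
    rw [h0 _ le_rfl, h0 _ (by omega)]
    simp
  have hLF := eq_zero_of_dvd_of_isUnit_coeff h'.1 hb hdvd hdeg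
  have hLg : L g = 0 := by
    have h0 : F * L g = 0 := by rw [← e, hLF, zero_mul]
    exact eq_zero_of_mul_eq_zero_of_isUnit_coeff h'.1 hb h0
  refine ⟨?_, hLg⟩
  have := hadd
  rw [hLF, hLg, mul_zero, add_zero] at this
  exact this.symm

end PolynomialAlgebra

end Unicritical
end

noncomputable section

namespace Unicritical

/-! ### Resultants at the geometric closed point and polynomials in z^p -/

section Decomposition

open Polynomial

variable {B : Type} [CommRing B]

/-- The degree-(n, n) resultant detects common zeros on ℙ¹; the condition on leading coefficients
excludes the one at infinity. If f has exact degree n, it differs from the ordinary resultant by a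
power of the leading coefficient. -/
lemma resultant_ne_zero_of_no_common_root {K : Type} [Field K] [IsAlgClosed K] {n : ℕ}
    {f g : K[X]} (hf : f.natDegree ≤ n) (hg : g.natDegree ≤ n)
    (hlead : f.coeff n ≠ 0 ∨ g.coeff n ≠ 0) (hroot : ∀ z, f.eval z = 0 → g.eval z ≠ 0) :
    resultant f g n n ≠ 0 := by
  have key : ∀ F G : K[X], F.natDegree ≤ n → G.natDegree ≤ n → IsCoprime F G → F.coeff n ≠ 0 →
      resultant F G n n ≠ 0 := by
    intro F G hF hG hFG hc
    have h1 : F.natDegree = n := le_antisymm hF (le_natDegree_of_ne_zero hc)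
    obtain ⟨j, hj⟩ : ∃ j, n = G.natDegree + j := ⟨n - G.natDegree, by omega⟩
    have h2 := resultant_add_right_deg F G n G.natDegree j le_rfl
    rw [← hj] at h2
    rw [h2]
    refine mul_ne_zero (pow_ne_zero _ hc) ?_
    have h3 := resultant_ne_zero F G hFG
    rwa [h1] at h3
  have hco : IsCoprime f g := by
    rw [isCoprime_iff_aeval_ne_zero_of_isAlgClosed K K]
    intro a
    simp only [coe_aeval_eq_eval]
    by_cases h : f.eval a = 0
    · exact Or.inr (hroot a h)
    · exact Or.inl h
  rcases hlead with h | h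
  · exact key f g hf hg hco h
  · rw [resultant_comm]
    exact mul_ne_zero (pow_ne_zero _ (by simp)) (key g f hg hf hco.symm h)

/-- The geometric closed point of a local ring. -/
def geomResidue (B : Type) [CommRing B] [IsLocalRing B] :
    B →+* AlgebraicClosure (IsLocalRing.ResidueField B) :=
  (algebraMap _ _).comp (IsLocalRing.residue B)

lemma geomResidue_eq_zero_iff [IsLocalRing B] (x : B) : geomResidue B x = 0 ↔ ¬ IsUnit x := by
  rw [geomResidue, RingHom.comp_apply, map_eq_zero, IsLocalRing.residue_eq_zero_iff]
  rfl

lemma isUnit_resultant_of_no_common_root [IsLocalRing B] {n : ℕ} {f g : B[X]}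
    (hf : f.natDegree ≤ n) (hg : g.natDegree ≤ n)
    (hlead : IsUnit (f.coeff n) ∨ IsUnit (g.coeff n))
    (hroot : ∀ z, f.eval₂ (geomResidue B) z = 0 → g.eval₂ (geomResidue B) z ≠ 0) :
    IsUnit (resultant f g n n) := by
  by_contra hcon
  rw [← geomResidue_eq_zero_iff, ← resultant_map_map] at hcon
  refine resultant_ne_zero_of_no_common_root (natDegree_map_le.trans hf) (natDegree_map_le.trans hg)
    ?_ (fun z ↦ ?_) hcon
  · simp only [coeff_map, Ne, geomResidue_eq_zero_iff, not_not]
    exact hlead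
  · have := hroot z
    rwa [← Polynomial.eval_map, ← Polynomial.eval_map] at this

lemma IsRat.no_common_root [IsLocalRing B] {d : ℕ} (hd : d ≠ 0) {f g : B[X]} (h : IsRat d f g)
    (z : AlgebraicClosure (IsLocalRing.ResidueField B)) (hf : f.eval₂ (geomResidue B) z = 0) :
    g.eval₂ (geomResidue B) z ≠ 0 := by
  intro hg
  obtain ⟨u, v, huv⟩ := h.isCoprime hd
  have := congrArg (eval₂ (geomResidue B) z) huv
  simp [eval₂_mul, hf, hg] at this

variable {p : ℕ} [Fact p.Prime]

lemma exists_expand_add {r : ℕ} (hr0 : 0 < r) (hr : r < p) (f : B[X])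
    (hf : ∀ n, f.coeff n ≠ 0 → n % p = 0 ∨ n % p = r) :
    ∃ f₀ f₁ : B[X], f = expand B p f₀ + X ^ r * expand B p f₁ ∧
      (∀ n, f₀.coeff n = f.coeff (p * n)) ∧ ∀ n, f₁.coeff n = f.coeff (p * n + r) := by
  have hp : 0 < p := (Fact.out : p.Prime).pos
  have mk : ∀ s, ∃ h : B[X], ∀ n, h.coeff n = f.coeff (p * n + s) := fun s ↦ by
    refine ⟨∑ n ∈ Finset.range (f.natDegree + 1), C (f.coeff (p * n + s)) * X ^ n, fun n ↦ ?_⟩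
    simp only [finsetSum_coeff, coeff_C_mul_X_pow, Finset.sum_ite_eq, Finset.mem_range]
    split_ifs with h
    · rfl
    · rw [coeff_eq_zero_of_natDegree_lt]
      nlinarith
  obtain ⟨f₀, h₀⟩ := mk 0
  obtain ⟨f₁, h₁⟩ := mk r
  refine ⟨f₀, f₁, ?_, h₀, h₁⟩
  ext n
  rw [coeff_add, coeff_expand hp, coeff_X_pow_mul', coeff_expand hp]
  have hdm := Nat.div_add_mod n p
  by_cases h0 : p ∣ n
  · obtain ⟨j, rfl⟩ := h0
    rw [if_pos (Dvd.intro _ rfl), Nat.mul_div_cancel_left _ hp, h₀]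
    have : (if r ≤ p * j then if p ∣ p * j - r then f₁.coeff ((p * j - r) / p) else 0 else 0) = 0 := by
      split_ifs with h2 h3
      · have := (Nat.dvd_sub_iff_right h2 (Dvd.intro _ rfl)).mp h3
        exact absurd (Nat.le_of_dvd hr0 this) (by omega)
      · rfl
      · rfl
    rw [this, add_zero, add_zero]
  · rw [if_neg h0, zero_add]
    by_cases hn : n % p = r
    · have h2 : n - r = p * (n / p) := by omega
      rw [if_pos (by omega), h2, if_pos (Dvd.intro _ rfl), Nat.mul_div_cancel_left _ hp, h₁, ← h2]
      congr 1
      omega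
    · by_contra hcon
      have h3 : f.coeff n = 0 := by
        by_contra h4
        rcases hf n h4 with h5 | h5
        · exact h0 (Nat.dvd_of_mod_eq_zero h5)
        · exact hn h5
      apply hcon
      rw [h3]
      split_ifs with h5 h6
      · exfalso
        obtain ⟨j, hj⟩ := h6
        apply hn
        have : n = r + p * j := by omega
        rw [this, Nat.add_mul_mod_self_left, Nat.mod_eq_of_lt hr]
      · rfl
      · rfl

variable [Algebra (ZMod p) B]

lemma natCast_eq_zero_of_algebra {n : ℕ} (hn : p ∣ n) : (n : B) = 0 := by
  have h : ((n : ℕ) : ZMod p) = 0 := (ZMod.natCast_eq_zero_iff n p).mpr hn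
  have := congrArg (algebraMap (ZMod p) B) h
  rwa [map_natCast, map_zero] at this

lemma derivative_expand_of_algebra (A : B[X]) : derivative (expand B p A) = 0 := by
  have : (p : B[X]) = C (p : B) := (C_eq_natCast p).symm
  rw [derivative_expand, this, natCast_eq_zero_of_algebra (dvd_refl p)]
  simp

/-- Polynomials in z^p have zero derivative, so W is an alternating bilinear form over the ring they
form, and a change of coordinates multiplies it by the determinant. -/
lemma critPoly_expand (A B₁ A₂ B₂ u v : B[X]) :
    critPoly (expand B p A * u + expand B p B₁ * v) (expand B p A₂ * u + expand B p B₂ * v) =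
      expand B p (A * B₂ - B₁ * A₂) * critPoly u v := by
  simp only [critPoly, derivative_add, derivative_mul, derivative_expand_of_algebra, map_sub,
    map_mul, zero_mul, zero_add]
  ring

/-- Among `A₁ + α A₀` with `α ∈ {0, 1}` one of the two choices gives a pair with unit resultant,
when `A₁ B₀ - A₀ B₁` has only one geometric root modulo the maximal ideal. -/
lemma exists_isUnit_resultant_shift [IsLocalRing B] {e a m : ℕ} {P₀ P₁ Q₀ Q₁ : B[X]}
    (hP₀ : P₀.natDegree ≤ e) (hP₁ : P₁.natDegree ≤ e) (hQ₀ : Q₀.natDegree ≤ e)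
    (hQ₁ : Q₁.natDegree ≤ e) (c S : B) (hc : IsUnit c)
    (hdet : P₁ * Q₀ - P₀ * Q₁ = C c * (X ^ p ^ a - C S) ^ m)
    (hlead : ∀ α : B, IsUnit ((P₁ + C α * P₀).coeff e) ∨ IsUnit ((Q₁ + C α * Q₀).coeff e))
    (hroot : ∀ z, P₀.eval₂ (geomResidue B) z = 0 → P₁.eval₂ (geomResidue B) z = 0 →
      Q₀.eval₂ (geomResidue B) z = 0 → Q₁.eval₂ (geomResidue B) z ≠ 0) :
    ∃ α : B, (α = 0 ∨ α = 1) ∧ IsUnit (resultant (P₁ + C α * P₀) (Q₁ + C α * Q₀) e e) := by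
  by_contra! hcon
  have key : ∀ α : B, (α = 0 ∨ α = 1) → ∃ z, (P₁ + C α * P₀).eval₂ (geomResidue B) z = 0 ∧
      (Q₁ + C α * Q₀).eval₂ (geomResidue B) z = 0 ∧ z ^ p ^ a = geomResidue B S := by
    intro α hα
    have h1 := hcon α hα
    have hd1 : (P₁ + C α * P₀).natDegree ≤ e :=
      natDegree_add_le_of_degree_le hP₁ ((natDegree_C_mul_le _ _).trans hP₀)
    have hd2 : (Q₁ + C α * Q₀).natDegree ≤ e :=
      natDegree_add_le_of_degree_le hQ₁ ((natDegree_C_mul_le _ _).trans hQ₀)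
    by_contra! h2
    refine h1 (isUnit_resultant_of_no_common_root hd1 hd2 (hlead α) fun z hz hz' ↦ ?_)
    refine h2 z hz hz' ?_
    -- The shift leaves the determinant unchanged, so a common root of the shifted pair is a root of
    -- z^{p^a} - S.
    have h3 : (P₁ + C α * P₀) * Q₀ - P₀ * (Q₁ + C α * Q₀) = C c * (X ^ p ^ a - C S) ^ m := by
      rw [← hdet]; ring
    have h4 := congrArg (eval₂ (geomResidue B) z) h3
    simp only [eval₂_sub, eval₂_mul, hz, hz', zero_mul, mul_zero, sub_zero, eval₂_C, eval₂_pow,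
      eval₂_X] at h4
    rcases mul_eq_zero.mp h4.symm with h5 | h5
    · rw [geomResidue_eq_zero_iff] at h5
      exact absurd hc h5
    · exact sub_eq_zero.mp (eq_zero_of_pow_eq_zero h5)
  obtain ⟨z, hz1, hz2, hz3⟩ := key 0 (Or.inl rfl)
  obtain ⟨z', hz1', hz2', hz3'⟩ := key 1 (Or.inr rfl)
  -- Frobenius is injective on the residue closure, so both shifts fail at the same root;
  -- subtracting, all four polynomials vanish there, against `hroot`.
  have hzz : z = z' := by
    let _ : Algebra (ZMod p) (AlgebraicClosure (IsLocalRing.ResidueField B)) :=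
      ((geomResidue B).comp (algebraMap (ZMod p) B)).toAlgebra
    have := sub_pow_pow_of_algebra (p := p) a z z'
    rw [hz3, hz3', sub_self] at this
    exact sub_eq_zero.mp (eq_zero_of_pow_eq_zero this)
  subst hzz
  simp only [C_0, C_1, zero_mul, one_mul, add_zero, eval₂_add] at hz1 hz2 hz1' hz2'
  rw [hz1, zero_add] at hz1'
  rw [hz2, zero_add] at hz2'
  exact hroot z hz1' hz1 hz2' hz2

/-- Data writing a pair as `f = A(z^p) u + B(z^p) v`, `g = A₂(z^p) u + B₂(z^p) v` with
`A B₂ - B A₂ = c τ` and `A, A₂` coprime. -/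
structure IsDecomp (p e b : ℕ) (u v τ f g : B[X]) (c : B) (A B₁ A₂ B₂ : B[X]) : Prop where
  A_le : A.natDegree ≤ e
  B₁_le : B₁.natDegree ≤ b
  A₂_le : A₂.natDegree ≤ e
  B₂_le : B₂.natDegree ≤ b
  left_eq : f = expand B p A * u + expand B p B₁ * v
  right_eq : g = expand B p A₂ * u + expand B p B₂ * v
  isUnit_resultant : IsUnit (resultant A A₂ e e)
  det_eq : A * B₂ - B₁ * A₂ = C c * τ

/-- When p ∣ q, W is a polynomial in z^p, so W' = 0. The operator of `IsRat.annihilated` with s = k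
= 0 is then zD², and z can be cancelled. -/
lemma IsUnicrit.derivative_derivative [IsLocalRing B] {d k m : ℕ} (hd : d ≠ 0) {f g : B[X]}
    (h : IsUnicrit d (p ^ (k + 1)) m f g) :
    derivative (derivative f) = 0 ∧ derivative (derivative g) = 0 := by
  obtain ⟨c, S, hc, hS⟩ := h.exists_eq
  have hW : derivative (critPoly f g) = 0 := by
    have : (C c * (X ^ p ^ (k + 1) - C S) ^ m : B[X]) =
        expand B p (C c * (X ^ p ^ k - C S) ^ m) := by
      simp [← pow_mul, pow_succ']
    rw [hS, this, derivative_expand_of_algebra]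
  have := h.toIsRat.annihilated hd 0 0 (by rw [hW]; simp)
  simp only [C_0, sub_zero, zero_mul] at this
  have hX : ∀ F : B[X], X * F = 0 → F = 0 := fun F hF ↦ by
    ext n
    have := congrArg (fun G ↦ G.coeff (n + 1)) hF
    simpa using this
  exact ⟨hX _ this.1, hX _ this.2⟩

/-- The coefficients satisfy n(n - 1)a_n = 0, and n(n - 1) is a unit unless n ≡ 0 or 1 modulo p. -/
lemma mod_of_derivative_derivative {f : B[X]} (hf : derivative (derivative f) = 0) (n : ℕ)
    (hn : f.coeff n ≠ 0) : n % p = 0 ∨ n % p = 1 := by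
  by_contra! hcon
  have hp := (Fact.out : p.Prime)
  obtain ⟨j, rfl⟩ : ∃ j, n = j + 2 := ⟨n - 2, by
    rcases n with _ | _ | n
    · simp at hcon
    · rw [zero_add, Nat.mod_eq_of_lt hp.one_lt] at hcon
      exact absurd rfl hcon.2
    · omega⟩
  have h1 := congrArg (fun G ↦ G.coeff j) hf
  simp only [coeff_derivative, coeff_zero] at h1
  have h2 : IsUnit (((j + 2) * (j + 1) : ℕ) : B) := by
    refine isUnit_natCast_of_algebra (p := p) fun hdvd ↦ ?_
    rcases hp.dvd_mul.mp hdvd with h | h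
    · exact hcon.1 (Nat.mod_eq_zero_of_dvd h)
    · apply hcon.2
      obtain ⟨i, hi⟩ := h
      rw [show j + 2 = 1 + p * i by omega, Nat.add_mul_mod_self_left, Nat.mod_eq_of_lt hp.one_lt]
  apply hn
  rw [← h2.mul_left_eq_zero, ← h1]
  push_cast
  ring

end Decomposition

end Unicritical
end

noncomputable section

namespace Unicritical

/-! ### Decompositions in the three cases and the nonexistence result -/

section Decomposition

open Polynomial

variable {B : Type} [CommRing B]

lemma natDegree_le_of_coeff_eq {f h : B[X]} {n r e : ℕ} {q : ℕ} (hf : f.natDegree ≤ n)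
    (hh : ∀ i, h.coeff i = f.coeff (q * i + r)) (hn : ∀ i, e < i → n < q * i + r) :
    h.natDegree ≤ e := by
  rw [natDegree_le_iff_coeff_eq_zero]
  intro i hi
  rw [hh, coeff_eq_zero_of_natDegree_lt (lt_of_le_of_lt hf (hn i hi))]

lemma eval₂_expand {A : Type} [CommRing A] (φ : B →+* A) (n : ℕ) (F : B[X]) (y : A) :
    (expand B n F).eval₂ φ y = F.eval₂ φ (y ^ n) := by
  rw [expand_eq_comp_X_pow, eval₂_comp, eval₂_X_pow]

lemma expand_X_pow_sub_pow (p : ℕ) (c S : B) (k m : ℕ) :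
    expand B p (C c * (X ^ p ^ k - C S) ^ m) = C c * (X ^ p ^ (k + 1) - C S) ^ m := by
  simp [← pow_mul, pow_succ']

lemma coeff_top_C_mul_X_pow_sub_pow (c S : B) (q m : ℕ) (hq : 0 < q) :
    (C c * (X ^ q - C S) ^ m).coeff (q * m) = c := by
  have := coeff_C_mul_X_pow_sub_C_pow hq (1 : B) S m (q * m)
  rw [C_1, one_mul, if_pos (Dvd.intro _ rfl), Nat.mul_div_cancel_left _ hq] at this
  rw [coeff_C_mul, this]
  simp

variable {p : ℕ} [Fact p.Prime] [Algebra (ZMod p) B] {d e k m : ℕ}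

/-- Here f = f₀(z^p) + z f₁(z^p) = (f₁ + αf₀)(z^p) · z + f₀(z^p)(1 - αz). The shift α is chosen by
`exists_isUnit_resultant_shift`; a common root z of f₀, f₁, g₀, g₁ would make a p-th root of z a
common root of f and g. -/
theorem IsUnicrit.exists_isDecomp_of_dvd_sub_one [IsLocalRing B] (hd : d = p * e + 1)
    (hqm : p ^ (k + 1) * m = 2 * d - 2) {f g : B[X]} (h : IsUnicrit d (p ^ (k + 1)) m f g) :
    ∃ (S α c : B) (A B₁ A₂ B₂ : B[X]), (α = 0 ∨ α = 1) ∧ IsUnit c ∧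
      IsDecomp p e e X (1 - C α * X) ((X ^ p ^ k - C S) ^ m) f g c A B₁ A₂ B₂ := by
  have hp := (Fact.out : p.Prime)
  have hp1 := hp.one_lt
  have hdd : d ≠ 0 := by omega
  obtain ⟨c, S, hc, hS⟩ := h.exists_eq
  obtain ⟨hf2, hg2⟩ := h.derivative_derivative hdd
  obtain ⟨f₀, f₁, hf, hf0, hf1⟩ := exists_expand_add (p := p) one_pos hp1 f
    (mod_of_derivative_derivative hf2)
  obtain ⟨g₀, g₁, hg, hg0, hg1⟩ := exists_expand_add (p := p) one_pos hp1 g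
    (mod_of_derivative_derivative hg2)
  have hlt : ∀ i, e < i → p * e + p ≤ p * i := fun i hi ↦ by nlinarith
  have df0 : f₀.natDegree ≤ e := natDegree_le_of_coeff_eq (r := 0) h.1.1 hf0 fun i hi ↦ by
    have := hlt i hi; omega
  have df1 : f₁.natDegree ≤ e := natDegree_le_of_coeff_eq h.1.1 hf1 fun i hi ↦ by
    have := hlt i hi; omega
  have dg0 : g₀.natDegree ≤ e := natDegree_le_of_coeff_eq (r := 0) h.1.2 hg0 fun i hi ↦ by
    have := hlt i hi; omega
  have dg1 : g₁.natDegree ≤ e := natDegree_le_of_coeff_eq h.1.2 hg1 fun i hi ↦ by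
    have := hlt i hi; omega
  have hdet : f₁ * g₀ - f₀ * g₁ = C c * (X ^ p ^ k - C S) ^ m := by
    apply expand_injective hp.pos
    rw [expand_X_pow_sub_pow, ← hS]
    have e1 := critPoly_expand (p := p) f₁ f₀ g₁ g₀ (X : B[X]) 1
    have e2 : critPoly (X : B[X]) 1 = 1 := by simp [critPoly]
    rw [e2, mul_one, mul_one, mul_one] at e1
    rw [← e1, hf, hg]
    congr 1 <;> ring
  have hpk : p ^ k * m = e + e := by
    apply Nat.eq_of_mul_eq_mul_left hp.pos
    rw [← mul_assoc, ← pow_succ', hqm, hd, mul_add, Nat.mul_add]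
    omega
  -- The determinant has degree exactly 2e with unit top coefficient c, so for no α can both shifted
  -- leading coefficients lie in the maximal ideal.
  have hc' : f₁.coeff e * g₀.coeff e - f₀.coeff e * g₁.coeff e = c := by
    have := congrArg (fun F ↦ F.coeff (p ^ k * m)) hdet
    simp only [coeff_top_C_mul_X_pow_sub_pow _ _ _ _ (pow_pos hp.pos k)] at this
    rw [hpk, coeff_sub, coeff_mul_add_eq_of_natDegree_le df1 dg0,
      coeff_mul_add_eq_of_natDegree_le df0 dg1] at this
    exact this
  obtain ⟨α, hα, hres⟩ := exists_isUnit_resultant_shift (p := p) (e := e) df0 df1 dg0 dg1 c S hc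
    hdet (fun α ↦ by
      by_contra! hcon
      simp only [coeff_add, coeff_C_mul] at hcon
      apply (IsLocalRing.mem_maximalIdeal c).mp ?_ hc
      have h1 := Ideal.mul_mem_right (g₀.coeff e) _ ((IsLocalRing.mem_maximalIdeal _).mpr hcon.1)
      have h2 := Ideal.mul_mem_right (f₀.coeff e) _ ((IsLocalRing.mem_maximalIdeal _).mpr hcon.2)
      have := sub_mem h1 h2
      rw [← hc']
      convert this using 1
      ring) (fun z hz0 hz1 hz2 hz3 ↦ by
      obtain ⟨y, hy⟩ := IsAlgClosed.exists_pow_nat_eq z hp.pos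
      refine h.toIsRat.no_common_root hdd y ?_ ?_
      · rw [hf, eval₂_add, eval₂_mul, eval₂_expand, eval₂_expand, hy, hz0, hz1]
        simp
      · rw [hg, eval₂_add, eval₂_mul, eval₂_expand, eval₂_expand, hy, hz2, hz3]
        simp)
  refine ⟨S, α, c, f₁ + C α * f₀, f₀, g₁ + C α * g₀, g₀, hα, hc,
    natDegree_add_le_of_degree_le df1 ((natDegree_C_mul_le _ _).trans df0), df0,
    natDegree_add_le_of_degree_le dg1 ((natDegree_C_mul_le _ _).trans dg0), dg0, ?_, ?_, hres, ?_⟩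
  · conv_lhs => rw [hf]
    simp only [map_add, map_mul, expand_C]
    ring
  · conv_lhs => rw [hg]
    simp only [map_add, map_mul, expand_C]
    ring
  · rw [← hdet]; ring

/-- Now f = (f₀ + αf₁)(z²) + f₁(z²)(z - α). Since d is even, the leading coefficient of f sits in f₀
and the shift does not affect it. The sign of c comes from the order of the basis. -/
theorem IsUnicrit.exists_isDecomp_of_two_dvd [IsLocalRing B] (hp2 : p = 2) (hd : d = p * e)
    (he : 0 < e) {f g : B[X]} (h : IsUnicrit d (p ^ (k + 1)) m f g) :
    ∃ (S α c : B) (A B₁ A₂ B₂ : B[X]), (α = 0 ∨ α = 1) ∧ IsUnit c ∧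
      IsDecomp p e (e - 1) 1 (X - C α) ((X ^ p ^ k - C S) ^ m) f g c A B₁ A₂ B₂ := by
  have hp := (Fact.out : p.Prime)
  have hp1 := hp.one_lt
  have hdd : d ≠ 0 := by rw [hd]; positivity
  obtain ⟨c, S, hc, hS⟩ := h.exists_eq
  obtain ⟨hf2, hg2⟩ := h.derivative_derivative hdd
  obtain ⟨f₀, f₁, hf, hf0, hf1⟩ := exists_expand_add (p := p) one_pos hp1 f
    (mod_of_derivative_derivative hf2)
  obtain ⟨g₀, g₁, hg, hg0, hg1⟩ := exists_expand_add (p := p) one_pos hp1 g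
    (mod_of_derivative_derivative hg2)
  subst hp2
  have df0 : f₀.natDegree ≤ e := natDegree_le_of_coeff_eq (r := 0) h.1.1 hf0 fun i hi ↦ by omega
  have df1 : f₁.natDegree ≤ e - 1 := natDegree_le_of_coeff_eq h.1.1 hf1 fun i hi ↦ by omega
  have dg0 : g₀.natDegree ≤ e := natDegree_le_of_coeff_eq (r := 0) h.1.2 hg0 fun i hi ↦ by omega
  have dg1 : g₁.natDegree ≤ e - 1 := natDegree_le_of_coeff_eq h.1.2 hg1 fun i hi ↦ by omega
  have hdet : f₀ * g₁ - f₁ * g₀ = C (-c) * (X ^ 2 ^ k - C S) ^ m := by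
    apply expand_injective hp.pos
    rw [expand_X_pow_sub_pow, C_neg, neg_mul, ← hS]
    have e1 := critPoly_expand (p := 2) f₀ f₁ g₀ g₁ (1 : B[X]) X
    have e2 : critPoly (1 : B[X]) X = -1 := by simp [critPoly]
    rw [e2, mul_neg, mul_one, mul_one, mul_one] at e1
    rw [← neg_eq_iff_eq_neg, ← e1, hf, hg]
    congr 1 <;> ring
  have hlead : ∀ (F F₀ F₁ : B[X]) (α : B), (∀ n, F₀.coeff n = F.coeff (2 * n)) →
      F₁.natDegree ≤ e - 1 → (F₀ + C α * F₁).coeff e = F.coeff d := by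
    intro F F₀ F₁ α h0 h1
    rw [coeff_add, coeff_C_mul, coeff_eq_zero_of_natDegree_lt (lt_of_le_of_lt h1 (by omega)),
      mul_zero, add_zero, h0, hd]
  obtain ⟨α, hα, hres⟩ := exists_isUnit_resultant_shift (p := 2) (e := e) (df1.trans (by omega)) df0
    (dg1.trans (by omega)) dg0 (-c) S hc.neg hdet (fun α ↦ by
      rw [hlead f _ _ _ hf0 df1, hlead g _ _ _ hg0 dg1]
      exact h.toIsRat.isUnit_coeff_or hdd) (fun z hz0 hz1 hz2 hz3 ↦ by
      obtain ⟨y, hy⟩ := IsAlgClosed.exists_pow_nat_eq z hp.pos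
      refine h.toIsRat.no_common_root hdd y ?_ ?_
      · rw [hf, eval₂_add, eval₂_mul, eval₂_expand, eval₂_expand, hy, hz0, hz1]
        simp
      · rw [hg, eval₂_add, eval₂_mul, eval₂_expand, eval₂_expand, hy, hz2, hz3]
        simp)
  refine ⟨S, α, -c, f₀ + C α * f₁, f₁, g₀ + C α * g₁, g₁, hα, hc.neg,
    natDegree_add_le_of_degree_le df0 ((natDegree_C_mul_le _ _).trans (df1.trans (by omega))), df1,
    natDegree_add_le_of_degree_le dg0 ((natDegree_C_mul_le _ _).trans (dg1.trans (by omega))), dg1,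
    ?_, ?_, hres, ?_⟩
  · conv_lhs => rw [hf]
    simp only [map_add, map_mul, expand_C]
    ring
  · conv_lhs => rw [hg]
    simp only [map_add, map_mul, expand_C]
    ring
  · rw [← hdet]; ring

/-- After translating s to 0, the equation reads n(n + 1)a_n = 0 on coefficients, so only exponents
n ≡ 0 or -1 modulo p survive. -/
lemma exists_expand_of_annihilated (hp2 : p ≠ 2) {f : B[X]} {s : B} (he : 0 < e)
    (hdeg : f.natDegree ≤ p * e)
    (hf : (X - C s) * derivative (derivative f) + 2 * derivative f = 0) :
    ∃ A B₁ : B[X], A.natDegree ≤ e ∧ B₁.natDegree ≤ e - 1 ∧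
      f = expand B p A + expand B p B₁ * (X - C s) ^ (p - 1) := by
  have hp := (Fact.out : p.Prime)
  have hp3 : 2 < p := lt_of_le_of_ne hp.two_le hp2.symm
  let h : B[X] := f.comp (X + C s)
  have hh : h.comp (X - C s) = f := by
    rw [comp_assoc]; simp
  have hdh : h.natDegree ≤ p * e := by
    refine natDegree_comp_le.trans ?_
    calc _ ≤ f.natDegree * 1 := Nat.mul_le_mul_left _ ((natDegree_add_C (a := s)).trans_le natDegree_X_le)
      _ ≤ p * e := by simpa using hdeg
  have hL : X * derivative (derivative h) + 2 * derivative h = 0 := by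
    have := congrArg (fun F ↦ F.comp (X + C s)) hf
    simpa [h, derivative_comp, mul_comp, add_comp] using this
  have hmod : ∀ n, h.coeff n ≠ 0 → n % p = 0 ∨ n % p = p - 1 := by
    intro n hn
    by_contra! hcon
    obtain ⟨j, rfl⟩ : ∃ j, n = j + 1 := ⟨n - 1, by
      rcases n with _ | n
      · simp at hcon
      · omega⟩
    have h1 := congrArg (fun G ↦ G.coeff j) hL
    have h2 : IsUnit (((j + 1) * (j + 2) : ℕ) : B) := by
      refine isUnit_natCast_of_algebra (p := p) fun hdvd ↦ ?_
      rcases hp.dvd_mul.mp hdvd with h | h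
      · exact hcon.1 (Nat.mod_eq_zero_of_dvd h)
      · apply hcon.2
        obtain ⟨i, hi⟩ := h
        obtain ⟨l, rfl⟩ : ∃ l, i = l + 1 := ⟨i - 1, by
          rcases i with _ | i
          · omega
          · omega⟩
        rw [show j + 1 = (p - 1) + p * l by rw [mul_add] at hi; omega, Nat.add_mul_mod_self_left,
          Nat.mod_eq_of_lt (by omega)]
    apply hn
    rw [← h2.mul_left_eq_zero]
    have h3 : (2 * derivative h).coeff j = 2 * (derivative h).coeff j := by
      rw [show (2 : B[X]) = C 2 from (map_ofNat C 2).symm, coeff_C_mul]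
    simp only [coeff_add, h3, coeff_zero] at h1
    rcases j with _ | j
    · simp [coeff_derivative] at h1 ⊢
      linear_combination h1
    · rw [coeff_X_mul] at h1
      simp only [coeff_derivative] at h1
      push_cast at h1 ⊢
      linear_combination h1
  obtain ⟨h₀, h₁, e1, hh0, hh1⟩ := exists_expand_add (p := p) (by omega) (by omega) h hmod
  -- Since (z - s)^p = z^p - s^p, translating back preserves polynomials in z^p.
  have hc : ∀ F : B[X], (expand B p F).comp (X - C s) = expand B p (F.comp (X - C (s ^ p))) := by
    intro F
    rw [expand_eq_comp_X_pow, expand_eq_comp_X_pow, comp_assoc, comp_assoc]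
    congr 1
    have := sub_pow_pow_of_algebra (p := p) 1 (X : B[X]) (C s)
    simpa using this
  have hcd : ∀ (F : B[X]) (n : ℕ), F.natDegree ≤ n → (F.comp (X - C (s ^ p))).natDegree ≤ n := by
    intro F n hF
    refine natDegree_comp_le.trans ?_
    calc _ ≤ F.natDegree * 1 := Nat.mul_le_mul_left _ (natDegree_X_sub_C_le _)
      _ ≤ n := by simpa using hF
  have hlt : ∀ i, e < i → p * e + p ≤ p * i := fun i hi ↦ by nlinarith
  refine ⟨h₀.comp (X - C (s ^ p)), h₁.comp (X - C (s ^ p)), hcd _ _ ?_, hcd _ _ ?_, ?_⟩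
  · exact natDegree_le_of_coeff_eq (r := 0) hdh hh0 fun i hi ↦ by have := hlt i hi; omega
  · refine natDegree_le_of_coeff_eq hdh hh1 fun i hi ↦ ?_
    have : p * e ≤ p * i := Nat.mul_le_mul_left p (by omega)
    omega
  · rw [← hc, ← hc, ← hh, e1]
    simp [add_comp, mul_comp]
    ring

/-- No shift is needed here. A common root of A and A₂ is a root of the determinant, hence equals
s^p; since (z - s)^{p-1} vanishes at s, both f and g would vanish there. -/
theorem IsUnicrit.exists_isDecomp_of_odd_dvd [IsLocalRing B] (hp2 : p ≠ 2) (hd : d = p * e)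
    (he : 0 < e) {f g : B[X]} (h : IsUnicrit d 1 (2 * d - 2) f g) :
    ∃ (S c : B) (A B₁ A₂ B₂ : B[X]), IsUnit c ∧
      IsDecomp p e (e - 1) 1 ((X - C S) ^ (p - 1)) ((X - C (S ^ p)) ^ (2 * e - 1))
        f g c A B₁ A₂ B₂ := by
  have hp := (Fact.out : p.Prime)
  have hp3 : 2 < p := lt_of_le_of_ne hp.two_le hp2.symm
  have hdd : d ≠ 0 := by rw [hd]; positivity
  obtain ⟨c, s, hc, hS⟩ := h.exists_eq
  rw [pow_one] at hS
  -- The factor (z - s)^{p-2} of W is W for the basis pair 1, (z - s)^{p-1}; the remaining exponent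
  -- is p times that of τ.
  have hd2 : 2 * d - 2 = p * (2 * e - 1) + (p - 2) := by
    obtain ⟨l, rfl⟩ : ∃ l, e = l + 1 := ⟨e - 1, by omega⟩
    rw [hd, show 2 * (l + 1) - 1 = 2 * l + 1 by omega]
    ring_nf
    omega
  have hann := h.toIsRat.annihilated hdd s ((2 * d - 2 : ℕ) : B) (by
    obtain ⟨n, hn⟩ : ∃ n, 2 * d - 2 = n + 1 := ⟨2 * d - 3, by omega⟩
    rw [hS, hn]
    simp only [derivative_mul, derivative_C, derivative_X_sub_C_pow,
      Nat.add_sub_cancel, map_natCast]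
    ring)
  have hk : ((2 * d - 2 : ℕ) : B) = -2 := by
    have : ((2 * d - 2 + 2 : ℕ) : B) = 0 := natCast_eq_zero_of_algebra (p := p) (by
      rw [Nat.sub_add_cancel (by omega), hd]; exact ⟨2 * e, by ring⟩)
    push_cast at this
    linear_combination this
  have hk' : (C ((2 * d - 2 : ℕ) : B) : B[X]) = -2 := by
    rw [hk, C_neg, show (C 2 : B[X]) = 2 from map_ofNat C 2]
  rw [hk', neg_mul, sub_neg_eq_add, neg_mul, sub_neg_eq_add] at hann
  obtain ⟨A, B₁, hA, hB₁, hf⟩ := exists_expand_of_annihilated hp2 he (hd ▸ h.1.1) hann.1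
  obtain ⟨A₂, B₂, hA₂, hB₂, hg⟩ := exists_expand_of_annihilated hp2 he (hd ▸ h.1.2) hann.2
  have hdet : A * B₂ - B₁ * A₂ = C c * (X - C (s ^ p)) ^ (2 * e - 1) := by
    apply expand_injective hp.pos
    have e1 := critPoly_expand (p := p) A B₁ A₂ B₂ (1 : B[X]) ((X - C s) ^ (p - 1))
    have e2 : critPoly (1 : B[X]) ((X - C s) ^ (p - 1)) = (X - C s) ^ (p - 2) := by
      have h1 : ((p - 1 : ℕ) : B) = -1 := by
        have : ((p - 1 + 1 : ℕ) : B) = 0 := natCast_eq_zero_of_algebra (p := p) (by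
          rw [Nat.sub_add_cancel hp.one_le])
        push_cast at this
        linear_combination this
      simp [critPoly, derivative_X_sub_C_pow, h1, Nat.sub_sub]
    rw [mul_one, mul_one, ← hf, ← hg, hS, e2, hd2, pow_add, ← mul_assoc] at e1
    have hreg : IsRegular ((X - C s) ^ (p - 2)) := (monic_X_sub_C s |>.pow _).isRegular
    rw [← hreg.right e1]
    have := sub_pow_pow_of_algebra (p := p) 1 (X : B[X]) (C s)
    rw [pow_one] at this
    simp [pow_mul, this]
  -- The second summand has degree at most p(e - 1) + p - 1 < d, so the coefficient of z^d comes
  -- from A alone.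
  have hlead : ∀ F A B₁ : B[X], B₁.natDegree ≤ e - 1 → A.natDegree ≤ e →
      F = expand B p A + expand B p B₁ * (X - C s) ^ (p - 1) → A.coeff e = F.coeff d := by
    intro F A B₁ hB hA hF
    have h0 : (expand B p B₁ * (X - C s) ^ (p - 1)).coeff d = 0 := by
      apply coeff_eq_zero_of_natDegree_lt
      have h1 : ((X - C s) ^ (p - 1)).natDegree ≤ p - 1 :=
        natDegree_pow_le.trans ((Nat.mul_le_mul_left _ (natDegree_X_sub_C_le s)).trans (by simp))
      have h2 := natDegree_expand p B₁
      have h3 := (natDegree_mul_le (p := expand B p B₁) (q := (X - C s) ^ (p - 1)))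
      have h4 : B₁.natDegree * p ≤ (e - 1) * p := Nat.mul_le_mul_right p hB
      have h5 : (e - 1) * p + p = p * e := by
        obtain ⟨l, rfl⟩ : ∃ l, e = l + 1 := ⟨e - 1, by omega⟩
        simp; ring
      omega
    rw [hF, coeff_add, h0, hd, coeff_expand_mul' hp.pos, add_zero]
  refine ⟨s, c, A, B₁, A₂, B₂, hc, hA, hB₁, hA₂, hB₂, by rw [mul_one]; exact hf,
    by rw [mul_one]; exact hg, ?_, hdet⟩
  refine isUnit_resultant_of_no_common_root hA hA₂ ?_ fun z hz hz' ↦ ?_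
  · rw [hlead f A B₁ hB₁ hA hf, hlead g A₂ B₂ hB₂ hA₂ hg]
    exact h.toIsRat.isUnit_coeff_or hdd
  · have h4 := congrArg (eval₂ (geomResidue B) z) hdet
    simp only [eval₂_sub, eval₂_mul, hz, hz', zero_mul, mul_zero, sub_zero, eval₂_C, eval₂_pow,
      eval₂_X] at h4
    have h5 : z = geomResidue B s ^ p := by
      rcases mul_eq_zero.mp h4.symm with h5 | h5
      · rw [geomResidue_eq_zero_iff] at h5
        exact absurd hc h5
      · have := sub_eq_zero.mp (eq_zero_of_pow_eq_zero h5)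
        rw [this, map_pow]
    have hp10 : p - 1 ≠ 0 := by omega
    refine h.toIsRat.no_common_root hdd (geomResidue B s) ?_ ?_
    · rw [hf, eval₂_add, eval₂_mul, eval₂_expand, eval₂_expand, ← h5, hz]
      simp [hp10]
    · rw [hg, eval₂_add, eval₂_mul, eval₂_expand, eval₂_expand, ← h5, hz']
      simp [hp10]

/-- There is no unicritical rational function of degree `d ≢ 0, 1`. -/
theorem IsUnicrit.false_of_not_dvd [IsLocalRing B] (hd : 1 < d) (h0 : ¬ p ∣ d) (h1 : ¬ p ∣ d - 1)
    {f g : B[X]} (h : IsUnicrit d 1 (2 * d - 2) f g) : False := by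
  have hp := (Fact.out : p.Prime)
  have hdd : d ≠ 0 := by omega
  obtain ⟨c, s, hc, hS⟩ := h.exists_eq
  rw [pow_one] at hS
  have hann := h.toIsRat.annihilated hdd s ((2 * d - 2 : ℕ) : B) (by
    obtain ⟨n, hn⟩ : ∃ n, 2 * d - 2 = n + 1 := ⟨2 * d - 3, by omega⟩
    rw [hS, hn]
    simp only [derivative_mul, derivative_C, derivative_X_sub_C_pow,
      Nat.add_sub_cancel, map_natCast]
    ring)
  -- The coefficient of z^{d-1} in the equation is d(d - 1)a_d - (2d - 2)d a_d = -d(d - 1)a_d, and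
  -- d(d - 1) is a unit.
  have key : ∀ F : B[X], F.natDegree ≤ d → (X - C s) * derivative (derivative F) -
      C ((2 * d - 2 : ℕ) : B) * derivative F = 0 → F.coeff d = 0 := by
    intro F hF hL
    obtain ⟨j, rfl⟩ : ∃ j, d = j + 2 := ⟨d - 2, by omega⟩
    have h2 := congrArg (fun G ↦ G.coeff (j + 1)) hL
    simp only [coeff_sub, sub_mul, coeff_X_mul, coeff_C_mul, coeff_derivative, coeff_zero] at h2
    rw [coeff_eq_zero_of_natDegree_lt (lt_of_le_of_lt hF (by omega : j + 2 < j + 1 + 1 + 1))] at h2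
    have h3 : IsUnit (((j + 2) * (j + 1) : ℕ) : B) := isUnit_natCast_of_algebra (p := p) fun hdvd ↦ by
      rcases hp.dvd_mul.mp hdvd with h | h
      · exact h0 h
      · exact h1 (by simpa using h)
    rw [← h3.mul_left_eq_zero]
    rw [show 2 * (j + 2) - 2 = 2 * j + 2 by omega] at h2
    push_cast at h2 ⊢
    linear_combination -h2
  rcases h.toIsRat.isUnit_coeff_or hdd with hu | hu
  · rw [key f h.1.1 hann.1] at hu; exact not_isUnit_zero hu
  · rw [key g h.1.2 hann.2] at hu; exact not_isUnit_zero hu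

end Decomposition

end Unicritical
end

noncomputable section

namespace Unicritical

/-! ### Normal forms and the universal unicritical function -/

section Universal

open Polynomial

/-- A pair `A B₂ - B₁ A₂ = τ` with `A` monic and `A, A₂` coprime determines `B₁` and `B₂`. -/
lemma eq_of_mul_sub_mul_eq {B : Type} [CommRing B] {e : ℕ} {A A₂ B₁ B₂ B₁' B₂' : B[X]}
    (hA : A.Monic) (hAe : A.natDegree = e) (hco : IsCoprime A A₂) (h₁ : B₁.degree < e)
    (h₁' : B₁'.degree < e) (h : A * B₂ - B₁ * A₂ = A * B₂' - B₁' * A₂) :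
    B₁ = B₁' ∧ B₂ = B₂' := by
  nontriviality B
  have e1 : A * (B₂ - B₂') = (B₁ - B₁') * A₂ := by linear_combination h
  have hdvd : A ∣ B₁ - B₁' := hco.dvd_of_dvd_mul_right (Dvd.intro _ e1)
  have h0 : B₁ - B₁' = 0 := by
    by_contra hne
    refine hA.not_dvd_of_degree_lt hne ?_ hdvd
    rw [degree_eq_natDegree hA.ne_zero, hAe]
    exact lt_of_le_of_lt (degree_sub_le _ _) (max_lt h₁ h₁')
  refine ⟨sub_eq_zero.mp h0, ?_⟩
  rw [h0, zero_mul] at e1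
  exact sub_eq_zero.mp (hA.isRegular.left (by simpa using e1))

/-- Over the ring of parameters the resultant is not invertible, so Bézout is solved for its
multiple of τ. Division by the monic A then brings B₁ below degree e. -/
lemma exists_mul_sub_mul_eq {B : Type} [CommRing B] {e b : ℕ} (he : 0 < e) (hb : e - 1 ≤ b)
    {A A₂ τ : B[X]} (hA : A.Monic) (hAe : A.natDegree = e) (hA₂ : A₂.natDegree ≤ e)
    (hτ : τ.natDegree ≤ e + b) :
    ∃ B₁ B₂ : B[X], B₁.degree < e ∧ B₂.natDegree ≤ b ∧
      A * B₂ - B₁ * A₂ = C (resultant A A₂ e e) * τ := by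
  nontriviality B
  obtain ⟨x, y, -, -, hxy⟩ := exists_mul_add_mul_eq_C_resultant A A₂ hAe.le hA₂ (.inl he.ne')
  let B₁ := (-(τ * y)) %ₘ A
  have hB₁ : B₁.degree < e := by
    have := degree_modByMonic_lt (-(τ * y)) hA
    rwa [degree_eq_natDegree hA.ne_zero, hAe] at this
  have hmod := modByMonic_add_div (-(τ * y)) A
  let B₂ := τ * x - (-(τ * y)) /ₘ A * A₂
  have key : A * B₂ - B₁ * A₂ = C (resultant A A₂ e e) * τ := by
    rw [← hxy]
    have : B₁ = -(τ * y) - A * ((-(τ * y)) /ₘ A) := eq_sub_of_add_eq hmod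
    rw [this]
    simp only [B₂]
    ring
  refine ⟨B₁, B₂, hB₁, ?_, key⟩
  -- Since A is monic, deg(A B₂) = e + deg B₂, whereas the equation bounds the degree of A B₂ by e +
  -- b.
  by_contra! hcon
  have h1 : A * B₂ = C (resultant A A₂ e e) * τ + B₁ * A₂ := by rw [← key]; ring
  have h2 : (A * B₂).natDegree = e + B₂.natDegree := by
    rw [hA.natDegree_mul' (by rintro h; simp [h] at hcon), hAe]
  have h3 : (A * B₂).natDegree ≤ e + b := by
    rw [h1]
    refine natDegree_add_le_of_degree_le ((natDegree_C_mul_le _ _).trans hτ)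
      (natDegree_mul_le.trans ?_)
    have : B₁.natDegree < e := by
      by_cases h0 : B₁ = 0
      · rw [h0, natDegree_zero]; exact he
      · exact (natDegree_lt_iff_degree_lt h0).mpr hB₁
    omega
  omega

/-- A normal form for unicritical rational functions: a basis `u, v` of the module of numerators
over the ring of polynomials in `z ^ p`, depending on the critical value `S` and a parameter `α`,
together with the determinant `τ` of the coordinates. -/
structure NormalForm (p d e ε q m : ℕ) [Fact p.Prime] where
  u : ∀ {R : Type} [CommRing R], R → R → R[X]
  v : ∀ {R : Type} [CommRing R], R → R → R[X]
  τ : ∀ {R : Type} [CommRing R], R → R → R[X]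
  map_u : ∀ {R R' : Type} [CommRing R] [CommRing R'] (φ : R →+* R') (S α : R),
    (u S α).map φ = u (φ S) (φ α)
  map_v : ∀ {R R' : Type} [CommRing R] [CommRing R'] (φ : R →+* R') (S α : R),
    (v S α).map φ = v (φ S) (φ α)
  map_τ : ∀ {R R' : Type} [CommRing R] [CommRing R'] (φ : R →+* R') (S α : R),
    (τ S α).map φ = τ (φ S) (φ α)
  crit_eq : ∀ {R : Type} [CommRing R] [Algebra (ZMod p) R] (S α : R),
    expand R p (τ S α) * critPoly (u S α) (v S α) = (X ^ q - C S) ^ m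
  natDegree_τ_le : ∀ {R : Type} [CommRing R] (S α : R), (τ S α).natDegree ≤ e + (e - 1 + ε)
  natDegree_le : ∀ {R : Type} [CommRing R] (S α : R) (A B : R[X]), A.natDegree ≤ e →
    B.natDegree ≤ e - 1 + ε → (expand R p A * u S α + expand R p B * v S α).natDegree ≤ d
  exists_decomp : ∀ {B : Type} [CommRing B] [IsLocalRing B] [Algebra (ZMod p) B] {f g : B[X]},
    IsUnicrit d q m f g → ∃ (S α c : B) (A B₁ A₂ B₂ : B[X]), (α = 0 ∨ α = 1) ∧ IsUnit c ∧
      IsDecomp p e (e - 1 + ε) (u S α) (v S α) (τ S α) f g c A B₁ A₂ B₂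

/-- Indices of the parameters: coefficients of `A` and `A₂`, then `c`, `S` and possibly `λ`. -/
abbrev ParamIdx (e ε : ℕ) : Type := (Fin e ⊕ Fin (e + 1)) ⊕ (Fin 2 ⊕ Fin ε)

/-- Indices of all the parameters, including `α` and `β`. -/
abbrev FullIdx (e ε : ℕ) : Type := ParamIdx e ε ⊕ Fin 2

section Params

variable {R R' : Type} [CommRing R] [CommRing R'] {e ε : ℕ} (t : FullIdx e ε → R)

def polyA : R[X] := X ^ e + ∑ i : Fin e, C (t (.inl (.inl (.inl i)))) * X ^ (i : ℕ)

def polyA₂ : R[X] := ∑ i : Fin (e + 1), C (t (.inl (.inl (.inr i)))) * X ^ (i : ℕ)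

def parC : R := t (.inl (.inr (.inl 0)))

def parS : R := t (.inl (.inr (.inl 1)))

/-- The sum over `Fin ε` is zero for ε = 0 and the single parameter λ for ε = 1, so both cases share
one formula. -/
def parLam : R := ∑ i : Fin ε, t (.inl (.inr (.inr i)))

def parα : R := t (.inr 0)

def parβ : R := t (.inr 1)

lemma map_polyA (φ : R →+* R') : (polyA t).map φ = polyA (φ ∘ t) := by
  simp [polyA, Polynomial.map_sum]

lemma map_polyA₂ (φ : R →+* R') : (polyA₂ t).map φ = polyA₂ (φ ∘ t) := by
  simp [polyA₂, Polynomial.map_sum]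

lemma map_parLam (φ : R →+* R') : φ (parLam t) = parLam (φ ∘ t) := by
  simp [parLam]

lemma degree_sum_lt : (∑ i : Fin e, C (t (.inl (.inl (.inl i)))) * X ^ (i : ℕ)).degree <
    ((e : ℕ) : WithBot ℕ) := by
  rw [degree_lt_iff_coeff_zero]
  intro n hn
  rw [finsetSum_coeff]
  refine Finset.sum_eq_zero fun i _ ↦ ?_
  rw [coeff_C_mul_X_pow, if_neg (by have := i.2; omega)]

lemma polyA_monic : (polyA t).Monic := monic_X_pow_add (degree_sum_lt t)

lemma natDegree_polyA [Nontrivial R] : (polyA t).natDegree = e := by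
  have h := degree_sum_lt t
  have : (polyA t).degree = e := by
    rw [polyA, degree_add_eq_left_of_degree_lt (by rwa [degree_X_pow]), degree_X_pow]
  exact natDegree_eq_of_degree_eq_some this

lemma coeff_polyA (i : Fin e) : (polyA t).coeff i = t (.inl (.inl (.inl i))) := by
  rw [polyA, coeff_add, coeff_X_pow, if_neg (by have := i.2; omega), zero_add, finsetSum_coeff]
  simp [coeff_X_pow, Fin.val_inj]

lemma coeff_polyA₂ (i : Fin (e + 1)) : (polyA₂ t).coeff i = t (.inl (.inl (.inr i))) := by
  rw [polyA₂, finsetSum_coeff]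
  simp [coeff_X_pow, Fin.val_inj]

lemma natDegree_polyA₂_le : (polyA₂ t).natDegree ≤ e :=
  natDegree_sum_le_of_forall_le _ _ fun i _ ↦ (natDegree_C_mul_X_pow_le _ _).trans (by omega)

lemma eq_polyA {A : R[X]} (hA : A.natDegree ≤ e) (h1 : A.coeff e = 1)
    (h : ∀ i : Fin e, t (.inl (.inl (.inl i))) = A.coeff i) : polyA t = A := by
  nontriviality R
  ext n
  rcases lt_trichotomy n e with hn | rfl | hn
  · rw [← h ⟨n, hn⟩]; exact coeff_polyA t ⟨n, hn⟩
  · have := polyA_monic t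
    rw [Monic, leadingCoeff, natDegree_polyA] at this
    rw [this, h1]
  · rw [coeff_eq_zero_of_natDegree_lt (lt_of_le_of_lt hA hn),
      coeff_eq_zero_of_natDegree_lt (lt_of_le_of_lt (natDegree_polyA t).le hn)]

lemma eq_polyA₂ {A : R[X]} (hA : A.natDegree ≤ e)
    (h : ∀ i : Fin (e + 1), t (.inl (.inl (.inr i))) = A.coeff i) : polyA₂ t = A := by
  ext n
  rcases lt_or_ge n (e + 1) with hn | hn
  · rw [← h ⟨n, hn⟩]; exact coeff_polyA₂ t ⟨n, hn⟩
  · rw [coeff_eq_zero_of_natDegree_lt (lt_of_le_of_lt hA hn),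
      coeff_eq_zero_of_natDegree_lt (lt_of_le_of_lt (natDegree_polyA₂_le t) hn)]

end Params

/-- The ring of parameters. -/
abbrev ParamRing (p e ε : ℕ) [Fact p.Prime] : Type := MvPolynomial (FullIdx e ε) (ZMod p)

/-- The universal parameters. -/
def univPar (p e ε : ℕ) [Fact p.Prime] : FullIdx e ε → ParamRing p e ε := MvPolynomial.X

namespace NormalForm

variable {p d e ε q m : ℕ} [Fact p.Prime] (N : NormalForm p d e ε q m)

/-- This is the solution with λ = 0, normalized by deg B₁ < e. The extra factor Res(A, A₂) is
harmless: once it is invertible it can be absorbed into the parameter c. -/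
lemma exists_univ (he : 0 < e) : ∃ B : (ParamRing p e ε)[X] × (ParamRing p e ε)[X],
    B.1.degree < e ∧ B.2.natDegree ≤ e - 1 + ε ∧
    polyA (univPar p e ε) * B.2 - B.1 * polyA₂ (univPar p e ε) =
      C (resultant (polyA (univPar p e ε)) (polyA₂ (univPar p e ε)) e e) *
        (C (parC (univPar p e ε)) * N.τ (parS (univPar p e ε)) (parα (univPar p e ε))) := by
  obtain ⟨B₁, B₂, h⟩ := exists_mul_sub_mul_eq he (Nat.le_add_right _ ε)
    (polyA_monic (univPar p e ε)) (natDegree_polyA _)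
    (natDegree_polyA₂_le _) ((natDegree_C_mul_le _ _).trans (N.natDegree_τ_le _ _))
  exact ⟨(B₁, B₂), h⟩

variable (he : 0 < e)

def univB₁ : (ParamRing p e ε)[X] := (N.exists_univ he).choose.1

def univB₂ : (ParamRing p e ε)[X] := (N.exists_univ he).choose.2

lemma univ_det : polyA (univPar p e ε) * N.univB₂ he - N.univB₁ he * polyA₂ (univPar p e ε) =
    C (resultant (polyA (univPar p e ε)) (polyA₂ (univPar p e ε)) e e) *
      (C (parC (univPar p e ε)) * N.τ (parS (univPar p e ε)) (parα (univPar p e ε))) :=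
  (N.exists_univ he).choose_spec.2.2

/-- The universal denominator. -/
def univDen : (ParamRing p e ε)[X] :=
  expand (ParamRing p e ε) p (polyA₂ (univPar p e ε)) *
      N.u (parS (univPar p e ε)) (parα (univPar p e ε)) +
    expand (ParamRing p e ε) p
        (N.univB₂ he + C (parLam (univPar p e ε)) * polyA₂ (univPar p e ε)) *
      N.v (parS (univPar p e ε)) (parα (univPar p e ε))

/-- The universal numerator. -/
def univNum : (ParamRing p e ε)[X] :=
  expand (ParamRing p e ε) p (polyA (univPar p e ε)) *
      N.u (parS (univPar p e ε)) (parα (univPar p e ε)) +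
    expand (ParamRing p e ε) p
        (N.univB₁ he + C (parLam (univPar p e ε)) * polyA (univPar p e ε)) *
      N.v (parS (univPar p e ε)) (parα (univPar p e ε)) - C (parβ (univPar p e ε)) * N.univDen he

/-- The element to be inverted. -/
def univLoc : ParamRing p e ε :=
  resultant (N.univNum he) (N.univDen he) d d *
    (resultant (polyA (univPar p e ε)) (polyA₂ (univPar p e ε)) e e * parC (univPar p e ε))

variable {R : Type} [CommRing R] (φ : ParamRing p e ε →+* R)

/-- The values of the parameters under a specialization. -/
def par : FullIdx e ε → R := φ ∘ univPar p e ε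

lemma map_par_A : (polyA (univPar p e ε)).map φ = polyA (par φ) := map_polyA _ φ

lemma map_par_A₂ : (polyA₂ (univPar p e ε)).map φ = polyA₂ (par φ) := map_polyA₂ _ φ

lemma map_par_C : φ (parC (univPar p e ε)) = parC (par φ) := rfl

lemma map_par_S : φ (parS (univPar p e ε)) = parS (par φ) := rfl

lemma map_par_lam : φ (parLam (univPar p e ε)) = parLam (par φ) := map_parLam _ φ

lemma map_par_α : φ (parα (univPar p e ε)) = parα (par φ) := rfl

lemma map_par_β : φ (parβ (univPar p e ε)) = parβ (par φ) := rfl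

lemma degree_map_univB₁_lt : ((N.univB₁ he).map φ).degree < e :=
  degree_map_le.trans_lt (N.exists_univ he).choose_spec.1

lemma natDegree_map_univB₂_le : ((N.univB₂ he).map φ).natDegree ≤ e - 1 + ε :=
  natDegree_map_le.trans (N.exists_univ he).choose_spec.2.1

lemma map_det : polyA (par φ) * (N.univB₂ he).map φ - (N.univB₁ he).map φ * polyA₂ (par φ) =
    C (resultant (polyA (par φ)) (polyA₂ (par φ)) e e) *
      (C (parC (par φ)) * N.τ (parS (par φ)) (parα (par φ))) := by
  have h := congrArg (Polynomial.map φ) (N.univ_det he)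
  rw [Polynomial.map_sub, Polynomial.map_mul, Polynomial.map_mul, Polynomial.map_mul,
    Polynomial.map_mul, Polynomial.map_C, Polynomial.map_C, N.map_τ, ← resultant_map_map,
    map_par_A, map_par_A₂, map_par_C, map_par_S, map_par_α] at h
  exact h

lemma map_univDen : (N.univDen he).map φ =
    expand R p (polyA₂ (par φ)) * N.u (parS (par φ)) (parα (par φ)) +
      expand R p ((N.univB₂ he).map φ + C (parLam (par φ)) * polyA₂ (par φ)) *
        N.v (parS (par φ)) (parα (par φ)) := by
  simp only [univDen, Polynomial.map_add, Polynomial.map_mul, map_expand, N.map_u,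
    N.map_v, Polynomial.map_C]
  simp only [map_par_A₂, map_par_S, map_par_lam, map_par_α]

lemma map_univNum : (N.univNum he).map φ =
    expand R p (polyA (par φ)) * N.u (parS (par φ)) (parα (par φ)) +
      expand R p ((N.univB₁ he).map φ + C (parLam (par φ)) * polyA (par φ)) *
        N.v (parS (par φ)) (parα (par φ)) - C (parβ (par φ)) * (N.univDen he).map φ := by
  simp only [univNum, Polynomial.map_sub, Polynomial.map_add, Polynomial.map_mul, map_expand,
    N.map_u, N.map_v, Polynomial.map_C]
  simp only [map_par_A, map_par_S, map_par_lam, map_par_α, map_par_β]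

lemma map_univLoc : φ (N.univLoc he) =
    resultant ((N.univNum he).map φ) ((N.univDen he).map φ) d d *
      (resultant (polyA (par φ)) (polyA₂ (par φ)) e e * parC (par φ)) := by
  rw [univLoc, map_mul, map_mul, ← resultant_map_map, ← resultant_map_map, map_par_A, map_par_A₂,
    map_par_C]

end NormalForm

end Universal

end Unicritical
end

noncomputable section

namespace Unicritical

/-! ### Specializations of the universal function: existence and uniqueness -/

section Universal

open Polynomial

namespace NormalForm

variable {p d e ε q m : ℕ} [Fact p.Prime] (N : NormalForm p d e ε q m) (he : 0 < e)

section

variable {R : Type} [CommRing R] (φ : ParamRing p e ε →+* R)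

/-- The numerator in which the parameter `β` has been removed. -/
lemma map_univNum_add : (N.univNum he).map φ + C (parβ (par φ)) * (N.univDen he).map φ =
    expand R p (polyA (par φ)) * N.u (parS (par φ)) (parα (par φ)) +
      expand R p ((N.univB₁ he).map φ + C (parLam (par φ)) * polyA (par φ)) *
        N.v (parS (par φ)) (parα (par φ)) := by
  rw [map_univNum]; ring

/-- λA has degree up to e, which the bound e - 1 + ε permits if ε = 1; for ε = 0 the parameter λ is
zero. -/
lemma natDegree_add_lam_mul_le {A B : R[X]} (hA : A.natDegree ≤ e) (hB : B.natDegree ≤ e - 1 + ε) :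
    (B + C (parLam (par φ)) * A).natDegree ≤ e - 1 + ε := by
  refine natDegree_add_le_of_degree_le hB ?_
  rcases Nat.eq_zero_or_pos ε with rfl | hε
  · have : parLam (par φ) = 0 := by simp [parLam]
    rw [this]; simp
  · exact (natDegree_C_mul_le _ _).trans (by omega)

lemma natDegree_map_univB₁_le : ((N.univB₁ he).map φ).natDegree ≤ e - 1 := by
  have := N.degree_map_univB₁_lt he φ
  by_cases h0 : (N.univB₁ he).map φ = 0
  · rw [h0]; simp
  · have := (natDegree_lt_iff_degree_lt h0).mpr this
    omega

lemma natDegree_polyA_le (t : FullIdx e ε → R) : (polyA t).natDegree ≤ e := by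
  nontriviality R
  exact (natDegree_polyA t).le

lemma natDegree_map_univDen_le : ((N.univDen he).map φ).natDegree ≤ d := by
  rw [map_univDen]
  exact N.natDegree_le _ _ _ _ (natDegree_polyA₂_le _)
    (natDegree_add_lam_mul_le φ (natDegree_polyA₂_le _) (N.natDegree_map_univB₂_le he φ))

lemma natDegree_map_univNum_le : ((N.univNum he).map φ).natDegree ≤ d := by
  rw [map_univNum]
  refine (natDegree_sub_le_of_le (m := d) (n := d) ?_ ?_).trans (max_self d).le
  · exact N.natDegree_le _ _ _ _ (natDegree_polyA_le _) (natDegree_add_lam_mul_le φ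
      (natDegree_polyA_le _) ((N.natDegree_map_univB₁_le he φ).trans (by omega)))
  · exact (natDegree_C_mul_le _ _).trans (N.natDegree_map_univDen_le he φ)

variable [Algebra (ZMod p) R]

/-- Neither β nor λ changes the determinant of the coordinates, so W is the universal determinant,
taken at z^p, times W of the basis. -/
lemma critPoly_map_univ : critPoly ((N.univNum he).map φ) ((N.univDen he).map φ) =
    C (resultant (polyA (par φ)) (polyA₂ (par φ)) e e * parC (par φ)) *
      (X ^ q - C (parS (par φ))) ^ m := by
  rw [← critPoly_add_C_mul _ _ (parβ (par φ)), map_univNum_add, map_univDen, critPoly_expand]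
  have h : polyA (par φ) * ((N.univB₂ he).map φ + C (parLam (par φ)) * polyA₂ (par φ)) -
      ((N.univB₁ he).map φ + C (parLam (par φ)) * polyA (par φ)) * polyA₂ (par φ) =
      C (resultant (polyA (par φ)) (polyA₂ (par φ)) e e) *
        (C (parC (par φ)) * N.τ (parS (par φ)) (parα (par φ))) := by
    rw [← N.map_det he]; ring
  rw [h, map_mul, map_mul, expand_C, expand_C, C_mul, ← N.crit_eq (parS (par φ)) (parα (par φ))]
  ring

theorem isUnicrit_map_univ (hu : IsUnit (φ (N.univLoc he))) :
    IsUnicrit d q m ((N.univNum he).map φ) ((N.univDen he).map φ) := by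
  rw [map_univLoc] at hu
  exact ⟨⟨N.natDegree_map_univNum_le he φ, N.natDegree_map_univDen_le he φ,
    isUnit_of_mul_isUnit_left hu⟩, _, _, isUnit_of_mul_isUnit_right hu, N.critPoly_map_univ he φ⟩

end

/-- Every unicritical rational function over a local ring is a specialization of the universal
one, up to a unit. -/
theorem exists_specialization (hε : ε ≤ 1) {B : Type} [CommRing B] [IsLocalRing B] [Algebra (ZMod p) B]
    {f g : B[X]} (h : IsUnicrit d q m f g) :
    ∃ (φ : ParamRing p e ε →+* B) (μ : B), IsUnit μ ∧ IsUnit (φ (N.univLoc he)) ∧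
      f = C μ * (N.univNum he).map φ ∧ g = C μ * (N.univDen he).map φ ∧
      (parα (par φ) = 0 ∨ parα (par φ) = 1) ∧ (parβ (par φ) = 0 ∨ parβ (par φ) = 1) := by
  obtain ⟨S, α, c, A, B₁, A₂, B₂, hα, hc, D⟩ := N.exists_decomp h
  have hA : IsRat e A A₂ := ⟨D.A_le, D.A₂_le, D.isUnit_resultant⟩
  -- Adding β times the second row gives A a unit leading coefficient μ; multiplying the whole pair
  -- by ν = μ⁻¹ makes it monic.
  obtain ⟨β, hβ, hlead⟩ := hA.exists_isUnit_coeff he.ne'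
  obtain ⟨μ, hμ⟩ := hlead
  have hμ1 : (↑μ⁻¹ : B) * μ = 1 := Units.inv_mul μ
  have hA' := (hA.add_C_mul β).C_mul μ⁻¹.isUnit
  obtain ⟨ν, hν⟩ : ∃ ν : B, ν = ↑μ⁻¹ := ⟨_, rfl⟩
  rw [← hν] at hμ1 hA'
  obtain ⟨A', hA'd⟩ : ∃ A' : B[X], A' = C ν * (A + C β * A₂) := ⟨_, rfl⟩
  obtain ⟨A₂', hA₂'d⟩ : ∃ A' : B[X], A' = C ν * A₂ := ⟨_, rfl⟩
  obtain ⟨B₁', hB₁'d⟩ : ∃ A' : B[X], A' = C ν * (B₁ + C β * B₂) := ⟨_, rfl⟩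
  obtain ⟨B₂', hB₂'d⟩ : ∃ A' : B[X], A' = C ν * B₂ := ⟨_, rfl⟩
  rw [← hA'd, ← hA₂'d] at hA'
  obtain ⟨r, hr⟩ := hA'.isUnit_resultant
  have hlead' : A'.coeff e = 1 := by rw [hA'd, coeff_C_mul, ← hμ, hμ1]
  have hB₁le : B₁'.natDegree ≤ e - 1 + ε := by
    rw [hB₁'d]
    exact (natDegree_C_mul_le _ _).trans
      (natDegree_add_le_of_degree_le D.B₁_le ((natDegree_C_mul_le _ _).trans D.B₂_le))
  -- Rescaling by ν multiplies the determinant by ν², and the universal determinant carries the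
  -- factor r = Res(A', A₂'); hence the value r⁻¹ν²c. The parameter λ is the coefficient of B₁' in
  -- degree e.
  let t : FullIdx e ε → B := Sum.elim (Sum.elim (Sum.elim (fun i ↦ A'.coeff i) fun i ↦ A₂'.coeff i)
    (Sum.elim ![(↑r⁻¹ : B) * (ν ^ 2 * c), S] fun i ↦ if (i : ℕ) = 0 then B₁'.coeff e else 0)) ![α, β]
  obtain ⟨φ, hφ⟩ : ∃ φ : ParamRing p e ε →+* B, par φ = t :=
    ⟨(MvPolynomial.aeval t).toRingHom, funext fun i ↦ MvPolynomial.aeval_X t i⟩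
  have hpA : polyA (par φ) = A' := by
    rw [hφ]; exact eq_polyA t hA'.1 hlead' fun i ↦ rfl
  have hpA₂ : polyA₂ (par φ) = A₂' := by
    rw [hφ]; exact eq_polyA₂ t hA'.2 fun i ↦ rfl
  have hpS : parS (par φ) = S := by rw [hφ]; rfl
  have hpC : parC (par φ) = (↑r⁻¹ : B) * (ν ^ 2 * c) := by rw [hφ]; rfl
  have hpα : parα (par φ) = α := by rw [hφ]; rfl
  have hpβ : parβ (par φ) = β := by rw [hφ]; rfl
  have hplam : parLam (par φ) = B₁'.coeff e := by
    rw [hφ, parLam]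
    rcases Nat.eq_zero_or_pos ε with rfl | hε0
    · rw [coeff_eq_zero_of_natDegree_lt (by omega)]
      rfl
    · rw [Finset.sum_eq_single ⟨0, hε0⟩]
      · simp [t]
      · intro i _ hi
        have : (i : ℕ) ≠ 0 := fun h0 ↦ hi (Fin.ext h0)
        simp [t, this]
      · simp
  have hB₁sub : (B₁' - C (B₁'.coeff e) * A').degree < ((e : ℕ) : WithBot ℕ) := by
    rw [degree_lt_iff_coeff_zero]
    intro n hn
    rw [coeff_sub, coeff_C_mul]
    rcases hn.eq_or_lt with rfl | hn
    · rw [hlead', mul_one, sub_self]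
    · rw [coeff_eq_zero_of_natDegree_lt (lt_of_le_of_lt hA'.1 hn),
        coeff_eq_zero_of_natDegree_lt (by omega), mul_zero, sub_zero]
  have hmonic : A'.Monic := monic_of_natDegree_le_of_coeff_eq_one e hA'.1 hlead'
  have hdet : A' * (B₂' - C (B₁'.coeff e) * A₂') - (B₁' - C (B₁'.coeff e) * A') * A₂' =
      C (ν ^ 2) * (C c * N.τ S α) := by
    rw [← D.det_eq, hA'd, hA₂'d, hB₁'d, hB₂'d, C_pow]
    ring
  have hkey := N.map_det he φ
  rw [hpA, hpA₂, hpC, hpS, hpα] at hkey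
  nontriviality B
  have hnat : A'.natDegree = e := le_antisymm hA'.1 (le_natDegree_of_ne_zero (by rw [hlead']; exact one_ne_zero))
  -- After subtracting λ(A', A₂'), both pairs satisfy deg B₁ < e and the same determinant equation,
  -- so they coincide.
  obtain ⟨e1, e2⟩ := eq_of_mul_sub_mul_eq hmonic hnat (hA'.isCoprime he.ne')
    hB₁sub (N.degree_map_univB₁_lt he φ) (B₂' := (N.univB₂ he).map φ) (by
      rw [hdet, hkey, ← mul_assoc, ← mul_assoc, ← C_mul, ← C_mul, ← hr, ← mul_assoc, Units.mul_inv,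
        one_mul])
  have hden : (N.univDen he).map φ = C ν * g := by
    rw [map_univDen, hpA₂, hpS, hpα, hplam, ← e2, D.right_eq, sub_add_cancel, hA₂'d, hB₂'d]
    simp only [map_mul, expand_C]
    ring
  have hnum : (N.univNum he).map φ = C ν * f := by
    have h1 := N.map_univNum_add he φ
    rw [hpβ, hden, hpA, hpS, hpα, hplam, ← e1, sub_add_cancel, hA'd, hB₁'d] at h1
    have h2 : (N.univNum he).map φ = expand B p (C ν * (A + C β * A₂)) * N.u S α +
        expand B p (C ν * (B₁ + C β * B₂)) * N.v S α - C β * (C ν * g) := by rw [← h1]; ring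
    rw [h2, D.right_eq, D.left_eq]
    simp only [map_mul, map_add, expand_C]
    ring
  have hC : (C (μ : B) : B[X]) * C ν = 1 := by rw [← C_mul, mul_comm, hμ1, C_1]
  have hνu : IsUnit ν := hν ▸ μ⁻¹.isUnit
  refine ⟨φ, μ, μ.isUnit, ?_, ?_, ?_, hpα ▸ hα, hpβ ▸ hβ⟩
  · rw [map_univLoc, hnum, hden, hpA, hpA₂, hpC]
    exact (h.toIsRat.C_mul hνu).isUnit_resultant.mul
      (hA'.isUnit_resultant.mul (r⁻¹.isUnit.mul ((hνu.pow 2).mul hc)))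
  · rw [hnum, ← mul_assoc, hC, one_mul]
  · rw [hden, ← mul_assoc, hC, one_mul]

/-- The parameters are determined by the rational function, once `α` and `β` are fixed. -/
theorem specialization_unique (hq : 0 < q) (hm : ¬ p ∣ m) (hε : ε ≤ 1) {L : Type} [Field L] [Algebra (ZMod p) L]
    {φ ψ : ParamRing p e ε →+* L} (hφ : IsUnit (φ (N.univLoc he)))
    (hψ : IsUnit (ψ (N.univLoc he))) (hα : parα (par φ) = parα (par ψ))
    (hβ : parβ (par φ) = parβ (par ψ)) {μ : L}
    (hnum : (N.univNum he).map ψ = C μ * (N.univNum he).map φ)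
    (hden : (N.univDen he).map ψ = C μ * (N.univDen he).map φ) : par φ = par ψ := by
  have hφ1 := hφ
  have hψ1 := hψ
  rw [map_univLoc, isUnit_iff_ne_zero] at hφ1 hψ1
  have hc := right_ne_zero_of_mul hφ1
  have hc' := right_ne_zero_of_mul hψ1
  have hr := left_ne_zero_of_mul hc
  -- the critical value
  have hW := N.critPoly_map_univ he ψ
  rw [hnum, hden, critPoly_C_mul, N.critPoly_map_univ he φ, ← mul_assoc, ← C_mul] at hW
  have hm0 : 0 < m := Nat.pos_of_ne_zero (by rintro rfl; exact hm (dvd_zero p))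
  have htop : μ ^ 2 * (resultant (polyA (par φ)) (polyA₂ (par φ)) e e * parC (par φ)) =
      resultant (polyA (par ψ)) (polyA₂ (par ψ)) e e * parC (par ψ) := by
    have := congrArg (fun F ↦ F.coeff (q * m)) hW
    simpa only [coeff_top_C_mul_X_pow_sub_pow _ _ _ _ hq] using this
  -- Once the leading coefficients of W agree, S is read off the coefficient -mS of z^{q(m-1)},
  -- using p ∤ m.
  have hS : parS (par φ) = parS (par ψ) := by
    rw [htop] at hW
    have h1 := mul_left_cancel₀ (C_ne_zero.mpr hc') hW
    have h2 := congrArg (fun F ↦ F.coeff (q * (m - 1))) h1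
    have h3 := fun S : L ↦ coeff_C_mul_X_pow_sub_C_pow hq (1 : L) S m (q * (m - 1))
    simp only [C_1, one_mul] at h3
    simp only [h3] at h2
    rw [if_pos (Dvd.intro _ rfl), if_pos (Dvd.intro _ rfl), Nat.mul_div_cancel_left _ hq,
      Nat.sub_sub_self hm0, Nat.choose_symm hm0, Nat.choose_one_right, pow_one, pow_one] at h2
    have h4 : (m : L) ≠ 0 := (isUnit_natCast_of_algebra (B := L) hm).ne_zero
    have h5 := mul_left_cancel₀ (by simpa using h4) h2
    exact neg_injective h5
  have hn := N.map_univNum_add he φ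
  have hn' := N.map_univNum_add he ψ
  rw [hnum, hden, ← hβ] at hn'
  have hd := N.map_univDen he φ
  have hd' := N.map_univDen he ψ
  rw [hden] at hd'
  rw [← hS, ← hα] at hn' hd'
  have hne : critPoly (N.u (parS (par φ)) (parα (par φ))) (N.v (parS (par φ)) (parα (par φ))) ≠ 0 := by
    intro h0
    have := N.crit_eq (parS (par φ)) (parα (par φ))
    rw [h0, mul_zero] at this
    exact pow_ne_zero m (monic_X_pow_sub_C (parS (par φ)) hq.ne').ne_zero this.symm
  have hvne : N.v (parS (par φ)) (parα (par φ)) ≠ 0 := fun h0 ↦ hne (by rw [h0]; simp [critPoly])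
  -- u and v are independent over the polynomials in z^p because W(u, v) ≠ 0: differentiating a
  -- relation treats its coefficients as constants, and eliminating v isolates one of them.
  have huniq : ∀ A B A' B' : L[X], expand L p A * N.u (parS (par φ)) (parα (par φ)) +
      expand L p B * N.v (parS (par φ)) (parα (par φ)) =
      expand L p A' * N.u (parS (par φ)) (parα (par φ)) +
      expand L p B' * N.v (parS (par φ)) (parα (par φ)) → A = A' ∧ B = B' := by
    intro A B A' B' h
    generalize N.u (parS (par φ)) (parα (par φ)) = u at *
    generalize N.v (parS (par φ)) (parα (par φ)) = v at *
    have h1 : expand L p (A - A') * u + expand L p (B - B') * v = 0 := by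
      rw [map_sub, map_sub]; linear_combination h
    have h2 := congrArg derivative h1
    simp only [derivative_add, derivative_mul, derivative_expand_of_algebra, zero_mul, zero_add,
      derivative_zero] at h2
    have h3 : expand L p (A - A') * critPoly u v = 0 := by
      rw [critPoly]; linear_combination v * h2 - derivative v * h1
    have h4 := (mul_eq_zero.mp h3).resolve_right hne
    rw [h4, zero_mul, zero_add] at h1
    have h5 := (mul_eq_zero.mp h1).resolve_right hvne
    have hp := (Fact.out : p.Prime).pos
    exact ⟨sub_eq_zero.mp ((expand_eq_zero hp).mp h4), sub_eq_zero.mp ((expand_eq_zero hp).mp h5)⟩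
  have hexp : ∀ F : L[X], C μ * expand L p F = expand L p (C μ * F) := fun F ↦ by
    rw [map_mul, expand_C]
  obtain ⟨a1, b1⟩ := huniq _ _ (C μ * polyA (par φ))
    (C μ * ((N.univB₁ he).map φ + C (parLam (par φ)) * polyA (par φ))) (by
      rw [← hn', ← hexp, ← hexp]; linear_combination (C μ) * hn)
  obtain ⟨a2, b2⟩ := huniq _ _ (C μ * polyA₂ (par φ))
    (C μ * ((N.univB₂ he).map φ + C (parLam (par φ)) * polyA₂ (par φ))) (by
      rw [← hd', ← hexp, ← hexp]; linear_combination (C μ) * hd)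
  -- Both A's are monic, so the scaling factor is trivial.
  have hμ1 : μ = 1 := by
    have h1 := polyA_monic (par φ)
    have h2 := polyA_monic (par ψ)
    have h3 := congrArg leadingCoeff a1
    rw [leadingCoeff_mul, leadingCoeff_C, h1, h2] at h3
    simpa using h3.symm
  rw [hμ1, C_1, one_mul] at a1 a2 b1 b2
  -- As deg B₁ < e and A is monic, λ is the coefficient of B₁ + λA in degree e.
  have hlam : parLam (par ψ) = parLam (par φ) := by
    have h0 : ∀ χ : ParamRing p e ε →+* L, ((N.univB₁ he).map χ + C (parLam (par χ)) *
        polyA (par χ)).coeff e = parLam (par χ) := by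
      intro χ
      have h2 := polyA_monic (par χ)
      rw [Monic, leadingCoeff, natDegree_polyA] at h2
      rw [coeff_add, coeff_C_mul, h2, coeff_eq_zero_of_degree_lt (N.degree_map_univB₁_lt he χ),
        zero_add, mul_one]
    rw [← h0 ψ, ← h0 φ, b1]
  rw [hμ1, one_pow, one_mul, a1, a2] at htop
  have hC := mul_left_cancel₀ hr htop
  funext i
  rcases i with ((i | i) | (i | i)) | i
  · have h1 := coeff_polyA (par φ) i
    rw [← a1, coeff_polyA] at h1
    exact h1.symm
  · have h1 := coeff_polyA₂ (par φ) i
    rw [← a2, coeff_polyA₂] at h1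
    exact h1.symm
  · fin_cases i
    · exact hC
    · exact hS
  · obtain rfl : ε = 1 := by have := i.2; omega
    have h1 : ∀ χ : ParamRing p e 1 →+* L, parLam (par χ) = par χ (.inl (.inr (.inr i))) :=
      fun χ ↦ by
        rw [parLam, Fin.sum_univ_one, Subsingleton.elim i 0]
    rw [← h1, ← h1, hlam]
  · fin_cases i
    · exact hα
    · exact hβ

end NormalForm

end Universal

end Unicritical
end

noncomputable section

namespace Unicritical

/-! ### The three normal forms, and an explicit function in each degree -/

section Instances

open Polynomial

lemma natDegree_X_pow_sub_C_pow_le {R : Type} [CommRing R] (S : R) (q m : ℕ) :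
    ((X ^ q - C S) ^ m).natDegree ≤ m * q := by
  nontriviality R
  exact natDegree_pow_le.trans (Nat.mul_le_mul_left m natDegree_X_pow_sub_C.le)

lemma natDegree_expand_mul_le {p : ℕ} {R : Type} [CommRing R] {A v : R[X]} {a b d : ℕ}
    (hA : A.natDegree ≤ a) (hv : v.natDegree ≤ b) (h : a * p + b ≤ d) :
    (expand R p A * v).natDegree ≤ d := by
  refine natDegree_mul_le.trans ((Nat.add_le_add ?_ hv).trans h)
  rw [natDegree_expand]
  exact Nat.mul_le_mul_right p hA

lemma pred_mul_add_le {p e : ℕ} (he : 0 < e) {b : ℕ} (hb : b ≤ p) :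
    (e - 1 + 0) * p + b ≤ p * e := by
  obtain ⟨n, rfl⟩ : ∃ n, e = n + 1 := ⟨e - 1, by omega⟩
  rw [Nat.add_sub_cancel, add_zero, mul_add, mul_one, mul_comm]
  omega

variable {p : ℕ} [Fact p.Prime]

/-- The normal form in degree `d = p e + 1`. -/
def normalFormOfDvdSubOne {d e k m : ℕ} (he : 0 < e) (hd : d = p * e + 1)
    (hqm : p ^ (k + 1) * m = 2 * d - 2) : NormalForm p d e 1 (p ^ (k + 1)) m where
  u _ _ := X
  v _ α := 1 - C α * X
  τ S _ := (X ^ p ^ k - C S) ^ m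
  map_u _ _ _ := by simp
  map_v _ _ _ := by simp
  map_τ _ _ _ := by simp
  crit_eq {R} _ _ S α := by
    have h := expand_X_pow_sub_pow p (1 : R) S k m
    rw [C_1, one_mul, one_mul] at h
    rw [h, critPoly]
    simp
  natDegree_τ_le S _ := by
    refine (natDegree_X_pow_sub_C_pow_le S _ m).trans ?_
    have h1 : p * (m * p ^ k) = p * (2 * e) := by
      have : p * (2 * e) = 2 * d - 2 := by rw [hd]; ring_nf; omega
      rw [this, ← hqm]; ring
    have := Nat.eq_of_mul_eq_mul_left (Fact.out : p.Prime).pos h1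
    omega
  natDegree_le {R} _ S α A B hA hB := by
    refine natDegree_add_le_of_degree_le
      (natDegree_expand_mul_le hA natDegree_X_le (by rw [hd, mul_comm]))
      (natDegree_expand_mul_le hB (b := 1) ?_ ?_)
    · exact (natDegree_sub_le _ _).trans (max_le (by simp) ((natDegree_C_mul_le _ _).trans natDegree_X_le))
    · rw [hd, Nat.sub_add_cancel he, mul_comm]
  exists_decomp {B} _ _ _ f g h := by
    rw [Nat.sub_add_cancel he]
    exact h.exists_isDecomp_of_dvd_sub_one hd hqm

/-- The normal form in characteristic two and degree `d = 2 e`. -/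
def normalFormOfTwoDvd {d e k m : ℕ} (hp2 : p = 2) (he : 0 < e) (hd : d = p * e)
    (hqm : p ^ (k + 1) * m = 2 * d - 2) : NormalForm p d e 0 (p ^ (k + 1)) m where
  u _ _ := 1
  v _ α := X - C α
  τ S _ := (X ^ p ^ k - C S) ^ m
  map_u _ _ _ := by simp
  map_v _ _ _ := by simp
  map_τ _ _ _ := by simp
  crit_eq {R} _ _ S α := by
    have h := expand_X_pow_sub_pow p (1 : R) S k m
    rw [C_1, one_mul, one_mul] at h
    have h2 : (2 : R) = 0 := by exact_mod_cast natCast_eq_zero_of_algebra (B := R) (p := p) (n := 2) (by rw [hp2])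
    have h3 : (-1 : R) = 1 := by linear_combination -h2
    have h4 : critPoly (1 : R[X]) (X - C α) = 1 := by
      rw [critPoly]
      simp only [derivative_one, zero_mul, derivative_sub, derivative_X, derivative_C, sub_zero,
        mul_one, zero_sub]
      rw [← C_1, ← C_neg, h3]
    rw [h, h4, mul_one]
  natDegree_τ_le S _ := by
    refine (natDegree_X_pow_sub_C_pow_le S _ m).trans ?_
    have h1 : 2 * (m * p ^ k) = 2 * (2 * e - 1) := by
      have : 2 * (2 * e - 1) = 2 * d - 2 := by rw [hd, hp2]; omega
      rw [this, ← hqm, pow_succ]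
      nth_rewrite 3 [hp2]
      ring
    omega
  natDegree_le {R} _ S α A B hA hB := by
    refine natDegree_add_le_of_degree_le
      (natDegree_expand_mul_le hA natDegree_one.le (by rw [hd, mul_comm, add_zero]))
      (natDegree_expand_mul_le hB (natDegree_X_sub_C_le _) ?_)
    rw [hd]
    exact pred_mul_add_le he (Fact.out : p.Prime).one_lt.le
  exists_decomp {B} _ _ _ f g h := h.exists_isDecomp_of_two_dvd hp2 hd he

/-- The normal form in odd characteristic and degree `d = p e`. -/
def normalFormOfOddDvd {d e : ℕ} (hp2 : p ≠ 2) (he : 0 < e) (hd : d = p * e) :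
    NormalForm p d e 0 1 (2 * d - 2) where
  u _ _ := 1
  v S _ := (X - C S) ^ (p - 1)
  τ S _ := (X - C (S ^ p)) ^ (2 * e - 1)
  map_u _ _ _ := by simp
  map_v _ _ _ := by simp
  map_τ _ _ _ := by simp
  crit_eq {R} _ _ S α := by
    have hp := (Fact.out : p.Prime)
    have hp3 : 2 < p := lt_of_le_of_ne hp.two_le hp2.symm
    have h1 : expand R p ((X - C (S ^ p)) ^ (2 * e - 1)) = (X - C S) ^ (p * (2 * e - 1)) := by
      have := sub_pow_pow_of_algebra (p := p) 1 (X : R[X]) (C S)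
      rw [pow_one] at this
      rw [pow_mul, this]
      simp
    have h0 : (p : R) = 0 := natCast_eq_zero_of_algebra (dvd_refl p)
    have h2 : critPoly (1 : R[X]) ((X - C S) ^ (p - 1)) = (X - C S) ^ (p - 2) := by
      have h3 : ((p - 1 : ℕ) : R) = -1 := by
        rw [Nat.cast_sub hp.one_lt.le, h0]; simp
      rw [critPoly, derivative_X_sub_C_pow, h3, Nat.sub_sub]
      simp
    rw [h1, h2, ← pow_add, pow_one]
    congr 1
    obtain ⟨n, rfl⟩ : ∃ n, e = n + 1 := ⟨e - 1, by omega⟩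
    rw [hd, show 2 * (n + 1) - 1 = 2 * n + 1 by omega]
    zify [hp.two_le, show 2 ≤ 2 * (p * (n + 1)) by nlinarith]
    ring
  natDegree_τ_le S _ := by
    refine natDegree_pow_le.trans ((Nat.mul_le_mul_left _ (natDegree_X_sub_C_le _)).trans ?_)
    omega
  natDegree_le {R} _ S α A B hA hB := by
    refine natDegree_add_le_of_degree_le
      (natDegree_expand_mul_le hA natDegree_one.le (by rw [hd, mul_comm, add_zero]))
      (natDegree_expand_mul_le hB (b := p - 1) (natDegree_pow_le.trans
        ((Nat.mul_le_mul_left _ (natDegree_X_sub_C_le _)).trans (by rw [mul_one]))) ?_)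
    rw [hd]
    exact pred_mul_add_le he (Nat.sub_le p 1)
  exists_decomp {B} _ _ _ f g h := by
    obtain ⟨S, c, A, B₁, A₂, B₂, hc, D⟩ := h.exists_isDecomp_of_odd_dvd hp2 hd he
    exact ⟨S, 0, c, A, B₁, A₂, B₂, .inl rfl, hc, D⟩

/-- A unicritical function of degree `p e`. -/
lemma exists_isUnicrit_of_dvd {d e q m : ℕ} (he : 0 < e) (hd : d = p * e)
    (hqm : q * m = 2 * d - 2) : ∃ f g : (ZMod p)[X], IsUnicrit d q m f g := by
  have hp := (Fact.out : p.Prime)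
  have hd2 : 2 ≤ d := by rw [hd]; nlinarith [hp.two_le]
  have h0 : ((d : ℕ) : ZMod p) = 0 := (ZMod.natCast_eq_zero_iff _ _).mpr (Dvd.intro _ hd.symm)
  -- Here f' = 0 and g' = -z^{d-2}, so W = z^{2d-2}; thus c = 1 and S = 0.
  refine ⟨X ^ d, 1 + X ^ (d - 1), ⟨?_, ?_, ?_⟩, 1, 0, isUnit_one, ?_⟩
  · simp
  · exact natDegree_add_le_of_degree_le (by simp) (by simp)
  · refine isUnit_resultant_of_no_common_root (by simp)
      (natDegree_add_le_of_degree_le (by simp) (by simp)) (.inl (by simp)) fun z hz h ↦ ?_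
    rw [eval₂_X_pow] at hz
    rw [eval₂_add, eval₂_one, eval₂_X_pow, eq_zero_of_pow_eq_zero hz,
      zero_pow (by omega), add_zero] at h
    exact one_ne_zero h
  · rw [critPoly]
    have h1 : ((d - 1 : ℕ) : ZMod p) = -1 := by rw [Nat.cast_sub (by omega), h0]; simp
    simp only [derivative_X_pow, derivative_add, derivative_one, h0, h1]
    simp only [map_zero, zero_mul, zero_add, sub_zero, ← pow_mul, hqm, zero_sub]
    simp only [map_neg, map_one, neg_mul, one_mul, mul_neg, neg_neg, ← pow_add]
    congr 1
    omega

/-- A unicritical function of degree `p e + 1`. -/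
lemma exists_isUnicrit_of_dvd_sub_one {d e q m : ℕ} (he : 0 < e) (hd : d = p * e + 1)
    (hqm : q * m = 2 * d - 2) : ∃ f g : (ZMod p)[X], IsUnicrit d q m f g := by
  have hp := (Fact.out : p.Prime)
  obtain ⟨n, hn⟩ : ∃ n, n = p * e := ⟨_, rfl⟩
  have h0 : ((n : ℕ) : ZMod p) = 0 := (ZMod.natCast_eq_zero_iff _ _).mpr (Dvd.intro _ hn.symm)
  have hn0 : 0 < n := by rw [hn]; exact mul_pos hp.pos he
  rw [← hn] at hd
  subst hd
  have hf : (1 + X + X ^ (n + 1) : (ZMod p)[X]).natDegree ≤ n + 1 :=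
    natDegree_add_le_of_degree_le (natDegree_add_le_of_degree_le (by simp)
      (natDegree_X_le.trans (by omega))) (by simp)
  have hg : (X ^ n * (1 + X) : (ZMod p)[X]).natDegree ≤ n + 1 :=
    natDegree_mul_le.trans (Nat.add_le_add (by simp)
      (natDegree_add_le_of_degree_le (by simp) natDegree_X_le))
  -- With p ∣ n one has f' = 1 + z^n and g' = z^n, so W = z^n((1 + z^n)(1 + z) - (1 + z + z^{n+1}))
  -- = z^{2n}, again with c = 1 and S = 0.
  refine ⟨1 + X + X ^ (n + 1), X ^ n * (1 + X), ⟨?_, ?_, ?_⟩, 1, 0, isUnit_one, ?_⟩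
  · exact hf
  · exact hg
  · refine isUnit_resultant_of_no_common_root hf hg (.inl ?_) fun z hz h ↦ ?_
    · rw [coeff_add, coeff_X_pow_self, coeff_add, coeff_X, coeff_one, if_neg (by omega),
        if_neg (by omega), add_zero, zero_add]
      exact isUnit_one
    · simp only [eval₂_add, eval₂_mul, eval₂_one, eval₂_X, eval₂_X_pow] at hz h
      rcases mul_eq_zero.mp h with h | h
      · have := eq_zero_of_pow_eq_zero h
        subst this
        simp at hz
      · rw [h, zero_add] at hz
        rw [eq_zero_of_pow_eq_zero hz, add_zero] at h
        exact one_ne_zero h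
  · rw [critPoly]
    simp only [derivative_X_pow, derivative_add, derivative_one, derivative_mul, derivative_X, h0,
      Nat.cast_add, Nat.cast_one]
    simp only [map_zero, zero_mul, zero_add, sub_zero, ← pow_mul, hqm, map_one,
      Nat.add_sub_cancel, mul_one, one_mul]
    rw [show 2 * (n + 1) - 2 = n + n by omega, pow_add, pow_succ]
    ring

end Instances

end Unicritical
end

/-! ### Points of U_d with prescribed parameters, in both charts -/

noncomputable section

namespace Unicritical

/-- Over a field, homogeneous coordinates are unique up to scaling. -/
lemma exists_eq_smul_of_pt_eq {L σ R : Type} [Field L] [CommRing R] [Algebra R L]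
    {h : MvPolynomial σ R} {d : ℕ} (hd : h ∈ grading R σ d) (hd0 : 0 < d) {v w : σ → L}
    (hv : IsUnit (MvPolynomial.aeval v h)) (hw : IsUnit (MvPolynomial.aeval w h))
    (e : pt h hd hd0 v hv = pt h hd hd0 w hw) {i : σ} (hi : v i ≠ 0) :
    ∃ μ : L, w = μ • v := by
  let c : Spec (.of L) := IsLocalRing.closedPoint L
  have hX : ∀ u : σ → L, MvPolynomial.aeval u (MvPolynomial.X i : MvPolynomial σ R) = u i :=
    fun u ↦ MvPolynomial.aeval_X u i
  have hvi : IsUnit (MvPolynomial.aeval v (MvPolynomial.X i : MvPolynomial σ R)) := by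
    rw [hX]; exact isUnit_iff_ne_zero.mpr hi
  have hwi : IsUnit (MvPolynomial.aeval w (MvPolynomial.X i : MvPolynomial σ R)) := by
    have h1 := (pt_mem_basicOpen hd hd0 v hv (X_mem i) one_pos c).mpr fun h0 ↦
      c.isPrime.ne_top (Ideal.eq_top_of_isUnit_mem _ h0 hvi)
    rw [e, pt_mem_basicOpen hd hd0 w hw (X_mem i) one_pos c] at h1
    exact isUnit_iff_ne_zero.mpr fun h0 ↦ h1 (h0 ▸ zero_mem _)
  rw [pt_eq_pt hd hd0 (X_mem i) one_pos v hv hvi, pt_eq_pt hd hd0 (X_mem i) one_pos w hw hwi,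
    pt, pt, cancel_mono] at e
  have e2 := congrArg CommRingCat.Hom.hom (Spec.map_injective e)
  rw [CommRingCat.hom_ofHom, CommRingCat.hom_ofHom] at e2
  refine ⟨w i * (v i)⁻¹, funext fun j ↦ ?_⟩
  have hj : (MvPolynomial.X j : MvPolynomial σ R) ∈ grading R σ (1 • 1) := X_mem j
  have h1 := evalAway_mk _ v hvi (X_mem i) 1 _ hj
  have h2 := evalAway_mk _ w hwi (X_mem i) 1 _ hj
  rw [e2] at h1
  simp only [pow_one, MvPolynomial.aeval_X] at h1 h2
  rw [← h2, Pi.smul_apply, smul_eq_mul, ← h1]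
  field_simp

section Lifts

open Polynomial

/-- Reverse the coefficients if `r` is true. -/
def rev {B : Type} [CommRing B] (r : Bool) (d : ℕ) (f : B[X]) : B[X] :=
  bif r then f.reflect d else f

variable {B B' : Type} [CommRing B] [CommRing B']

lemma rev_C_mul (r : Bool) (d : ℕ) (c : B) (f : B[X]) : rev r d (C c * f) = C c * rev r d f := by
  cases r
  · rfl
  · exact reflect_C_mul f c d

lemma rev_map (r : Bool) (d : ℕ) (φ : B →+* B') (f : B[X]) :
    rev r d (f.map φ) = (rev r d f).map φ := by
  cases r
  · rfl
  · exact reflect_map φ f d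

lemma rev_rev (r : Bool) (d : ℕ) (f : B[X]) : rev r d (rev r d f) = f := by
  cases r
  · rfl
  · exact reflect_reflect

lemma rev_injective (r : Bool) (d : ℕ) : Function.Injective (rev (B := B) r d) :=
  Function.LeftInverse.injective (g := rev r d) (rev_rev r d)

lemma IsRat.rev {d : ℕ} {f g : B[X]} (h : IsRat d f g) (r : Bool) :
    IsRat d (rev r d f) (rev r d g) := by
  cases r
  · exact h
  · exact h.reflect

lemma reflect_pow_mul {f : B[X]} {q : ℕ} (hf : f.natDegree ≤ q) (m : ℕ) :
    reflect (q * m) (f ^ m) = reflect q f ^ m := by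
  induction m with
  | zero => simp
  | succ m ih =>
    rw [pow_succ, mul_add, mul_one, reflect_mul _ _ _ hf, ih, pow_succ]
    exact natDegree_pow_le.trans (by rw [mul_comm]; exact Nat.mul_le_mul_right m hf)

/-- A unicritical function with invertible critical value is also unicritical in the other
chart. -/
lemma IsRat.isUnicrit_reflect {d q m : ℕ} (hd : 0 < d) (hqm : q * m = 2 * d - 2) {f g : B[X]}
    (h : IsRat d f g) {c S : B} (hc : IsUnit c) (hS : IsUnit S)
    (heq : critPoly f g = C c * (X ^ q - C S) ^ m) :
    IsUnicrit d q m (f.reflect d) (g.reflect d) := by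
  obtain ⟨s, rfl⟩ := hS
  -- Reversing z^q - S gives 1 - S z^q = -S(z^q - S⁻¹), so the critical datum becomes S⁻¹.
  have h1 : Polynomial.reflect q (X ^ q - C (s : B)) = C (-(s : B)) * (X ^ q - C (↑s⁻¹ : B)) := by
    rw [reflect_sub, reflect_C, reflect_monomial, revAt_le le_rfl, Nat.sub_self, mul_sub, ← Polynomial.C_mul,
      neg_mul, Units.mul_inv]
    simp only [pow_zero, C_neg, C_1]
    ring
  refine ⟨h.reflect, -c * (-(s : B)) ^ m, (↑s⁻¹ : B), hc.neg.mul (s.isUnit.neg.pow m), ?_⟩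
  rw [critPoly_reflect hd h.left_le h.right_le, heq, reflect_C_mul, ← hqm, reflect_pow_mul, h1,
    mul_pow]
  · simp only [C_neg, Polynomial.C_mul, C_pow]
    ring
  · nontriviality B
    exact natDegree_X_pow_sub_C.le

variable {p : ℕ} [Fact p.Prime] {d : ℕ}

/-- A closed immersion followed by an open one. Morphisms into the fibre product can thus be
compared through their coordinates in ℙ^{2d+1}. -/
instance mono_toProjSpace (hd : 1 < d) : Mono (unicriticalLocus.toProjSpace p d hd) := by
  have : Mono (curveι p d hd) := inferInstance
  exact mono_comp' (inferInstanceAs (Mono (pullback.fst (omega p d hd) (curveι p d hd))))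
    (inferInstanceAs (Mono (sepLocus p d).ι))

lemma IsRat.exists_eq_C_mul_of_pt_eq (hd : 1 < d) {L : Type} [Field L] [Algebra (ZMod p) L]
    {f g f₂ g₂ : L[X]} (h : IsRat d f g) (h₂ : IsRat d f₂ g₂) (e : h.pt p hd = h₂.pt p hd) :
    ∃ μ : L, f₂ = C μ * f ∧ g₂ = C μ * g := by
  obtain ⟨i, hi⟩ : ∃ i, coeffVec d f g i ≠ 0 := by
    by_contra! hcon
    have h0 : coeffVec d f g = coeffVec d 0 0 := by
      rw [funext hcon]; ext (i | i) <;> simp [coeffVec]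
    obtain ⟨rfl, rfl⟩ := coeffVec_injective h.1 h.2 (by simp) (by simp) h0
    obtain ⟨a, b, hab⟩ := h.isCoprime (by omega)
    simp at hab
  obtain ⟨μ, hμ⟩ := exists_eq_smul_of_pt_eq _ _ _ _ e hi
  rw [← coeffVec_C_mul] at hμ
  exact ⟨μ, coeffVec_injective h₂.1 h₂.2 ((natDegree_C_mul_le _ _).trans h.1)
    ((natDegree_C_mul_le _ _).trans h.2) hμ⟩

variable [Algebra (ZMod p) B] [Algebra (ZMod p) B']

theorem IsUnicrit.exists_lift_rev {k m : ℕ} (hd : 1 < d) (hqm : p ^ k * m = 2 * d - 2)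
    {f g : B[X]} (h : IsUnicrit d (p ^ k) m f g) (r : Bool) :
    ∃ y : Spec (.of B) ⟶ unicriticalLocus p d hd,
      y ≫ unicriticalLocus.toProjSpace p d hd = (h.toIsRat.rev r).pt p hd := by
  cases r
  · exact h.exists_lift hd hqm
  · exact h.exists_lift_reflect hd hqm

namespace NormalForm

variable {e ε k m : ℕ} (N : NormalForm p d e ε (p ^ k) m) (he : 0 < e) (hd : 1 < d)
  (hqm : p ^ k * m = 2 * d - 2)

/-- The point of the unicritical locus with given parameters. -/
def lift (r : Bool) (χ : ParamRing p e ε →+* B) (hu : IsUnit (χ (N.univLoc he))) :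
    Spec (.of B) ⟶ unicriticalLocus p d hd :=
  ((N.isUnicrit_map_univ he χ hu).exists_lift_rev hd hqm r).choose

lemma lift_toProjSpace (r : Bool) (χ : ParamRing p e ε →+* B) (hu : IsUnit (χ (N.univLoc he))) :
    N.lift he hd hqm r χ hu ≫ unicriticalLocus.toProjSpace p d hd =
      ((N.isUnicrit_map_univ he χ hu).toIsRat.rev r).pt p hd :=
  ((N.isUnicrit_map_univ he χ hu).exists_lift_rev hd hqm r).choose_spec

lemma lift_toSpec (r : Bool) (χ : ParamRing p e ε →+* B) (hu : IsUnit (χ (N.univLoc he))) :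
    N.lift he hd hqm r χ hu ≫ unicriticalLocus.toSpec p d hd =
      Spec.map (CommRingCat.ofHom (algebraMap (ZMod p) B)) := by
  rw [unicriticalLocus.toSpec, ← Category.assoc, lift_toProjSpace, IsRat.pt, pt_toSpec]

/-- `lift` is a choice, but a unique one since U_d → ℙ^{2d+1} is a monomorphism, so it commutes with
base change. Every ring map between 𝔽_p-algebras is 𝔽_p-linear, so φ may be arbitrary. -/
lemma map_comp_lift (r : Bool) (χ : ParamRing p e ε →+* B) (hu : IsUnit (χ (N.univLoc he)))
    (φ : B →+* B') : Spec.map (CommRingCat.ofHom φ) ≫ N.lift he hd hqm r χ hu =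
      N.lift he hd hqm r (φ.comp χ) (hu.map φ) := by
  rw [← cancel_mono (unicriticalLocus.toProjSpace p d hd), Category.assoc, lift_toProjSpace,
    lift_toProjSpace]
  let ψ : B →ₐ[ZMod p] B' := { φ with
    commutes' := fun a ↦ RingHom.congr_fun (Subsingleton.elim (φ.comp (algebraMap (ZMod p) B)) _) a }
  refine IsRat.map_comp_pt hd _ ψ ?_ ?_ _
  · rw [← Polynomial.map_map, rev_map]
  · rw [← Polynomial.map_map, rev_map]

lemma lift_congr {r r' : Bool} {χ χ' : ParamRing p e ε →+* B} {hu : IsUnit (χ (N.univLoc he))}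
    {hu' : IsUnit (χ' (N.univLoc he))} (μ : B) (hμ : IsUnit μ)
    (hf : rev r' d ((N.univNum he).map χ') = C μ * rev r d ((N.univNum he).map χ))
    (hg : rev r' d ((N.univDen he).map χ') = C μ * rev r d ((N.univDen he).map χ)) :
    N.lift he hd hqm r' χ' hu' = N.lift he hd hqm r χ hu := by
  rw [← cancel_mono (unicriticalLocus.toProjSpace p d hd), lift_toProjSpace, lift_toProjSpace]
  exact IsRat.pt_C_mul hd _ _ μ hμ hf hg

/-- The parametrization is surjective on local-ring points: the unit end coefficient of W selects
the chart, and `exists_specialization` supplies the parameters. -/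
theorem exists_eq_lift (hm : ¬ p ∣ m) (hε : ε ≤ 1) [IsLocalRing B]
    (x : Spec (.of B) ⟶ unicriticalLocus p d hd) :
    ∃ (r : Bool) (χ : ParamRing p e ε →+* B) (hu : IsUnit (χ (N.univLoc he))),
      (parα (par χ) = 0 ∨ parα (par χ) = 1) ∧ (parβ (par χ) = 0 ∨ parβ (par χ) = 1) ∧
      x = N.lift he hd hqm r χ hu := by
  obtain ⟨f, g, h, hx, hW, h1, h2⟩ := exists_isRat_of_point hd hqm hm x
  obtain ⟨r, hr⟩ : ∃ r : Bool, IsUnicrit d (p ^ k) m (rev r d f) (rev r d g) := by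
    rcases hW with hW | hW
    · exact ⟨false, h1 hW⟩
    · exact ⟨true, h2 hW⟩
  obtain ⟨χ, μ, hμ, hu, hf, hg, hα, hβ⟩ := N.exists_specialization he hε hr
  refine ⟨r, χ, hu, hα, hβ, ?_⟩
  rw [← cancel_mono (unicriticalLocus.toProjSpace p d hd), lift_toProjSpace, hx]
  refine IsRat.pt_C_mul hd _ _ μ hμ ?_ ?_
  · rw [← rev_C_mul, ← hf, rev_rev]
  · rw [← rev_C_mul, ← hg, rev_rev]

/-- A point with invertible critical value is in both charts. -/
theorem exists_lift_eq_lift_not [IsLocalRing B] (hε : ε ≤ 1) (r : Bool)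
    (χ : ParamRing p e ε →+* B) (hu : IsUnit (χ (N.univLoc he))) (hS : IsUnit (parS (par χ))) :
    ∃ (χ' : ParamRing p e ε →+* B) (hu' : IsUnit (χ' (N.univLoc he))),
      N.lift he hd hqm (!r) χ hu = N.lift he hd hqm r χ' hu' := by
  have h := N.isUnicrit_map_univ he χ hu
  have hu2 := hu
  rw [map_univLoc] at hu2
  obtain ⟨χ', μ, hμ, hu', hf, hg, -, -⟩ := N.exists_specialization he hε
    (h.toIsRat.isUnicrit_reflect (by omega) hqm (isUnit_of_mul_isUnit_right hu2) hS
      (N.critPoly_map_univ he χ))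
  refine ⟨χ', hu', N.lift_congr he hd hqm μ hμ ?_ ?_⟩
  · rw [← rev_C_mul, ← hf]
    cases r
    · rfl
    · exact reflect_reflect.symm
  · rw [← rev_C_mul, ← hg]
    cases r
    · rfl
    · exact reflect_reflect.symm

/-- A point over a field determines its parameters, once `α` and `β` are fixed. -/
theorem lift_injective (hm : ¬ p ∣ m) (hε : ε ≤ 1) {L : Type} [Field L] [Algebra (ZMod p) L]
    (r : Bool) {χ χ' : ParamRing p e ε →+* L} (hu : IsUnit (χ (N.univLoc he)))
    (hu' : IsUnit (χ' (N.univLoc he))) (hα : parα (par χ) = parα (par χ'))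
    (hβ : parβ (par χ) = parβ (par χ'))
    (h : N.lift he hd hqm r χ hu = N.lift he hd hqm r χ' hu') : χ = χ' := by
  have h1 := congrArg (· ≫ unicriticalLocus.toProjSpace p d hd) h
  simp only [lift_toProjSpace] at h1
  obtain ⟨μ, hf, hg⟩ := IsRat.exists_eq_C_mul_of_pt_eq hd _ _ h1
  rw [← rev_C_mul] at hf hg
  have h2 := N.specialization_unique he (pow_pos (Fact.out : p.Prime).pos k) hm hε hu hu' hα hβ
    (rev_injective r d hf) (rev_injective r d hg)
  exact MvPolynomial.ringHom_ext' (Subsingleton.elim _ _) fun i ↦ congrFun h2 i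

end NormalForm

end Lifts

end Unicritical
end

noncomputable section

namespace Unicritical

/-! ### Dimension of integral schemes of finite type over a field -/

section Dimension

/-- Contraction of primes is strictly monotone by incomparability, surjective by lying over, and
lifts chains by going up; so it preserves coheights. -/
lemma ringKrullDim_eq_of_isIntegral (R S : Type) [CommRing R] [CommRing S] [Algebra R S]
    [Algebra.IsIntegral R S] (hinj : Function.Injective (algebraMap R S)) :
    ringKrullDim S = ringKrullDim R := by
  let f : PrimeSpectrum S → PrimeSpectrum R := PrimeSpectrum.comap (algebraMap R S)
  have hf : StrictMono f := fun P Q h ↦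
    Ideal.IsIntegral.comap_lt_comap (I := P.asIdeal) (J := Q.asIdeal) h
  have hsurj : Function.Surjective f := fun P ↦ by
    obtain ⟨Q, -, hQ, h⟩ := Ideal.exists_ideal_over_prime_of_isIntegral P.asIdeal (⊥ : Ideal S) (by
      rw [← RingHom.ker_eq_comap_bot, (RingHom.injective_iff_ker_eq_bot _).mp hinj]; exact bot_le)
    exact ⟨⟨Q, hQ⟩, PrimeSpectrum.ext h⟩
  have hup : ∀ P Q, f P < Q → ∃ P', P < P' ∧ f P' = Q := fun P Q h ↦ by
    obtain ⟨P', hP, hP', h'⟩ := Ideal.exists_ideal_over_prime_of_isIntegral_of_isPrime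
      (S := S) Q.asIdeal P.asIdeal h.le
    refine ⟨⟨P', hP'⟩, lt_of_le_of_ne hP ?_, PrimeSpectrum.ext h'⟩
    rintro rfl
    exact h.ne (PrimeSpectrum.ext h')
  rw [ringKrullDim, ringKrullDim, Order.krullDim_eq_iSup_coheight, Order.krullDim_eq_iSup_coheight,
    ← hsurj.iSup_comp]
  exact iSup_congr fun P ↦ by rw [Order.coheight_eq_of_strictMono f hf hup]

/-- By Noether normalization both invariants equal the number of variables. Transcendence degree is
easy to follow under localization, and dimension then follows with it. -/
lemma exists_ringKrullDim_eq_and_trdeg_eq (k A : Type) [Field k] [CommRing A] [IsDomain A]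
    [Algebra k A] [Algebra.FiniteType k A] :
    ∃ s : ℕ, ringKrullDim A = s ∧ Algebra.trdeg k A = s := by
  obtain ⟨s, g, hg, hfin⟩ := exists_integral_inj_algHom_of_fg k A
  let _ : Algebra (MvPolynomial (Fin s) k) A := g.toRingHom.toAlgebra
  have hinj : Function.Injective (algebraMap (MvPolynomial (Fin s) k) A) := hg
  have : Algebra.IsIntegral (MvPolynomial (Fin s) k) A := ⟨hfin⟩
  have : IsScalarTower k (MvPolynomial (Fin s) k) A := .of_algHom g
  have : FaithfulSMul (MvPolynomial (Fin s) k) A := (faithfulSMul_iff_algebraMap_injective _ _).mpr hg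
  refine ⟨s, ?_, ?_⟩
  · rw [ringKrullDim_eq_of_isIntegral (MvPolynomial (Fin s) k) A hinj,
      MvPolynomial.ringKrullDim_of_isNoetherianRing, ringKrullDim_eq_zero_of_field]
    simp
  · rw [← trdeg_add_eq k (MvPolynomial (Fin s) k) (A := A), trdeg_eq_zero (R := MvPolynomial (Fin s) k),
      MvPolynomial.trdeg_of_isDomain]
    simp

/-- Inverting a nonzero element of a domain of finite type over a field does not change the
dimension. -/
lemma ringKrullDim_eq_of_away (k A B : Type) [Field k] [CommRing A] [IsDomain A]
    [Algebra k A] [Algebra.FiniteType k A] [CommRing B] [Algebra A B] (f : A) (hf : f ≠ 0)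
    [IsLocalization.Away f B] : ringKrullDim B = ringKrullDim A := by
  have hM : Submonoid.powers f ≤ nonZeroDivisors A :=
    powers_le_nonZeroDivisors_of_noZeroDivisors hf
  have : IsDomain B := IsLocalization.isDomain_of_le_nonZeroDivisors B hM
  have hinj := IsLocalization.injective B hM
  let _ : Algebra k B := ((algebraMap A B).comp (algebraMap k A)).toAlgebra
  have : IsScalarTower k A B := .of_algebraMap_eq fun _ ↦ rfl
  have : FaithfulSMul A B := (faithfulSMul_iff_algebraMap_injective _ _).mpr hinj
  have : Algebra.IsAlgebraic A B := IsLocalization.isAlgebraic B (Submonoid.powers f)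
  have : Algebra.FiniteType A B := IsLocalization.finiteType_of_monoid_fg (Submonoid.powers f) B
  have : Algebra.FiniteType k B := .trans (S := A) inferInstance inferInstance
  obtain ⟨s, hs, hs'⟩ := exists_ringKrullDim_eq_and_trdeg_eq k A
  obtain ⟨t, ht, ht'⟩ := exists_ringKrullDim_eq_and_trdeg_eq k B
  have h := trdeg_add_eq k A (A := B)
  rw [trdeg_eq_zero (R := A), add_zero, hs', ht'] at h
  rw [hs, ht, Nat.cast_injective h]

/-- The coheight of an irreducible closed set is unchanged on restriction to an open set meeting it,
so dimension is computed locally. -/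
lemma topologicalKrullDim_le_of_forall_exists {X : Type} [TopologicalSpace X] {N : WithBot ℕ∞}
    (h : ∀ x : X, ∃ U : TopologicalSpace.Opens X, x ∈ U ∧ topologicalKrullDim U ≤ N) :
    topologicalKrullDim X ≤ N := by
  rw [topologicalKrullDim, Order.krullDim_eq_iSup_coheight, iSup_le_iff]
  intro Z
  obtain ⟨x, hx⟩ := Z.2.nonempty
  obtain ⟨U, hU, hN⟩ := h x
  have hemb := U.isOpen.isOpenEmbedding_subtypeVal
  let V : {V : TopologicalSpace.IrreducibleCloseds X | ((↑) ⁻¹' (V : Set X) : Set U).Nonempty} :=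
    ⟨Z, ⟨x, hU⟩, hx⟩
  have h1 := (TopologicalSpace.IrreducibleCloseds.orderIsoOfIsOpenEmbedding _ hemb).apply_symm_apply V
  have h2 := congrArg Subtype.val h1
  have h3 := hemb.coheight_map ((TopologicalSpace.IrreducibleCloseds.orderIsoOfIsOpenEmbedding _ hemb).symm V)
  have h4 : Order.coheight Z = _ := (congrArg Order.coheight h2.symm).trans h3
  rw [h4]
  exact (Order.coheight_le_krullDim _).trans hN

variable {X : Scheme.{0}}

lemma topologicalKrullDim_eq_of_isAffineOpen {U : X.Opens} (hU : IsAffineOpen U) :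
    topologicalKrullDim U = ringKrullDim Γ(X, U) := by
  rw [← PrimeSpectrum.topologicalKrullDim_eq_ringKrullDim]
  exact IsHomeomorph.topologicalKrullDim_eq _ (hU.isoSpec.hom.homeomorph).isHomeomorph

variable [IsIntegral X] {k : Type} [Field k]

lemma ringKrullDim_basicOpen_eq (sX : X ⟶ Spec (.of k)) [LocallyOfFiniteType sX] {U : X.Opens} (hU : IsAffineOpen U) (f : Γ(X, U))
    {x : X} (hx : x ∈ X.basicOpen f) : ringKrullDim Γ(X, X.basicOpen f) = ringKrullDim Γ(X, U) := by
  have hxU := X.basicOpen_le f hx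
  have : Nonempty U := ⟨⟨x, hxU⟩⟩
  let φ : CommRingCat.of k ⟶ Γ(X, U) :=
    (Scheme.ΓSpecIso (.of k)).inv ≫ sX.appLE ⊤ U le_top
  have hφ : φ.hom.FiniteType := by
    refine (sX.finiteType_appLE (isAffineOpen_top _) hU le_top).comp ?_
    exact RingHom.FiniteType.of_surjective _
      (ConcreteCategory.bijective_of_isIso (Scheme.ΓSpecIso (.of k)).inv).2
  let _ : Algebra k Γ(X, U) := φ.hom.toAlgebra
  have : Algebra.FiniteType k Γ(X, U) := hφ
  have := hU.isLocalization_basicOpen f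
  refine ringKrullDim_eq_of_away k Γ(X, U) Γ(X, X.basicOpen f) f ?_
  rintro rfl
  simp at hx

/-- All nonempty opens of an integral scheme locally of finite type over a field have the same
dimension. -/
theorem topologicalKrullDim_opens_eq (sX : X ⟶ Spec (.of k)) [LocallyOfFiniteType sX] (V : X.Opens) (hV : (V : Set X).Nonempty) :
    topologicalKrullDim V = topologicalKrullDim X := by
  obtain ⟨x, hx⟩ := hV
  obtain ⟨_, ⟨W : X.Opens, hW, rfl⟩, hxW, hWV⟩ :=
    X.isBasis_affineOpens.exists_subset_of_mem_open hx V.isOpen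
  have h1 : topologicalKrullDim W ≤ topologicalKrullDim V :=
    (Topology.IsEmbedding.inclusion hWV).isInducing.topologicalKrullDim_le
  have h2 : topologicalKrullDim V ≤ topologicalKrullDim X := topologicalKrullDim_subspace_le X V
  have h3 : topologicalKrullDim X ≤ topologicalKrullDim W := by
    -- By irreducibility an affine neighbourhood of y meets W, and the two share a common basic
    -- open, to which both dimensions descend.
    refine topologicalKrullDim_le_of_forall_exists fun y ↦ ?_
    obtain ⟨_, ⟨U : X.Opens, hU, rfl⟩, hyU, -⟩ :=
      X.isBasis_affineOpens.exists_subset_of_mem_open (Set.mem_univ y) isOpen_univ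
    refine ⟨U, hyU, ?_⟩
    obtain ⟨z, hzU, hzW⟩ := nonempty_preirreducible_inter U.isOpen W.isOpen ⟨y, hyU⟩ ⟨x, hxW⟩
    obtain ⟨f, g, hfg, hf⟩ := exists_basicOpen_le_affine_inter hU hW z ⟨hzU, hzW⟩
    have e1 := ringKrullDim_basicOpen_eq sX hU f hf
    have e2 := ringKrullDim_basicOpen_eq sX hW g (hfg ▸ hf)
    rw [hfg] at e1
    exact ((topologicalKrullDim_eq_of_isAffineOpen hU).trans (e1.symm.trans
      (e2.trans (topologicalKrullDim_eq_of_isAffineOpen hW).symm))).le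
  exact le_antisymm h2 (h3.trans h1)

/-- Birational integral schemes locally of finite type over a field have the same dimension. -/
theorem topologicalKrullDim_eq_of_birationalOver {Y : Scheme.{0}} [IsIntegral Y]
    (sX : X ⟶ Spec (.of k)) [LocallyOfFiniteType sX] (sY : Y ⟶ Spec (.of k)) [LocallyOfFiniteType sY] (h : Scheme.BirationalOver sX sY) :
    topologicalKrullDim X = topologicalKrullDim Y := by
  obtain ⟨f, -⟩ := h
  rw [← topologicalKrullDim_opens_eq sX f.source f.dense_source.nonempty,
    ← topologicalKrullDim_opens_eq sY f.target f.dense_target.nonempty]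
  exact IsHomeomorph.topologicalKrullDim_eq _ f.iso.hom.homeomorph.isHomeomorph

end Dimension

end Unicritical
end

noncomputable section

namespace Unicritical

/-! ### Reducedness and irreducibility from a parametrization of local points -/

section Integral

lemma injective_map_of_eq_top {Y : Scheme.{0}} (O : Y.Opens) (hO : O = ⊤) :
    Function.Injective (Y.presheaf.map (homOfLE le_top : O ⟶ ⊤).op) := by
  subst hO
  have : (homOfLE le_top : (⊤ : Y.Opens) ⟶ ⊤) = 𝟙 _ := Subsingleton.elim _ _
  rw [this, op_id, CategoryTheory.Functor.map_id]
  exact fun _ _ h ↦ h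

variable {X : Scheme.{0}} {D : Type} [CommRing D] [IsDomain D] (ψ : Bool → (Spec (.of D) ⟶ X))

/-- If every point of `X` is hit by one of the morphisms `ψ r` at the level of local rings, then
`X` is reduced. -/
lemma isReduced_of_lifts
    (h : ∀ x : X, ∃ (r : Bool) (φ : Spec (X.presheaf.stalk x) ⟶ Spec (.of D)),
      X.fromSpecStalk x = φ ≫ ψ r) : IsReduced X := by
  have key : ∀ x : X, _root_.IsReduced (X.presheaf.stalk x) := fun x ↦ by
    obtain ⟨r, φ, hφ⟩ := h x
    refine ⟨fun t ht ↦ ?_⟩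
    obtain ⟨U, hxU, s, rfl⟩ := X.presheaf.exists_germ_eq t
    obtain ⟨n, hn⟩ := ht
    rw [← map_pow] at hn
    obtain ⟨V, hxV, i, j, e⟩ := X.presheaf.germ_eq x hxU hxU (s ^ n) 0 (hn.trans (map_zero _).symm)
    rw [map_zero, map_pow] at e
    -- A nilpotent section pulls back to zero on the domain D, and the map from the local scheme at
    -- x factors through it, so the germ is zero.
    have e2 : (ψ r).app V (X.presheaf.map i.op s) = 0 := by
      have : IsReduced (Spec (.of D)) := inferInstance
      have : _root_.IsReduced Γ(Spec (.of D), (ψ r) ⁻¹ᵁ V) := inferInstance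
      refine eq_zero_of_pow_eq_zero (n := n) ?_
      rw [← map_pow, e, map_zero]
    have e3 : (X.fromSpecStalk x).app V (X.presheaf.map i.op s) = 0 := by
      rw [hφ]
      exact (congrArg (φ.app _) e2).trans (map_zero _)
    rw [Scheme.fromSpecStalk_app hxV, CommRingCat.comp_apply, TopCat.Presheaf.germ_res_apply] at e3
    have hc : IsLocalRing.closedPoint (X.presheaf.stalk x) ∈ X.fromSpecStalk x ⁻¹ᵁ V := by
      have h4 : X.fromSpecStalk x (IsLocalRing.closedPoint _) ∈ V := by
        rw [Scheme.fromSpecStalk_closedPoint]; exact hxV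
      exact h4
    have e4 := injective_map_of_eq_top _ (IsLocalRing.closed_point_mem_iff.mp hc)
      (e3.trans (map_zero _).symm)
    exact (ConcreteCategory.bijective_of_isIso (Scheme.ΓSpecIso (X.presheaf.stalk x)).inv).1
      (e4.trans (map_zero _).symm)
  exact isReduced_of_isReduced_stalk X

/-- The image of the generic point of Spec D under ψ r specializes to every point hit by ψ r. By h'
the two such images specialize to each other, so either one is generic in X. -/
lemma irreducibleSpace_of_lifts
    (h : ∀ x : X, ∃ (r : Bool) (φ : Spec (X.presheaf.stalk x) ⟶ Spec (.of D)),
      X.fromSpecStalk x = φ ≫ ψ r)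
    (h' : ∀ r, ∃ y, ψ r y = ψ (!r) (genericPoint (Spec (.of D)))) : IrreducibleSpace X := by
  let η := genericPoint (Spec (.of D))
  have h1 : ∀ r y, ψ r η ⤳ ψ r y := fun r y ↦
    ((genericPoint_spec (Spec (.of D))).specializes trivial).map (ψ r).continuous
  have h2 : ∀ r, ψ r η ⤳ ψ (!r) η := fun r ↦ by
    obtain ⟨y, hy⟩ := h' r
    rw [← hy]
    exact h1 r y
  have h3 : ∀ x, ψ false η ⤳ x := fun x ↦ by
    obtain ⟨r, φ, hφ⟩ := h x
    have h4 : X.fromSpecStalk x (IsLocalRing.closedPoint _) = x := Scheme.fromSpecStalk_closedPoint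
    rw [hφ] at h4
    have h5 : ψ r η ⤳ x := h4 ▸ h1 r _
    cases r
    · exact h5
    · exact (h2 false).trans h5
  have : IsIrreducible (Set.univ : Set X) := by
    have h6 : closure {ψ false η} = Set.univ := Set.eq_univ_of_forall fun x ↦ (h3 x).mem_closure
    rw [← h6]
    exact isIrreducible_singleton.closure
  exact { isPreirreducible_univ := this.2, toNonempty := ⟨ψ false η⟩ }

end Integral

/-! ### A birationality criterion at generic points -/

section Birational

variable {X Y S : Scheme.{0}} [IsIntegral X] [IsIntegral Y] (sX : X ⟶ S) (sY : Y ⟶ S)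

instance isDominant_fromSpecStalkOfMem (U : X.Opens) (hU : genericPoint X ∈ U) :
    IsDominant (U.fromSpecStalkOfMem (genericPoint X) hU) := by
  have h : U.fromSpecStalkOfMem (genericPoint X) hU (IsLocalRing.closedPoint _) =
      ⟨genericPoint X, hU⟩ := by
    apply Subtype.ext
    have := congr($(U.fromSpecStalkOfMem_ι (genericPoint X) hU) (IsLocalRing.closedPoint _))
    exact this.trans Scheme.fromSpecStalk_closedPoint
  refine ⟨fun x ↦ ?_⟩
  have h2 : (⟨genericPoint X, hU⟩ : U) ⤳ x :=
    (Topology.IsInducing.subtypeVal.specializes_iff).mp ((genericPoint_spec X).specializes trivial)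
  exact closure_mono (Set.singleton_subset_iff.mpr (Set.mem_range.mpr ⟨_, h⟩)) h2.mem_closure

/-- A morphism which lifts the generic point of the target, such that points over the function
field of the source are determined by their image, is birational. -/
theorem birationalOver_of_lift [LocallyOfFiniteType sY] [IsSeparated sX] [IsSeparated sY]
    (ψ : Y ⟶ X) (hψ : ψ ≫ sX = sY)
    (φ : Spec (X.presheaf.stalk (genericPoint X)) ⟶ Y)
    (hφ : φ ≫ ψ = X.fromSpecStalk (genericPoint X))
    (huniq : ∀ a b : Spec (Y.presheaf.stalk (genericPoint Y)) ⟶ Y, a ≫ ψ = b ≫ ψ → a = b) :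
    Scheme.BirationalOver sX sY := by
  -- The lift of the generic point extends to a section g of ψ over a dense open V.
  obtain ⟨V, hV, g, hg, hgs⟩ := spread_out_of_isGermInjective' sX sY φ
    (by rw [← hψ, ← Category.assoc, hφ])
  have : IsIntegral V.toScheme := by
    have : Nonempty V := ⟨⟨_, hV⟩⟩
    infer_instance
  -- Both sides agree at the generic point, which is dominant in V, and the target is separated.
  have h1 : g ≫ ψ = V.ι := by
    refine ext_of_isDominant_of_isSeparated sX (by rw [Category.assoc, hψ, hgs])
      (V.fromSpecStalkOfMem (genericPoint X) hV) ?_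
    rw [← Category.assoc, ← hg, hφ, Scheme.Opens.fromSpecStalkOfMem_ι]
  let W : Y.Opens := ψ ⁻¹ᵁ V
  have hgW : Set.range g ⊆ Set.range W.ι := by
    rintro _ ⟨x, rfl⟩
    rw [Scheme.Opens.range_ι]
    have : (g ≫ ψ) x ∈ V := by rw [h1]; exact x.2
    exact this
  let g' : V.toScheme ⟶ W.toScheme := IsOpenImmersion.lift W.ι g hgW
  have hg' : g' ≫ W.ι = g := IsOpenImmersion.lift_fac _ _ _
  let ψ' : W.toScheme ⟶ V.toScheme := ψ ∣_ V
  have hψ' : ψ' ≫ V.ι = W.ι ≫ ψ := morphismRestrict_ι ψ V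
  have hWne : (W : Set Y).Nonempty := ⟨(g' ⟨_, hV⟩).1, (g' ⟨_, hV⟩).2⟩
  have hW : genericPoint Y ∈ W :=
    ((genericPoint_spec Y).mem_open_set_iff W.isOpen).mpr (by simpa using hWne)
  have : Nonempty W := ⟨⟨_, hW⟩⟩
  -- After composition with ψ both sides agree, so by `huniq` they agree at the generic point of Y;
  -- separatedness does the rest.
  have h2 : ψ' ≫ g = W.ι := by
    refine ext_of_isDominant_of_isSeparated sY
      (by rw [Category.assoc, hgs, ← Category.assoc, hψ', Category.assoc, hψ])
      (W.fromSpecStalkOfMem (genericPoint Y) hW) ?_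
    apply huniq
    simp only [Category.assoc, h1, hψ']
  refine ⟨⟨V, V.isOpen.dense ⟨_, hV⟩, W, W.isOpen.dense hWne, ⟨g', ψ', ?_, ?_⟩⟩, ?_⟩
  · rw [← cancel_mono V.ι, Category.assoc, hψ', ← Category.assoc, hg', h1, Category.id_comp]
  · rw [← cancel_mono W.ι, Category.assoc, hg', h2, Category.id_comp]
  · change g' ≫ W.ι ≫ sY = V.ι ≫ sX
    rw [← Category.assoc, hg', hgs]

end Birational

end Unicritical
end

noncomputable section

namespace Unicritical

/-! ### U_d as a quasi-projective scheme over 𝔽_p -/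

section Structure

variable {p : ℕ} [Fact p.Prime] {d : ℕ} (hd : 1 < d)

instance isImmersion_toProjSpace : IsImmersion (unicriticalLocus.toProjSpace p d hd) := by
  have h1 : IsImmersion (pullback.fst (omega p d hd) (curveι p d hd)) := inferInstance
  have h2 : IsImmersion (sepLocus p d).ι := inferInstance
  exact IsImmersion.comp (pullback.fst (omega p d hd) (curveι p d hd)) (sepLocus p d).ι

instance isSeparated_unicriticalLocus_toSpec : IsSeparated (unicriticalLocus.toSpec p d hd) := by
  rw [unicriticalLocus.toSpec]
  infer_instance

instance locallyOfFiniteType_unicriticalLocus_toSpec :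
    LocallyOfFiniteType (unicriticalLocus.toSpec p d hd) := by
  rw [unicriticalLocus.toSpec]
  infer_instance

/-- Immersions into the locally Noetherian space ℙ^{2d+1} are quasi-compact. -/
instance quasiCompact_unicriticalLocus_toSpec :
    QuasiCompact (unicriticalLocus.toSpec p d hd) := by
  have : IsLocallyNoetherian (ProjSpace (ZMod p) (CoeffIdx d)) :=
    LocallyOfFiniteType.isLocallyNoetherian (ProjSpace.toSpec (ZMod p) (CoeffIdx d))
  have h1 : QuasiCompact (unicriticalLocus.toProjSpace p d hd) :=
    inferInstanceAs (QuasiCompact (pullback.fst (omega p d hd) (curveι p d hd) ≫ (sepLocus p d).ι))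
  have h2 : QuasiCompact (ProjSpace.toSpec (ZMod p) (CoeffIdx d)) := inferInstance
  rw [unicriticalLocus.toSpec]
  infer_instance

lemma isQuasiProjectiveVariety_of_isIntegral [IsIntegral (unicriticalLocus p d hd)] :
    IsQuasiProjectiveVariety (unicriticalLocus.toSpec p d hd) where
  isIntegral := inferInstance
  isSeparated := inferInstance
  locallyOfFiniteType := inferInstance
  quasiCompact := inferInstance
  exists_immersion := ⟨CoeffIdx d, inferInstance, unicriticalLocus.toProjSpace p d hd,
    inferInstance, rfl⟩

variable {hd} in
-- Stalks of U_d carry no given 𝔽_p-algebra structure; the structure morphism provides one.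
lemma nonempty_algebra_of_point {B : Type} [CommRing B]
    (x : Spec (.of B) ⟶ unicriticalLocus p d hd) : Nonempty (Algebra (ZMod p) B) := by
  obtain ⟨χ, -⟩ := Spec.map_surjective (x ≫ unicriticalLocus.toSpec p d hd)
  exact ⟨χ.hom.toAlgebra⟩

end Structure

/-! ### Integrality of U_d and slices with constant α, β -/

namespace NormalForm

variable {p : ℕ} [Fact p.Prime] {d e ε k m : ℕ} (N : NormalForm p d e ε (p ^ k) m) (he : 0 < e)
  (hd : 1 < d) (hqm : p ^ k * m = 2 * d - 2)

/-- The universal unicritical function with arbitrary parameters `α` and `β`. -/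
def univLift (r : Bool) : Spec (.of (Localization.Away (N.univLoc he))) ⟶ unicriticalLocus p d hd :=
  N.lift he hd hqm r (algebraMap _ _) (IsLocalization.Away.algebraMap_isUnit _)

lemma lift_eq_comp_univLift {B : Type} [CommRing B] [Algebra (ZMod p) B] (r : Bool)
    (χ : ParamRing p e ε →+* B) (hu : IsUnit (χ (N.univLoc he))) :
    N.lift he hd hqm r χ hu = Spec.map (CommRingCat.ofHom (IsLocalization.Away.lift
      (S := Localization.Away (N.univLoc he)) (N.univLoc he) hu)) ≫ N.univLift he hd hqm r := by
  rw [univLift, map_comp_lift]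
  congr 1
  exact (IsLocalization.Away.lift_comp (N.univLoc he) hu).symm

/-- Every local-ring point factors through one of the two universal charts over the same domain, so
the criteria `isReduced_of_lifts` and `irreducibleSpace_of_lifts` apply. With α and β variable, no
choice between their values has to be made here. -/
theorem isIntegral_unicriticalLocus (hqm : p ^ k * m = 2 * d - 2) (hm : ¬ p ∣ m) (hε : ε ≤ 1) (h0 : N.univLoc he ≠ 0) :
    IsIntegral (unicriticalLocus p d hd) := by
  have hM : Submonoid.powers (N.univLoc he) ≤ nonZeroDivisors _ :=
    powers_le_nonZeroDivisors_of_noZeroDivisors h0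
  have : IsDomain (Localization.Away (N.univLoc he)) :=
    IsLocalization.isDomain_of_le_nonZeroDivisors _ hM
  have h1 : ∀ x : unicriticalLocus p d hd, ∃ (r : Bool)
      (φ : Spec ((unicriticalLocus p d hd).presheaf.stalk x) ⟶
        Spec (.of (Localization.Away (N.univLoc he)))),
      (unicriticalLocus p d hd).fromSpecStalk x = φ ≫ N.univLift he hd hqm r := fun x ↦ by
    let B : Type := (unicriticalLocus p d hd).presheaf.stalk x
    let f : Spec (.of B) ⟶ unicriticalLocus p d hd := (unicriticalLocus p d hd).fromSpecStalk x
    obtain ⟨_⟩ := nonempty_algebra_of_point f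
    obtain ⟨r, χ, hu, -, -, h⟩ := N.exists_eq_lift he hd hqm hm hε f
    exact ⟨r, _, h.trans (N.lift_eq_comp_univLift he hd hqm r χ hu)⟩
  have h2 : ∀ r, ∃ y, N.univLift he hd hqm r y = N.univLift he hd hqm (!r)
      (genericPoint (Spec (.of (Localization.Away (N.univLoc he))))) := fun r ↦ by
    let D := Localization.Away (N.univLoc he)
    let K := FractionRing D
    have hinj : Function.Injective (algebraMap D K) := IsFractionRing.injective D K
    have hinj' : Function.Injective (algebraMap (ParamRing p e ε) D) :=
      IsLocalization.injective D hM
    let χ : ParamRing p e ε →+* K := (algebraMap D K).comp (algebraMap _ D)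
    have hu : IsUnit (χ (N.univLoc he)) :=
      (IsLocalization.Away.algebraMap_isUnit (N.univLoc he)).map (algebraMap D K)
    -- S is a variable, hence nonzero at the generic point of either chart, so that point also lies
    -- in the other chart.
    have hS : IsUnit (parS (par χ)) := by
      refine isUnit_iff_ne_zero.mpr fun h ↦ ?_
      exact MvPolynomial.X_ne_zero (R := ZMod p) (.inl (.inr (.inl 1)) : FullIdx e ε)
        ((hinj.comp hinj') (h.trans (map_zero χ).symm))
    obtain ⟨χ', hu', h⟩ := N.exists_lift_eq_lift_not he hd hqm hε r χ hu hS
    rw [N.lift_eq_comp_univLift he hd hqm r χ'] at h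
    have h3 : N.lift he hd hqm (!r) χ hu = Spec.map (CommRingCat.ofHom (algebraMap D K)) ≫
        N.univLift he hd hqm (!r) := (N.map_comp_lift he hd hqm (!r) _ _ (algebraMap D K)).symm
    rw [h3] at h
    let c : Spec (.of K) := IsLocalRing.closedPoint K
    have hc : Spec.map (CommRingCat.ofHom (algebraMap D K)) c = genericPoint (Spec (.of D)) := by
      rw [genericPoint_eq_bot_of_affine]
      apply PrimeSpectrum.ext
      ext a
      have : algebraMap D K a ∈ IsLocalRing.maximalIdeal K ↔ a ∈ (0 : Ideal D) := by
        rw [IsLocalRing.maximalIdeal_eq_bot, Ideal.mem_bot, map_eq_zero_iff _ hinj]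
        rfl
      exact this
    refine ⟨_, (congr($h c).symm.trans ?_)⟩
    exact congrArg _ hc
  have := isReduced_of_lifts _ h1
  have := irreducibleSpace_of_lifts _ h1 h2
  exact isIntegral_of_irreducibleSpace_of_isReduced _

/-- Specialize the parameters `α` and `β` to constants. -/
def slice (p e ε : ℕ) [Fact p.Prime] (a b : ZMod p) :
    ParamRing p e ε →+* MvPolynomial (ParamIdx e ε) (ZMod p) :=
  (MvPolynomial.aeval (Sum.elim MvPolynomial.X ![MvPolynomial.C a, MvPolynomial.C b])).toRingHom

lemma eq_comp_slice {B : Type} [CommRing B] [Algebra (ZMod p) B] {a b : ZMod p}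
    (χ : ParamRing p e ε →+* B) (hα : parα (par χ) = algebraMap _ _ a)
    (hβ : parβ (par χ) = algebraMap _ _ b) :
    χ = ((MvPolynomial.aeval (R := ZMod p) fun i ↦ par χ (.inl i)).toRingHom).comp
      (slice p e ε a b) := by
  refine MvPolynomial.ringHom_ext' (Subsingleton.elim _ _) fun i ↦ ?_
  rw [RingHom.comp_apply]
  have h1 : slice p e ε a b (MvPolynomial.X i) = _ := MvPolynomial.aeval_X _ i
  rw [h1]
  rcases i with i | i
  · exact (MvPolynomial.aeval_X (R := ZMod p) (fun i ↦ par χ (.inl i)) i).symm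
  · fin_cases i
    · exact hα.trans (MvPolynomial.aeval_C _ a).symm
    · exact hβ.trans (MvPolynomial.aeval_C _ b).symm

/-- The universal unicritical function with fixed parameters `α` and `β`. -/
def sliceLift (a b : ZMod p) (r : Bool) :
    Spec (.of (Localization.Away (slice p e ε a b (N.univLoc he)))) ⟶ unicriticalLocus p d hd :=
  N.lift he hd hqm r ((algebraMap (MvPolynomial (ParamIdx e ε) (ZMod p)) _).comp (slice p e ε a b))
    (IsLocalization.Away.algebraMap_isUnit (slice p e ε a b (N.univLoc he)))

/-- The values of α and β can be taken in {0, 1}, hence come from 𝔽_p; so every field-valued point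
lies on a slice defined over 𝔽_p. -/
theorem exists_eq_comp_sliceLift (hm : ¬ p ∣ m) (hε : ε ≤ 1) {K : Type} [Field K]
    (x : Spec (.of K) ⟶ unicriticalLocus p d hd) :
    ∃ (a b : ZMod p) (r : Bool) (φ : Localization.Away (slice p e ε a b (N.univLoc he)) →+* K),
      x = Spec.map (CommRingCat.ofHom φ) ≫ N.sliceLift he hd hqm a b r := by
  obtain ⟨_⟩ := nonempty_algebra_of_point x
  obtain ⟨r, χ, hu, hα, hβ, h⟩ := N.exists_eq_lift he hd hqm hm hε x
  have h01 : ∀ t : K, t = 0 ∨ t = 1 → ∃ a : ZMod p, t = algebraMap (ZMod p) K a := by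
    rintro t (rfl | rfl)
    · exact ⟨0, (map_zero _).symm⟩
    · exact ⟨1, (map_one _).symm⟩
  obtain ⟨a, ha⟩ := h01 _ hα
  obtain ⟨b, hb⟩ := h01 _ hβ
  have hχ := eq_comp_slice χ ha hb
  have hu' : IsUnit ((MvPolynomial.aeval (R := ZMod p) fun i ↦ par χ (.inl i)).toRingHom
      (slice p e ε a b (N.univLoc he))) := by
    have := hu
    rw [hχ] at this
    exact this
  refine ⟨a, b, r, IsLocalization.Away.lift _ hu', ?_⟩
  rw [h, sliceLift, map_comp_lift]
  congr 1
  rw [← RingHom.comp_assoc, IsLocalization.Away.lift_comp]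
  exact hχ

lemma slice_surjective (a b : ZMod p) : Function.Surjective (slice p e ε a b) := fun x ↦
  ⟨MvPolynomial.rename Sum.inl x, by
    have : (MvPolynomial.aeval (R := ZMod p) (Sum.elim MvPolynomial.X
      ![MvPolynomial.C a, MvPolynomial.C b] : FullIdx e ε → MvPolynomial (ParamIdx e ε) (ZMod p)))
      (MvPolynomial.rename Sum.inl x) = x := by
      rw [MvPolynomial.aeval_rename]
      exact MvPolynomial.aeval_X_left_apply x
    exact this⟩

/-- With α and β constant, `lift_injective` recovers all remaining parameters. This is what makes a
slice birational onto its image. -/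
theorem sliceLift_injective (hm : ¬ p ∣ m) (hε : ε ≤ 1) {L : Type} [Field L] (a b : ZMod p)
    (r : Bool) (φ φ' : Localization.Away (slice p e ε a b (N.univLoc he)) →+* L)
    (h : Spec.map (CommRingCat.ofHom φ) ≫ N.sliceLift he hd hqm a b r =
      Spec.map (CommRingCat.ofHom φ') ≫ N.sliceLift he hd hqm a b r) : φ = φ' := by
  obtain ⟨_⟩ := nonempty_algebra_of_point (Spec.map (CommRingCat.ofHom φ) ≫ N.sliceLift he hd hqm a b r)
  rw [sliceLift, map_comp_lift, map_comp_lift] at h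
  have hpar : ∀ (i : Fin 2),
      par ((φ.comp (algebraMap _ _)).comp (slice p e ε a b)) (.inr i) =
      par ((φ'.comp (algebraMap _ _)).comp (slice p e ε a b)) (.inr i) := fun i ↦ by
    have h1 : slice p e ε a b (MvPolynomial.X (.inr i)) = MvPolynomial.C (![a, b] i) := by
      refine (MvPolynomial.aeval_X _ _).trans ?_
      fin_cases i <;> rfl
    have h2 : ((φ.comp (algebraMap (MvPolynomial (ParamIdx e ε) (ZMod p)) _)).comp MvPolynomial.C) =
        ((φ'.comp (algebraMap (MvPolynomial (ParamIdx e ε) (ZMod p)) _)).comp MvPolynomial.C) :=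
      Subsingleton.elim _ _
    simp only [par, univPar, Function.comp_apply, RingHom.comp_apply, h1]
    exact RingHom.congr_fun h2 _
  have h2 := N.lift_injective he hd hqm hm hε r _ _ (hpar 0) (hpar 1) h
  refine IsLocalization.ringHom_ext (Submonoid.powers (slice p e ε a b (N.univLoc he))) ?_
  refine RingHom.ext fun x ↦ ?_
  obtain ⟨y, rfl⟩ := slice_surjective a b x
  exact RingHom.congr_fun h2 y

end NormalForm

end Unicritical
end

noncomputable section

/-! ### Rationality, dimension, and the assembly of the cases -/

namespace Unicritical

/-- A nonempty principal open subset of affine space is birational to affine space. -/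
lemma birationalOver_affineSpace {R σ : Type} [CommRing R] [IsDomain R] [Fintype σ] {n : ℕ}
    (hn : Fintype.card σ = n) (h : MvPolynomial σ R) (h0 : Nontrivial (Localization.Away h)) :
    Scheme.BirationalOver
      (Spec.map (CommRingCat.ofHom (algebraMap R (Localization.Away h))))
      (𝔸(Fin n; Spec (.of R)) ↘ Spec (.of R)) := by
  let ρ : MvPolynomial (Fin n) R ≃ₐ[R] MvPolynomial σ R :=
    MvPolynomial.renameEquiv R (Fintype.equivFinOfCardEq hn).symm
  let f₁ : Spec (.of (Localization.Away h)) ⟶ Spec (.of (MvPolynomial σ R)) :=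
    Spec.map (CommRingCat.ofHom (algebraMap _ _))
  let f₂ : Spec (.of (MvPolynomial σ R)) ⟶ Spec (.of (MvPolynomial (Fin n) R)) :=
    Spec.map (CommRingCat.ofHom ρ.toRingEquiv.toRingHom)
  have : IsIso (CommRingCat.ofHom ρ.toRingEquiv.toRingHom) :=
    inferInstanceAs (IsIso ρ.toRingEquiv.toCommRingCatIso.hom)
  let f : Spec (.of (Localization.Away h)) ⟶ 𝔸(Fin n; Spec (.of R)) :=
    f₁ ≫ f₂ ≫ (AffineSpace.SpecIso (Fin n) (.of R)).inv
  have h1 : IsOpenImmersion f₁ := inferInstance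
  have h2 : IsOpenImmersion f₂ := inferInstance
  have h3 : IsOpenImmersion f := inferInstance
  have : Nonempty (Spec (.of (Localization.Away h))) :=
    inferInstanceAs (Nonempty (PrimeSpectrum (Localization.Away h)))
  have h4 : IsDominant f :=
    ⟨f.isOpenEmbedding.isOpen_range.dense (Set.range_nonempty _)⟩
  refine Scheme.Hom.birationalOver f _ _ ?_
  simp only [f, f₁, f₂, Category.assoc, AffineSpace.SpecIso_inv_over, ← Spec.map_comp,
    ← CommRingCat.ofHom_comp]
  congr 2
  refine RingHom.ext fun r ↦ ?_
  change algebraMap _ _ (ρ (MvPolynomial.C r)) = _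
  rw [IsScalarTower.algebraMap_apply R (MvPolynomial σ R) (Localization.Away h)]
  congr 1
  exact ρ.commutes r

lemma topologicalKrullDim_affineSpace (k : Type) [Field k] (n : ℕ) :
    topologicalKrullDim 𝔸(Fin n; Spec (.of k)) = ((n : ℕ) : WithBot ℕ∞) := by
  have h1 : topologicalKrullDim 𝔸(Fin n; Spec (.of k)) =
      topologicalKrullDim (PrimeSpectrum (MvPolynomial (Fin n) k)) :=
    IsHomeomorph.topologicalKrullDim_eq _
      (AffineSpace.SpecIso (Fin n) (.of k)).hom.homeomorph.isHomeomorph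
  rw [h1, PrimeSpectrum.topologicalKrullDim_eq_ringKrullDim,
    MvPolynomial.ringKrullDim_of_isNoetherianRing, ringKrullDim_eq_zero_of_field]
  simp

section

variable {p : ℕ} [Fact p.Prime] {d : ℕ}

/-- The generic point of U_d lies on some slice, whichever it is. That slice is a nonempty principal
open subset of affine space, and its map to U_d satisfies `birationalOver_of_lift`. The coordinates
number e + (e + 1) + 2 + ε. -/
theorem NormalForm.birationalOver {e ε k m : ℕ} (N : NormalForm p d e ε (p ^ k) m) (he : 0 < e)
    (hd : 1 < d) (hqm : p ^ k * m = 2 * d - 2) (hm : ¬ p ∣ m) (hε : ε ≤ 1)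
    [IsIntegral (unicriticalLocus p d hd)] :
    Scheme.BirationalOver (unicriticalLocus.toSpec p d hd)
      (𝔸(Fin (2 * e + 3 + ε); Spec (.of (ZMod p))) ↘ Spec (.of (ZMod p))) := by
  let U := unicriticalLocus p d hd
  let K : Type := U.presheaf.stalk (genericPoint U)
  let _ : Field K := inferInstanceAs (Field U.functionField)
  let x : Spec (.of K) ⟶ U := U.fromSpecStalk (genericPoint U)
  obtain ⟨a, b, r, φ, h⟩ := N.exists_eq_comp_sliceLift he hd hqm hm hε x
  let D := Localization.Away (slice p e ε a b (N.univLoc he))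
  have hD : Nontrivial D := φ.domain_nontrivial
  have hs : slice p e ε a b (N.univLoc he) ≠ 0 := fun h0 ↦ by
    have := IsLocalization.Away.algebraMap_isUnit (S := D) (slice p e ε a b (N.univLoc he))
    have e0 := (congrArg (algebraMap (MvPolynomial (ParamIdx e ε) (ZMod p)) D) h0).trans (map_zero _)
    exact not_isUnit_zero (e0 ▸ this)
  have : IsDomain D := IsLocalization.isDomain_of_le_nonZeroDivisors D
    (powers_le_nonZeroDivisors_of_noZeroDivisors hs)
  have : LocallyOfFiniteType (Spec.map (CommRingCat.ofHom (algebraMap (ZMod p) D))) := by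
    have : Algebra.FiniteType (MvPolynomial (ParamIdx e ε) (ZMod p)) D :=
      IsLocalization.finiteType_of_monoid_fg (Submonoid.powers (slice p e ε a b (N.univLoc he))) D
    have : Algebra.FiniteType (ZMod p) D :=
      .trans (S := MvPolynomial (ParamIdx e ε) (ZMod p)) inferInstance inferInstance
    rw [HasRingHomProperty.Spec_iff (P := @LocallyOfFiniteType)]
    exact (RingHom.finiteType_algebraMap (A := ZMod p) (B := D)).mpr this
  have h1 : Scheme.BirationalOver (unicriticalLocus.toSpec p d hd)
      (Spec.map (CommRingCat.ofHom (algebraMap (ZMod p) D))) := by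
    refine birationalOver_of_lift _ _ (N.sliceLift he hd hqm a b r) (N.lift_toSpec he hd hqm r _ _)
      (Spec.map (CommRingCat.ofHom φ)) h.symm fun y z hyz ↦ ?_
    let L : Type := (Spec (.of D)).presheaf.stalk (genericPoint (Spec (.of D)))
    let _ : Field L := inferInstanceAs (Field (Spec (.of D)).functionField)
    obtain ⟨y', rfl⟩ := Spec.map_surjective y
    obtain ⟨z', rfl⟩ := Spec.map_surjective z
    have h2 := N.sliceLift_injective he hd hqm hm hε (L := L) a b r y'.hom z'.hom hyz
    rw [CommRingCat.hom_ext h2]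
  refine h1.trans (birationalOver_affineSpace ?_ _ hD)
  simp only [Fintype.card_sum, Fintype.card_fin]
  omega

theorem NormalForm.unicriticalLocus_geometry {e ε k m n : ℕ} (N : NormalForm p d e ε (p ^ k) m) (he : 0 < e)
    (hd : 1 < d) (hqm : p ^ k * m = 2 * d - 2) (hm : ¬ p ∣ m) (hε : ε ≤ 1)
    (hne : ∃ f g : Polynomial (ZMod p), IsUnicrit d (p ^ k) m f g) (hn : 2 * e + 3 + ε = n) :
    IsQuasiProjectiveVariety (unicriticalLocus.toSpec p d hd) ∧
      IrreducibleSpace (unicriticalLocus p d hd) ∧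
      IsRational (unicriticalLocus.toSpec p d hd) ∧
      topologicalKrullDim (unicriticalLocus p d hd) = ((n : ℕ) : WithBot ℕ∞) := by
  subst hn
  -- The explicit unicritical function is a specialization at which the inverted element becomes a
  -- unit.
  have h0 : N.univLoc he ≠ 0 := fun h0 ↦ by
    obtain ⟨f, g, h⟩ := hne
    obtain ⟨φ, -, -, hu, -⟩ := N.exists_specialization he hε h
    rw [h0, map_zero] at hu
    exact not_isUnit_zero hu
  have := N.isIntegral_unicriticalLocus he hd hqm hm hε h0
  have hb := N.birationalOver he hd hqm hm hε
  refine ⟨isQuasiProjectiveVariety_of_isIntegral hd, inferInstance, ⟨_, hb⟩, ?_⟩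
  have : LocallyOfFiniteType (𝔸(Fin (2 * e + 3 + ε); Spec (.of (ZMod p))) ↘ Spec (.of (ZMod p))) :=
    inferInstance
  rw [topologicalKrullDim_eq_of_birationalOver _ _ hb]
  exact topologicalKrullDim_affineSpace (ZMod p) _

/-- As 2 divides d or d - 1, the hypotheses force p ≠ 2, so p ∤ 2d - 2 and k = 0. The stalk at a
point would then carry a unicritical function excluded by `IsUnicrit.false_of_not_dvd`. -/
theorem isEmpty_unicriticalLocus (hd : 1 < d) (h0 : ¬ p ∣ d) (h1 : ¬ p ∣ d - 1) :
    IsEmpty (unicriticalLocus p d hd) := by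
  have hp := (Fact.out : p.Prime)
  refine ⟨fun x ↦ ?_⟩
  let B : Type := (unicriticalLocus p d hd).presheaf.stalk x
  let y : Spec (.of B) ⟶ unicriticalLocus p d hd := (unicriticalLocus p d hd).fromSpecStalk x
  obtain ⟨_⟩ := nonempty_algebra_of_point y
  have hp2 : ¬ p ∣ 2 := fun h ↦ by
    obtain rfl := (Nat.prime_dvd_prime_iff_eq hp Nat.prime_two).mp h
    omega
  have hm : ¬ p ∣ 2 * d - 2 := fun h ↦ by
    rw [show 2 * d - 2 = 2 * (d - 1) by omega] at h
    exact (hp.dvd_mul.mp h).elim hp2 h1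
  obtain ⟨f, g, h, -, hW, h2, h3⟩ := exists_isRat_of_point (k := 0) hd (by simp) hm y
  rw [pow_zero] at h2 h3
  rcases hW with hW | hW
  · exact (h2 hW).false_of_not_dvd hd h0 h1
  · exact (h3 hW).false_of_not_dvd hd h0 h1

/-- Split off the largest power of `p`. -/
lemma exists_pow_mul_eq (hd : 1 < d) : ∃ k m : ℕ, p ^ k * m = 2 * d - 2 ∧ ¬ p ∣ m := by
  obtain ⟨k, m, hm, h⟩ := Nat.exists_eq_pow_mul_and_not_dvd (n := 2 * d - 2) (by omega) p
    (Fact.out : p.Prime).ne_one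
  exact ⟨k, m, h.symm, hm⟩

theorem unicriticalLocus_geometry_of_dvd (hd : 1 < d) (h : p ∣ d) :
    IsQuasiProjectiveVariety (unicriticalLocus.toSpec p d hd) ∧
      IrreducibleSpace (unicriticalLocus p d hd) ∧
      IsRational (unicriticalLocus.toSpec p d hd) ∧
      topologicalKrullDim (unicriticalLocus p d hd) = ((3 + 2 * d / p : ℕ) : WithBot ℕ∞) := by
  have hp := (Fact.out : p.Prime)
  obtain ⟨e, he⟩ := h
  have he0 : 0 < e := Nat.pos_of_ne_zero (by rintro rfl; omega)
  have hn : 2 * e + 3 + 0 = 3 + 2 * d / p := by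
    rw [he, show 2 * (p * e) = p * (2 * e) by ring, Nat.mul_div_cancel_left _ hp.pos]
    ring
  by_cases hp2 : p = 2
  · obtain ⟨k, m, hqm, hm⟩ := exists_pow_mul_eq (p := p) hd
    -- For p = 2 the number 2d - 2 is even, so q is divisible by p and W is a polynomial in z^p.
    obtain ⟨k, rfl⟩ : ∃ k', k = k' + 1 := by
      rcases k with - | k
      · rw [pow_zero, one_mul] at hqm
        exact absurd ⟨d - 1, by rw [hqm, hp2]; omega⟩ hm
      · exact ⟨k, rfl⟩
    exact (normalFormOfTwoDvd hp2 he0 he hqm).unicriticalLocus_geometry he0 hd hqm hm zero_le_one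
      (exists_isUnicrit_of_dvd he0 he hqm) hn
  -- For odd p dividing d, p cannot divide 2(d - 1), so q = 1.
  · have hm : ¬ p ∣ 2 * d - 2 := fun h ↦ by
      rw [show 2 * d - 2 = 2 * (d - 1) by omega] at h
      rcases hp.dvd_mul.mp h with h | h
      · exact hp2 ((Nat.prime_dvd_prime_iff_eq hp Nat.prime_two).mp h)
      · have := (Nat.dvd_sub (Dvd.intro e he.symm) h)
        rw [Nat.sub_sub_self hd.le] at this
        exact hp.one_lt.ne' (Nat.dvd_one.mp this)
    exact NormalForm.unicriticalLocus_geometry (k := 0) (normalFormOfOddDvd hp2 he0 he) he0 hd (by simp) hm zero_le_one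
      (exists_isUnicrit_of_dvd he0 he (by simp)) hn

theorem unicriticalLocus_geometry_of_dvd_sub_one (hd : 1 < d) (h : p ∣ d - 1) :
    IsQuasiProjectiveVariety (unicriticalLocus.toSpec p d hd) ∧
      IrreducibleSpace (unicriticalLocus p d hd) ∧
      IsRational (unicriticalLocus.toSpec p d hd) ∧
      topologicalKrullDim (unicriticalLocus p d hd) =
        ((4 + 2 * (d - 1) / p : ℕ) : WithBot ℕ∞) := by
  have hp := (Fact.out : p.Prime)
  obtain ⟨e, he⟩ := h
  have he0 : 0 < e := Nat.pos_of_ne_zero (by rintro rfl; omega)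
  have hde : d = p * e + 1 := by omega
  have hn : 2 * e + 3 + 1 = 4 + 2 * (d - 1) / p := by
    rw [he, show 2 * (p * e) = p * (2 * e) by ring, Nat.mul_div_cancel_left _ hp.pos]
    ring
  obtain ⟨k, m, hqm, hm⟩ := exists_pow_mul_eq (p := p) hd
  -- Here 2d - 2 = 2pe is divisible by p for every prime p, so q is again divisible by p.
  obtain ⟨k, rfl⟩ : ∃ k', k = k' + 1 := by
    rcases k with - | k
    · rw [pow_zero, one_mul] at hqm
      refine absurd ⟨2 * e, ?_⟩ hm
      rw [hqm, show 2 * d - 2 = 2 * (d - 1) by omega, he]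
      ring
    · exact ⟨k, rfl⟩
  exact (normalFormOfDvdSubOne he0 hde hqm).unicriticalLocus_geometry he0 hd hqm hm le_rfl
    (exists_isUnicrit_of_dvd_sub_one he0 hde hqm) hn

end

end Unicritical

end

theorem theorem1p3 (p : ℕ) [Fact p.Prime] (d : ℕ) (hd : 1 < d) :
    (¬ (d ≡ 0 [MOD p] ∨ d ≡ 1 [MOD p]) → IsEmpty (Unicritical.unicriticalLocus p d hd)) ∧
    ((d ≡ 0 [MOD p] ∨ d ≡ 1 [MOD p]) →
      Unicritical.IsQuasiProjectiveVariety (Unicritical.unicriticalLocus.toSpec p d hd) ∧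
      IrreducibleSpace (Unicritical.unicriticalLocus p d hd) ∧
      Unicritical.IsRational (Unicritical.unicriticalLocus.toSpec p d hd) ∧
      (p ∣ d → topologicalKrullDim (Unicritical.unicriticalLocus p d hd) =
        ((3 + 2 * d / p : ℕ) : WithBot ℕ∞)) ∧
      (p ∣ d - 1 → topologicalKrullDim (Unicritical.unicriticalLocus p d hd) =
        ((4 + 2 * (d - 1) / p : ℕ) : WithBot ℕ∞))) := by
  have h0 : d ≡ 0 [MOD p] ↔ p ∣ d := Nat.modEq_zero_iff_dvd
  have h1 : d ≡ 1 [MOD p] ↔ p ∣ d - 1 := by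
    rw [Nat.ModEq.comm, Nat.modEq_iff_dvd' hd.le]
  rw [h0, h1]
  refine ⟨fun h ↦ Unicritical.isEmpty_unicriticalLocus hd (fun h2 ↦ h (.inl h2))
    fun h2 ↦ h (.inr h2), fun h ↦ ?_⟩
  have key : Unicritical.IsQuasiProjectiveVariety (Unicritical.unicriticalLocus.toSpec p d hd) ∧
      IrreducibleSpace (Unicritical.unicriticalLocus p d hd) ∧
      Unicritical.IsRational (Unicritical.unicriticalLocus.toSpec p d hd) := by
    rcases h with h | h
    · obtain ⟨a, b, c, -⟩ := Unicritical.unicriticalLocus_geometry_of_dvd hd h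
      exact ⟨a, b, c⟩
    · obtain ⟨a, b, c, -⟩ := Unicritical.unicriticalLocus_geometry_of_dvd_sub_one hd h
      exact ⟨a, b, c⟩
  exact ⟨key.1, key.2.1, key.2.2, fun h ↦ (Unicritical.unicriticalLocus_geometry_of_dvd hd h).2.2.2,
    fun h ↦ (Unicritical.unicriticalLocus_geometry_of_dvd_sub_one hd h).2.2.2⟩
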